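/- Let $n\ge 0$, let $M^{n+1}$ be a closed connected smooth Riemannian manifold, and let $A\in\mathbb R$. There is a constant $\delta>0$, depending only on $M$ (with its metric) and $A$, with the following property. Let $\Sigma^n$ be a closed smooth manifold (not necessarily connected) and let $\varphi\colon\Sigma\to M$ be a smooth almost embedding: $\varphi$ is an immersion, and every point of $\Lambda=\varphi(\Sigma)$ has an open neighborhood $W$ such that $\varphi^{-1}(W)$ is a disjoint union of finitely many connected open sets $\Sigma_1,\dots,\Sigma_l$, each $\varphi|_{\Sigma_i}$ is an embedding, and for $i\ne j$ the sheet $\varphi(\Sigma_j)$ lies on one side of the sheet $\varphi(\Sigma_i)$ in $W$ (sheets may touch but not cross). Let $\Omega\subset M$ be a measurable set such that $\Lambda=\partial\Omega$ with multiplicity one; that is, $\Lambda$ is the set of points all of whose neighborhoods meet both $\Omega$ and $M\setminus\Omega$ in positive volume, and the points $x\in\Sigma$ with $\varphi^{-1}(\varphi(x))=\{x\}$ (the regular points) are dense in $\Sigma$. Assume that - the mean curvature vector of $\varphi$ vanishes nowhere, and it points into $\Omega$ at all regular points, or points out of $\Omega$ at all regular points; - $\operatorname{Area}(\Lambda)\le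 A$, where $\operatorname{Area}$ is the $n$-dimensional Hausdorff measure; - $\frac13\operatorname{Vol}(M)\le\operatorname{Vol}(\Omega)\le\frac23\operatorname{Vol}(M)$. Then $\Lambda$ has a component of extrinsic diameter at least $\delta$: there is a connected component $\Sigma'$ of $\Sigma$ such that the diameter of $\varphi(\Sigma')$ in the Riemannian distance of $M$ is at least $\delta$. -/

import Mathlib

open Set Function Bundle MeasureTheory Manifold
open scoped Topology ENNReal ContDiff

noncomputable section

namespace SmallComponents

/-! ### Hypersurfaces in an `(n+1)`-dimensional manifold -/

section Hypersurface

variable {n : ℕ}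
  {M : Type*} [TopologicalSpace M] [ChartedSpace (EuclideanSpace ℝ (Fin (n + 1))) M]
  {S : Type*} [TopologicalSpace S] [ChartedSpace (EuclideanSpace ℝ (Fin n)) S]

/-- A smooth immersion `φ : S → M` of an `n`-manifold into an `(n+1)`-manifold is an *almost
embedding* if every point of the image has an open neighbourhood `W` such that `φ ⁻¹(W)` is a
disjoint union of finitely many connected open pieces `U i`, each of which is embedded by `φ`, and
such that each sheet `φ(U j)` lies on one side of each other sheet `φ(U i)` in `W`: the sheet
`φ(U i)` is the regular zero set of a smooth function `f i` on `W`, whose two sides are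
`{f i > 0}` and `{f i < 0}`.  Thus sheets may touch, but they do not cross. -/
structure IsAlmostEmbedding (φ : S → M) : Prop where
  contMDiff : ContMDiff (𝓡 n) (𝓡 (n + 1)) ∞ φ
  immersion : ∀ x, Injective (mfderiv (𝓡 n) (𝓡 (n + 1)) φ x)
  sheets : ∀ p ∈ range φ, ∃ W : Set M, IsOpen W ∧ p ∈ W ∧
    ∃ (l : ℕ) (U : Fin l → Set S) (f : Fin l → M → ℝ),
      (∀ i, IsOpen (U i) ∧ IsConnected (U i)) ∧
      Pairwise (fun i j => Disjoint (U i) (U j)) ∧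
      (⋃ i, U i) = φ ⁻¹' W ∧
      (∀ i, Topology.IsEmbedding ((U i).domRestrict φ)) ∧
      ∀ i, ContMDiffOn (𝓡 (n + 1)) 𝓘(ℝ) ∞ (f i) W ∧
        (∀ q ∈ W, f i q = 0 → mfderiv (𝓡 (n + 1)) 𝓘(ℝ) (f i) q ≠ 0) ∧
        φ '' U i = {q ∈ W | f i q = 0} ∧
        ∀ j, j ≠ i → (∀ q ∈ φ '' U j, 0 ≤ f i q) ∨ (∀ q ∈ φ '' U j, f i q ≤ 0)

end Hypersurface

/-- The points of `S` that do not lie over the touching set of `φ`.  (For an immersion of a compact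
manifold, these are the points over which the image is embedded.) -/
def regularPoints {S M : Type*} (φ : S → M) : Set S :=
  {x | ∀ y, φ y = φ x → y = x}

/-! ### Caccioppoli sets and their boundaries -/

section Boundary

variable {n : ℕ} {M : Type*} [MetricSpace M] [MeasurableSpace M] [BorelSpace M]

/-- The support of the boundary of `Ω`, a set which is only relevant up to null sets of the
`d`-dimensional volume: the points all of whose neighbourhoods meet both `Ω` and its complement in
positive volume. -/
def boundarySupport (d : ℕ) (Ω : Set M) : Set M :=
  {p | ∀ U ∈ 𝓝 p, 0 < μHE[d] (U ∩ Ω) ∧ 0 < μHE[d] (U \ Ω)}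

/-- The hypersurface given by `φ : S → M` (with `dim M = n + 1`) is the boundary of `Ω`, with
multiplicity one: its image is the boundary of `Ω`, and `φ` does not cover a piece of its image
more than once, i.e. the preimage of the touching set has empty interior in `S`. -/
structure IsBoundaryOf {S : Type*} [TopologicalSpace S] (n : ℕ) (φ : S → M) (Ω : Set M) :
    Prop where
  range_eq : range φ = boundarySupport (n + 1) Ω
  multiplicity_one : Dense (regularPoints φ)

/-- The tangent vector `w` at `p` is transverse to the boundary of `Ω` near `p` and points into `Ω`:
near `p`, up to a null set, `Ω` is the set where a smooth function vanishing at `p` is positive,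
and the derivative of this function in direction `w` is positive. -/
def PointsInto [ChartedSpace (EuclideanSpace ℝ (Fin (n + 1))) M]
    (Ω : Set M) (p : M) (w : TangentSpace (𝓡 (n + 1)) p) : Prop :=
  ∃ f : M → ℝ, ContMDiffAt (𝓡 (n + 1)) 𝓘(ℝ) ∞ f p ∧ f p = 0 ∧
    (0 : ℝ) < mfderiv (𝓡 (n + 1)) 𝓘(ℝ) f p w ∧
    ∃ U ∈ 𝓝 p, ∀ᵐ q ∂(μHE[n + 1] : Measure M), q ∈ U → (q ∈ Ω ↔ 0 < f q)

end Boundary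

/-! ### Mean curvature -/

section MeanCurvature

variable {n : ℕ}
  {M : Type*} [TopologicalSpace M] [ChartedSpace (EuclideanSpace ℝ (Fin (n + 1))) M]
  [RiemannianBundle (fun p : M => TangentSpace (𝓡 (n + 1)) p)]
  {S : Type*} [TopologicalSpace S] [ChartedSpace (EuclideanSpace ℝ (Fin n)) S]

/-- The Riemannian metric of `M` in the preferred chart around `p`:
`chartMetric p y v w = g_{ij}(y) v^i w^j`. -/
def chartMetric (p : M) (y v w : EuclideanSpace ℝ (Fin (n + 1))) : ℝ :=
  inner ℝ
    (mfderiv 𝓘(ℝ, EuclideanSpace ℝ (Fin (n + 1))) (𝓡 (n + 1))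
      (extChartAt (𝓡 (n + 1)) p).symm y v)
    (mfderiv 𝓘(ℝ, EuclideanSpace ℝ (Fin (n + 1))) (𝓡 (n + 1))
      (extChartAt (𝓡 (n + 1)) p).symm y w)

/-- The Christoffel symbols of the first kind of the Levi-Civita connection in the preferred chart
around `p`: `christoffel p y a b w = g_y(Γ_y(a, b), w)
= (∂_a g(b, w) + ∂_b g(a, w) - ∂_w g(a, b)) / 2`. -/
def christoffel (p : M) (y a b w : EuclideanSpace ℝ (Fin (n + 1))) : ℝ :=
  (fderiv ℝ (fun z => chartMetric p z b w) y a + fderiv ℝ (fun z => chartMetric p z a w) y b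
    - fderiv ℝ (fun z => chartMetric p z a b) y w) / 2

/-- The map `φ : S → M` in the preferred charts around `x` and `φ x`. -/
def inCharts (φ : S → M) (x : S) : EuclideanSpace ℝ (Fin n) → EuclideanSpace ℝ (Fin (n + 1)) :=
  extChartAt (𝓡 (n + 1)) (φ x) ∘ φ ∘ (extChartAt (𝓡 n) x).symm

/-- The `i`-th partial derivative at `u` of `φ` in the preferred charts around `x` and `φ x`. -/
def partialDeriv (φ : S → M) (x : S) (i : Fin n) (u : EuclideanSpace ℝ (Fin n)) :
    EuclideanSpace ℝ (Fin (n + 1)) :=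
  fderiv ℝ (inCharts φ x) u (EuclideanSpace.single i 1)

/-- The first fundamental form `G_{ij} = g(∂_i φ, ∂_j φ)` at `x`, in the preferred charts. -/
def firstFundamentalForm (φ : S → M) (x : S) : Matrix (Fin n) (Fin n) ℝ :=
  Matrix.of fun i j =>
    chartMetric (φ x) (extChartAt (𝓡 (n + 1)) (φ x) (φ x))
      (partialDeriv φ x i (extChartAt (𝓡 n) x x)) (partialDeriv φ x j (extChartAt (𝓡 n) x x))

/-- The second fundamental form `h_{ij} = g(∇_{∂_i} ∂_j φ, w)` at `x` in direction of the normal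
vector `w`, in the preferred charts. -/
def secondFundamentalForm (φ : S → M) (x : S) (w : TangentSpace (𝓡 (n + 1)) (φ x)) :
    Matrix (Fin n) (Fin n) ℝ :=
  let u : EuclideanSpace ℝ (Fin n) := extChartAt (𝓡 n) x x
  let y : EuclideanSpace ℝ (Fin (n + 1)) := extChartAt (𝓡 (n + 1)) (φ x) (φ x)
  let w' : EuclideanSpace ℝ (Fin (n + 1)) :=
    mfderiv (𝓡 (n + 1)) 𝓘(ℝ, EuclideanSpace ℝ (Fin (n + 1))) (extChartAt (𝓡 (n + 1)) (φ x)) (φ x) w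
  Matrix.of fun i j =>
    chartMetric (φ x) y (fderiv ℝ (partialDeriv φ x j) u (EuclideanSpace.single i 1)) w'
      + christoffel (φ x) y (partialDeriv φ x i u) (partialDeriv φ x j u) w'

/-- The vector `w` at `φ x` is normal to the sheet of the hypersurface through `x`. -/
def IsNormal (φ : S → M) (x : S) (w : TangentSpace (𝓡 (n + 1)) (φ x)) : Prop :=
  ∀ v : TangentSpace (𝓡 n) x, inner ℝ (mfderiv (𝓡 n) (𝓡 (n + 1)) φ x v) w = 0

/-- The mean curvature `g(H(x), w)` of the immersed hypersurface `φ` at `x` in direction of the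
normal vector `w`, where `H` is the mean curvature vector: the trace `G^{ij} h_{ij}` of the second
fundamental form.  The round sphere has positive mean curvature in the inward direction. -/
def meanCurvature (φ : S → M) (x : S) (w : TangentSpace (𝓡 (n + 1)) (φ x)) : ℝ :=
  ((firstFundamentalForm φ x)⁻¹ * secondFundamentalForm φ x w).trace

end MeanCurvature

section Direction

variable (n : ℕ)
  {M : Type*} [MetricSpace M]
  [ChartedSpace (EuclideanSpace ℝ (Fin (n + 1))) M]
  [RiemannianBundle (fun p : M => TangentSpace (𝓡 (n + 1)) p)]
  {S : Type*} [TopologicalSpace S] [ChartedSpace (EuclideanSpace ℝ (Fin n)) S]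

/-- The mean curvature vector of `φ` does not vanish at any point. -/
def NonvanishingMeanCurvature (φ : S → M) : Prop :=
  ∀ x, ∃ w, IsNormal (n := n) φ x w ∧ meanCurvature φ x w ≠ 0

variable [MeasurableSpace M] [BorelSpace M]

/-- The mean curvature vector points into `Ω` at every point off the touching set: the mean
curvature with respect to the normal pointing into `Ω` is positive. -/
def MeanCurvaturePointsInto (φ : S → M) (Ω : Set M) : Prop :=
  ∀ x ∈ regularPoints φ, ∀ w, IsNormal (n := n) φ x w → PointsInto Ω (φ x) w → 0 < meanCurvature φ x w

/-- The mean curvature vector points out of `Ω` at every point off the touching set: the mean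
curvature with respect to the normal pointing into `Ω` is negative. -/
def MeanCurvaturePointsOutOf (φ : S → M) (Ω : Set M) : Prop :=
  ∀ x ∈ regularPoints φ, ∀ w, IsNormal (n := n) φ x w → PointsInto Ω (φ x) w → meanCurvature φ x w < 0

end Direction

end SmallComponents

end

/-!
# Boundaries with nonvanishing mean curvature have a component of definite size

Let `Λ = φ(S)` be the boundary of `Ω`, and suppose that all components of `Λ` are small.  After
exchanging `Ω` and its complement, the mean curvature vector points into `Ω`.  The claim is that
then every component `C` of `M \ Λ` inside `Ω` is small, in the sense that its diameter is at most
`η` (`exists_forall_dist_le`).  Since the area of `Λ` is at most `A`, it follows that the volume of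
`Ω` is small: in a chart, one leaves `C`, and so meets `Λ`, by moving the distance `O(η)` in a fixed
direction, and projecting `Λ` along this direction bounds the volume of the union of all such `C` by
`O(η) A` (`volume_le_of_shift_mem`, `euclideanHausdorffMeasure_le_of_small_components`).  This
contradicts `Vol(Ω) ≥ Vol(M) / 3`.

To see that `C` is small, choose a regular point `φ x` in its boundary
(`exists_regularPoint_mem_closure`: at a boundary point which lies on as few sheets as possible, the
boundary of `C` is locally contained in one sheet, so `C` contains one side of it).  The component
`Σ' = φ(K)` of `Λ` through `φ x`, where `K` is the connected component of `x` in `S`, is contained in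
a small coordinate ball.  As the mean curvature vanishes nowhere, each sheet has a positive side,
the one to which the mean curvature vector points (`OrientedSheets`, `exists_side`), and `Σ'` bounds
with multiplicity: there is an integer-valued function `s` on `M` which vanishes outside of the ball
and which increases by one whenever one crosses a sheet of `Σ'` to its positive side
(`exists_multiplicity`).  Locally such functions exist by definition of the sheets, and they are
glued by means of the vanishing of the integral Čech cohomology of the simply connected chart
(`exists_int_step_of_cocycle`).

The sheets of `Σ'` touch, but they do not cross.  Therefore the value of `s` at regular points of
`Σ'` (that is, on the negative side) is locally constant, hence constant, on `K`
(`OrientedSheets.exists_eventually_eq`).  Let `φ x₁` be the point of `Σ'` which is farthest from the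
centre of the ball.  Small coordinate spheres are strictly convex, and comparison with the sphere
through `φ x₁` shows that the mean curvature vector points into the ball there
(`meanCurvature_neg_of_isLocalMax`), so that `s` vanishes at `φ x₁`
(`OrientedSheets.multiplicity_eq_zero_of_farthest`).  Consequently `s ≥ 0` at regular points of
`Σ'`, and `s ≥ 1` on their positive sides.  Now `C` lies inside `Ω`, which near `φ x` is the positive
side, and `s` is constant on `C`, as `C` does not meet `Λ`.  Hence `s ≥ 1` on `C`, and `C` is
contained in the small ball (`subset_ball_of_frequently`).
-/

namespace SmallComponents

/-! ### Step functions with prescribed jumps -/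

/-- A Čech `1`-cocycle of locally constant integer-valued functions on a simply connected space is
a coboundary: if the local functions `σ a` differ by locally constant functions, then there is a
global function `s` with the same jumps.  With a partition of unity `χ`, the function
`G₀ = ∑ χ a • σ a` has a continuous class in `ℝ / ℤ`, which lifts to a continuous function `G`; the
function `s` is `G₀ - G`. -/
theorem exists_int_step_of_cocycle {X ι : Type*} [TopologicalSpace X] [SimplyConnectedSpace X]
    [LocallyPathConnectedSpace X] [NormalSpace X] [ParacompactSpace X]
    (W : ι → Set X) (hW : ∀ a, IsOpen (W a)) (hcov : ⋃ a, W a = univ) (σ : ι → X → ℤ)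
    (h : ∀ a b, ∀ x ∈ W a ∩ W b, ∀ᶠ z in 𝓝 x, σ a z - σ b z = σ a x - σ b x) :
    ∃ s : X → ℤ, ∀ a, ∀ x ∈ W a, ∀ᶠ z in 𝓝 x, s z - σ a z = s x - σ a x := by
  classical
  obtain ⟨χ, hχ⟩ := PartitionOfUnity.exists_isSubordinate isClosed_univ W hW hcov.ge
  set G₀ : X → ℝ := fun z => ∑ᶠ a, χ a z * (σ a z : ℝ) with hG₀
  -- Near every point, `G₀` is the sum of any of the local functions and a continuous function.
  have key : ∀ b, ∀ x ∈ W b, ∃ g : X → ℝ, Continuous g ∧ ∀ᶠ z in 𝓝 x, G₀ z = σ b z + g z := by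
    intro b x hx
    obtain ⟨J, N, hN, hNU, hJ⟩ := χ.exists_finset_nhds_support_subset hχ hW x
    refine ⟨fun z => ∑ a ∈ J, χ a z * ((σ a x - σ b x : ℤ) : ℝ), by fun_prop, ?_⟩
    have hloc : ∀ᶠ z in 𝓝 x, ∀ a ∈ J, σ a z - σ b z = σ a x - σ b x := by
      rw [Filter.eventually_all_finset]
      intro a ha
      exact h a b x ⟨by simpa using (mem_iInter₂.1 (hNU (mem_of_mem_nhds hN)) a ha), hx⟩
    filter_upwards [hN, hloc] with z hz hl
    have h1 : ∑ a ∈ J, χ a z = 1 := by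
      rw [← finsum_eq_sum_of_support_subset _ (hJ z hz)]
      exact χ.sum_eq_one (mem_univ z)
    have h2 : G₀ z = ∑ a ∈ J, χ a z * (σ a z : ℝ) := by
      apply finsum_eq_sum_of_support_subset
      exact (support_mul_subset_left _ _).trans (hJ z hz)
    rw [h2]
    calc ∑ a ∈ J, χ a z * (σ a z : ℝ)
        = ∑ a ∈ J, (χ a z * (σ b z : ℝ) + χ a z * ((σ a x - σ b x : ℤ) : ℝ)) := by
          refine Finset.sum_congr rfl fun a ha => ?_
          rw [← hl a ha]; push_cast; ring
      _ = _ := by rw [Finset.sum_add_distrib, ← Finset.sum_mul, h1, one_mul]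
  have hmem : ∀ x, ∃ a, x ∈ W a := fun x => by
    simpa using (hcov.ge (mem_univ x))
  have hcont : Continuous fun z => ((G₀ z : ℝ) : AddCircle (1 : ℝ)) := by
    rw [continuous_iff_continuousAt]
    intro x
    obtain ⟨b, hb⟩ := hmem x
    obtain ⟨g, hg, hgz⟩ := key b x hb
    have : ContinuousAt (fun z => ((g z : ℝ) : AddCircle (1 : ℝ))) x :=
      ((AddCircle.continuous_mk' 1).comp hg).continuousAt
    refine this.congr ?_
    filter_upwards [hgz] with z hz
    rw [hz, AddCircle.coe_add]
    simp
  obtain ⟨x₀⟩ : Nonempty X := inferInstance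
  obtain ⟨G, ⟨-, hG⟩, -⟩ := (AddCircle.isCoveringMap_coe (1 : ℝ)).existsUnique_continuousMap_lifts
    ⟨_, hcont⟩ x₀ (G₀ x₀) rfl
  have hGz : ∀ z, ∃ k : ℤ, (k : ℝ) = G₀ z - G z := by
    intro z
    have : ((G z : ℝ) : AddCircle (1 : ℝ)) = (G₀ z : ℝ) := congrFun hG z
    have h0 : ((G₀ z - G z : ℝ) : AddCircle (1 : ℝ)) = 0 := by
      rw [AddCircle.coe_sub, this, sub_self]
    obtain ⟨k, hk⟩ := (AddCircle.coe_eq_zero_iff 1).1 h0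
    exact ⟨k, by simpa using hk⟩
  choose s hs using hGz
  refine ⟨s, fun b x hx => ?_⟩
  obtain ⟨g, hg, hgz⟩ := key b x hx
  have hc : ContinuousAt (fun z => g z - G z) x := (hg.sub G.continuous).continuousAt
  have h1 : ∀ᶠ z in 𝓝 x, |(g z - G z) - (g x - G x)| < 1 := by
    have := (Metric.tendsto_nhds.1 hc) 1 one_pos
    simpa only [Real.dist_eq] using this
  have hval : ∀ z, G₀ z = σ b z + g z → ((s z - σ b z : ℤ) : ℝ) = g z - G z := by
    intro z hz
    push_cast
    rw [hs, hz]; ring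
  filter_upwards [h1, hgz] with z hz hz'
  rw [← hval z hz', ← hval x hgz.self_of_nhds] at hz
  rw [← sub_eq_zero, ← Int.abs_lt_one_iff]
  exact_mod_cast hz

/-! ### The two sides of a regular zero set -/

section NormedSpace

variable {E : Type*} [NormedAddCommGroup E] [NormedSpace ℝ E]

theorem eventually_pos_along {f : E → ℝ} {y ν : E} (hf : DifferentiableAt ℝ f y) (hy : f y = 0)
    (hν : 0 < fderiv ℝ f y ν) : ∀ᶠ t in 𝓝[>] (0 : ℝ), 0 < f (y + t • ν) := by
  have h1 : HasDerivAt (fun t : ℝ => f (y + t • ν)) (fderiv ℝ f y ν) 0 := by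
    have h2 : HasDerivAt (fun t : ℝ => y + t • ν) ν 0 := by
      simpa using ((hasDerivAt_id (0 : ℝ)).smul_const ν).const_add y
    have h3 : HasFDerivAt f (fderiv ℝ f y) (y + (0 : ℝ) • ν) := by simpa using hf.hasFDerivAt
    exact h3.comp_hasDerivAt (0 : ℝ) h2
  have h4 := (hasDerivAt_iff_tendsto_slope.1 h1).eventually (lt_mem_nhds hν)
  have h5 : ∀ᶠ t in 𝓝[>] (0 : ℝ), 0 < slope (fun t : ℝ => f (y + t • ν)) 0 t :=
    h4.filter_mono (nhdsWithin_mono _ fun t (ht : 0 < t) => ht.ne')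
  filter_upwards [h5, self_mem_nhdsWithin] with t ht (ht0 : 0 < t)
  rw [slope_def_field] at ht
  simp only [zero_smul, add_zero, hy, sub_zero] at ht
  exact (div_pos_iff_of_pos_right ht0).1 ht

/-- The positive side of a regular zero set is locally connected up to the zero set. -/
theorem exists_nhds_isPreconnected_pos {f : E → ℝ} {y : E} (hf : ContDiffAt ℝ 1 f y)
    (hy : f y = 0) (hd : fderiv ℝ f y ≠ 0) {V : Set E} (hV : V ∈ 𝓝 y) :
    ∃ D ∈ 𝓝 y, D ⊆ V ∧ IsPreconnected (D ∩ {z | 0 < f z}) := by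
  obtain ⟨ν, hν⟩ : ∃ ν, 0 < fderiv ℝ f y ν := by
    obtain ⟨ν, hν⟩ : ∃ ν, fderiv ℝ f y ν ≠ 0 := by
      by_contra! h
      exact hd (ContinuousLinearMap.ext h)
    rcases hν.lt_or_gt with h | h
    · exact ⟨-ν, by simpa using h⟩
    · exact ⟨ν, h⟩
  have h1 : ∀ᶠ z in 𝓝 y, DifferentiableAt ℝ f z :=
    (hf.eventually (by simp)).mono fun z hz => hz.differentiableAt (by simp)
  have h2 : ∀ᶠ z in 𝓝 y, 0 < fderiv ℝ f z ν := by
    have : ContinuousAt (fun z => fderiv ℝ f z ν) y :=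
      (hf.continuousAt_fderiv (by simp)).clm_apply continuousAt_const
    exact this.eventually (lt_mem_nhds hν)
  obtain ⟨R, hR, hball⟩ := Metric.eventually_nhds_iff_ball.1 ((h1.and h2).and hV)
  -- The neighbourhood is a cylinder `y + z + τ • ν` with `‖z‖ < ε` and `|τ| ≤ a`: the function is
  -- increasing along the axis, and positive on the top.
  obtain ⟨a, ha, haν, hatop⟩ : ∃ a : ℝ, 0 < a ∧ a * ‖ν‖ < R / 2 ∧ 0 < f (y + a • ν) := by
    have h3 : ∀ᶠ t in 𝓝[>] (0 : ℝ), t * ‖ν‖ < R / 2 := by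
      have : ContinuousAt (fun t : ℝ => t * ‖ν‖) 0 := by fun_prop
      refine (this.eventually (gt_mem_nhds ?_)).filter_mono nhdsWithin_le_nhds
      simpa using half_pos hR
    obtain ⟨a, ⟨h4, h5⟩, h6⟩ := ((eventually_pos_along (hf.differentiableAt (by simp)) hy hν).and
      h3 |>.and self_mem_nhdsWithin).exists
    exact ⟨a, h6, h5, h4⟩
  have hin : ∀ z : E, ‖z‖ < R / 2 → ∀ τ ∈ Icc (-a) a, y + z + τ • ν ∈ Metric.ball y R := by
    intro z hz τ hτ
    rw [mem_ball_iff_norm]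
    calc ‖y + z + τ • ν - y‖ = ‖z + τ • ν‖ := by congr 1; abel
      _ ≤ ‖z‖ + |τ| * ‖ν‖ := (norm_add_le _ _).trans (by rw [norm_smul, Real.norm_eq_abs])
      _ ≤ ‖z‖ + a * ‖ν‖ := by gcongr; exact abs_le.2 hτ
      _ < R := by linarith
  obtain ⟨ε, hε, hεR, htop⟩ : ∃ ε > 0, ε < R / 2 ∧ ∀ z : E, ‖z‖ < ε → 0 < f (y + z + a • ν) := by
    have hc : ContinuousAt (fun z => f (y + z + a • ν)) 0 := by
      have : DifferentiableAt ℝ f (y + 0 + a • ν) :=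
        (hball _ (hin 0 (by simpa using half_pos hR) a ⟨by linarith, le_rfl⟩)).1.1
      exact ContinuousAt.comp (f := fun z => y + z + a • ν) (g := f) this.continuousAt
        (by fun_prop)
    have := hc.eventually (lt_mem_nhds (by simpa using hatop : (0 : ℝ) < f (y + 0 + a • ν)))
    obtain ⟨ε, hε, h⟩ := Metric.eventually_nhds_iff_ball.1 this
    refine ⟨min ε (R / 4), by positivity, (min_le_right _ _).trans_lt (by linarith), fun z hz => ?_⟩
    exact h z (by simpa using hz.trans_le (min_le_left _ _))
  refine ⟨{q | ∃ z : E, ‖z‖ < ε ∧ ∃ τ ∈ Icc (-a) a, q = y + z + τ • ν}, ?_, ?_, ?_⟩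
  · refine Filter.mem_of_superset (Metric.ball_mem_nhds y hε) fun q hq => ?_
    refine ⟨q - y, mem_ball_iff_norm.1 hq, 0, ⟨by linarith, ha.le⟩, by simp⟩
  · rintro q ⟨z, hz, τ, hτ, rfl⟩
    exact (hball _ (hin z (hz.trans hεR) τ hτ)).2
  · have hmono : ∀ z : E, ‖z‖ < ε → StrictMonoOn (fun τ : ℝ => f (y + z + τ • ν)) (Icc (-a) a) := by
      intro z hz
      have hder : ∀ τ ∈ Icc (-a) a, HasDerivAt (fun τ : ℝ => f (y + z + τ • ν))
          (fderiv ℝ f (y + z + τ • ν) ν) τ := by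
        intro τ hτ
        have h2 : HasDerivAt (fun t : ℝ => y + z + t • ν) ν τ := by
          simpa using ((hasDerivAt_id τ).smul_const ν).const_add (y + z)
        exact (hball _ (hin z (hz.trans hεR) τ hτ)).1.1.hasFDerivAt.comp_hasDerivAt τ h2
      refine strictMonoOn_of_deriv_pos (convex_Icc _ _)
        (fun τ hτ => (hder τ hτ).continuousAt.continuousWithinAt) fun τ hτ => ?_
      have hτ' := interior_subset hτ
      rw [(hder τ hτ').deriv]
      exact (hball _ (hin z (hz.trans hεR) τ hτ')).1.2
    have hT : IsPreconnected ((fun z => y + z + a • ν) '' Metric.ball (0 : E) ε) :=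
      (convex_ball (0 : E) ε).isPreconnected.image _ (by fun_prop)
    refine isPreconnected_of_forall (y + 0 + a • ν) ?_
    rintro q ⟨⟨z, hz, τ, hτ, rfl⟩, hq : 0 < f _⟩
    have hseg : IsPreconnected ((fun t : ℝ => y + z + t • ν) '' Icc τ a) :=
      isPreconnected_Icc.image _ (by fun_prop)
    refine ⟨_, ?_, ?_, ?_, IsPreconnected.union (y + z + a • ν) ?_ ?_ hseg hT⟩
    · rintro q (⟨t, ht, rfl⟩ | ⟨z', hz', rfl⟩)
      · have ht' : t ∈ Icc (-a) a := ⟨hτ.1.trans ht.1, ht.2⟩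
        exact ⟨⟨z, hz, t, ht', rfl⟩, hq.trans_le ((hmono z hz).monotoneOn hτ ht' ht.1)⟩
      · have hz'' : ‖z'‖ < ε := by simpa using hz'
        exact ⟨⟨z', hz'', a, ⟨by linarith, le_rfl⟩, rfl⟩, htop z' hz''⟩
    · exact Or.inr ⟨0, by simpa using hε, rfl⟩
    · exact Or.inl ⟨τ, ⟨le_rfl, hτ.2⟩, rfl⟩
    · exact ⟨a, ⟨hτ.2, le_rfl⟩, rfl⟩
    · exact ⟨z, by simpa using hz, rfl⟩

end NormedSpace

section Manifold

variable {n : ℕ} {M : Type*} [TopologicalSpace M]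

/-- The differential of a real function on a manifold, as a linear form on the model space: the
tangent space at `p` is the model space, by means of the preferred chart around `p`. -/
noncomputable def differential (n : ℕ) [ChartedSpace (EuclideanSpace ℝ (Fin n)) M] (f : M → ℝ)
    (p : M) : EuclideanSpace ℝ (Fin n) →L[ℝ] ℝ :=
  mfderiv (𝓡 n) 𝓘(ℝ) f p

variable [ChartedSpace (EuclideanSpace ℝ (Fin n)) M]

theorem differential_eq_fderiv_extChartAt {f : M → ℝ} {p : M}
    (hf : MDifferentiableAt (𝓡 n) 𝓘(ℝ) f p) :
    differential n f p = fderiv ℝ (f ∘ (extChartAt (𝓡 n) p).symm) (extChartAt (𝓡 n) p p) := by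
  rw [differential, hf.mfderiv, writtenInExtChartAt, ModelWithCorners.range_eq_univ,
    fderivWithin_univ]
  rfl

theorem differential_neg (f : M → ℝ) (p : M) :
    differential n (fun q => -f q) p = -differential n f p := by
  exact mfderiv_neg

theorem contDiffAt_comp_extChartAt_symm [IsManifold (𝓡 n) ∞ M] {F : Type*} [NormedAddCommGroup F]
    [NormedSpace ℝ F] {m : ℕ∞}
    {f : M → F} {p q : M} (hq : q ∈ (extChartAt (𝓡 n) p).source)
    (hf : ContMDiffAt (𝓡 n) 𝓘(ℝ, F) m f q) :
    ContDiffAt ℝ m (f ∘ (extChartAt (𝓡 n) p).symm) (extChartAt (𝓡 n) p q) := by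
  rw [← contMDiffAt_iff_contDiffAt]
  have h1 : ContMDiffAt 𝓘(ℝ, EuclideanSpace ℝ (Fin n)) (𝓡 n) m (extChartAt (𝓡 n) p).symm
      (extChartAt (𝓡 n) p q) :=
    ((contMDiffOn_extChartAt_symm (n := ∞) p).contMDiffAt
      ((isOpen_extChartAt_target p).mem_nhds
        ((extChartAt (𝓡 n) p).map_source hq))).of_le (by exact_mod_cast le_top)
  refine ContMDiffAt.comp (extChartAt (𝓡 n) p q) ?_ h1
  rwa [(extChartAt (𝓡 n) p).left_inv hq]

theorem eventually_pos_along_chart {f : M → ℝ} {p : M} {ν : EuclideanSpace ℝ (Fin n)}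
    (hf : MDifferentiableAt (𝓡 n) 𝓘(ℝ) f p) (hp : f p = 0)
    (hν : 0 < differential n f p ν) :
    ∀ᶠ t in 𝓝[>] (0 : ℝ),
      0 < f ((extChartAt (𝓡 n) p).symm (extChartAt (𝓡 n) p p + t • ν)) := by
  rw [differential_eq_fderiv_extChartAt hf] at hν
  refine eventually_pos_along (f := f ∘ (extChartAt (𝓡 n) p).symm) ?_ (by simpa using hp) hν
  by_contra h
  rw [fderiv_zero_of_not_differentiableAt h] at hν
  exact lt_irrefl _ hν

theorem tendsto_along_chart (p : M) (ν : EuclideanSpace ℝ (Fin n)) :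
    Filter.Tendsto (fun t : ℝ => (extChartAt (𝓡 n) p).symm (extChartAt (𝓡 n) p p + t • ν))
      (𝓝[>] 0) (𝓝 p) := by
  have h1 : ContinuousAt (extChartAt (𝓡 n) p).symm (extChartAt (𝓡 n) p p + (0 : ℝ) • ν) := by
    simpa using continuousAt_extChartAt_symm (I := 𝓡 n) p
  have h2 : ContinuousAt (fun t : ℝ => extChartAt (𝓡 n) p p + t • ν) 0 := by fun_prop
  have h3 := (ContinuousAt.comp (f := fun t : ℝ => extChartAt (𝓡 n) p p + t • ν) h1 h2).tendsto
  simp only [Function.comp_apply, zero_smul, add_zero, extChartAt_to_inv] at h3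
  exact h3.mono_left nhdsWithin_le_nhds

theorem exists_pos_differential_of_ne_zero {f : M → ℝ} {p : M} (hd : differential n f p ≠ 0) :
    ∃ ν : EuclideanSpace ℝ (Fin n), 0 < differential n f p ν := by
  obtain ⟨ν, hν⟩ : ∃ ν, differential n f p ν ≠ 0 := by
    by_contra! h
    exact hd (ContinuousLinearMap.ext h)
  rcases lt_or_gt_of_ne hν with h | h
  · exact ⟨-ν, by simpa using h⟩
  · exact ⟨ν, h⟩

theorem frequently_pos {f : M → ℝ} {p : M} (hf : MDifferentiableAt (𝓡 n) 𝓘(ℝ) f p) (hp : f p = 0)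
    (hd : differential n f p ≠ 0) : ∃ᶠ q in 𝓝 p, 0 < f q := by
  obtain ⟨ν, hν⟩ := exists_pos_differential_of_ne_zero hd
  exact (tendsto_along_chart p ν).frequently (eventually_pos_along_chart hf hp hν).frequently

variable [IsManifold (𝓡 n) ∞ M]

/-- One side of the regular zero set of a smooth function is locally connected up to the zero
set. -/
theorem exists_nhds_isPreconnected_pos_manifold {f : M → ℝ} {p : M}
    (hf : ContMDiffAt (𝓡 n) 𝓘(ℝ) 1 f p) (hp : f p = 0) (hd : differential n f p ≠ 0)
    {V : Set M} (hV : V ∈ 𝓝 p) :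
    ∃ D ∈ 𝓝 p, D ⊆ V ∧ IsPreconnected (D ∩ {q | 0 < f q}) := by
  set e := extChartAt (𝓡 n) p with he
  have hV' : e.symm ⁻¹' V ∩ e.target ∈ 𝓝 (e p) := by
    refine Filter.inter_mem ?_ (extChartAt_target_mem_nhds p)
    exact (continuousAt_extChartAt_symm p).preimage_mem_nhds (by simpa [he] using hV)
  rw [differential_eq_fderiv_extChartAt (hf.mdifferentiableAt (by simp))] at hd
  obtain ⟨D, hD, hDV, hDc⟩ := exists_nhds_isPreconnected_pos
    (contDiffAt_comp_extChartAt_symm (m := 1) (mem_extChartAt_source p) hf)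
    (by simpa using hp) hd hV'
  refine ⟨e.source ∩ e ⁻¹' D, Filter.inter_mem (extChartAt_source_mem_nhds p)
    ((continuousAt_extChartAt p).preimage_mem_nhds hD), ?_, ?_⟩
  · rintro q ⟨hq, hq'⟩
    have := (hDV hq').1
    rwa [mem_preimage, e.left_inv hq] at this
  · have : e.source ∩ e ⁻¹' D ∩ {q | 0 < f q}
        = e.symm '' (D ∩ {z | 0 < (f ∘ e.symm) z}) := by
      ext q
      constructor
      · rintro ⟨⟨hq, hq'⟩, hq''⟩
        exact ⟨e q, ⟨hq', by simpa [e.left_inv hq] using hq''⟩, e.left_inv hq⟩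
      · rintro ⟨z, ⟨hz, hz'⟩, rfl⟩
        have ht := (hDV hz).2
        exact ⟨⟨e.map_target ht, by rwa [mem_preimage, e.right_inv ht]⟩, hz'⟩
    rw [this]
    refine hDc.image _ ((continuousOn_extChartAt_symm p).mono fun z hz => (hDV hz.1).2)

theorem eventually_pos_imp_pos {f f' : M → ℝ} {p : M}
    (hf : ContMDiffAt (𝓡 n) 𝓘(ℝ) 1 f p) (hf' : ContMDiffAt (𝓡 n) 𝓘(ℝ) 1 f' p)
    (hp : f p = 0) (hp' : f' p = 0)
    (hd : differential n f p ≠ 0)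
    {c : ℝ} (hc : 0 < c) (hff' : differential n f' p = c • differential n f p)
    (hz : ∀ᶠ q in 𝓝 p, f' q = 0 → f q = 0) :
    ∀ᶠ q in 𝓝 p, 0 < f q → 0 < f' q := by
  have hcont : ∀ᶠ q in 𝓝 p, ContinuousAt f' q :=
    ((contMDiffAt_iff_contMDiffAt_nhds (by simp)).1 hf').mono fun q hq => hq.continuousAt
  obtain ⟨D, hD, hDV, hDc⟩ := exists_nhds_isPreconnected_pos_manifold hf hp hd
    (Filter.inter_mem hz hcont)
  obtain ⟨ν, hν⟩ := exists_pos_differential_of_ne_zero hd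
  have hν' : 0 < differential n f' p ν := by
    rw [hff']; exact mul_pos hc hν
  obtain ⟨t, ⟨ht1, ht2⟩, ht3⟩ := ((eventually_pos_along_chart (hf.mdifferentiableAt (by simp)) hp
    hν).and (eventually_pos_along_chart (hf'.mdifferentiableAt (by simp)) hp' hν') |>.and
    ((tendsto_along_chart p ν).eventually hD)).exists
  filter_upwards [hD] with q hq hq0
  by_contra hneg
  have hle : f' q ≤ 0 := not_lt.1 hneg
  obtain ⟨z, hz, hz0⟩ := hDc.intermediate_value (a := q) ⟨hq, hq0⟩ ⟨ht3, ht1⟩ (f := f')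
    (fun z hz => (hDV hz.1).2.continuousWithinAt) ⟨hle, ht2.le⟩
  exact hz.2.ne' ((hDV hz.1).1 hz0)

/-- If two functions have the same regular zero set near a point, and if their differentials there
are positively proportional, then they have the same sign near this point. -/
theorem eventually_pos_iff_pos {f f' : M → ℝ} {p : M}
    (hf : ContMDiffAt (𝓡 n) 𝓘(ℝ) 1 f p) (hf' : ContMDiffAt (𝓡 n) 𝓘(ℝ) 1 f' p)
    (hp : f p = 0) (hp' : f' p = 0)
    (hd : differential n f p ≠ 0)
    {c : ℝ} (hc : 0 < c) (hff' : differential n f' p = c • differential n f p)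
    (hz : ∀ᶠ q in 𝓝 p, f' q = 0 ↔ f q = 0) :
    ∀ᶠ q in 𝓝 p, 0 < f q ↔ 0 < f' q := by
  have hff'' : differential n f p = c⁻¹ • differential n f' p := by
    rw [hff', smul_smul, inv_mul_cancel₀ hc.ne', one_smul]
  have hd' : differential n f' p ≠ 0 := fun h => hd (by rw [hff'', h, smul_zero])
  filter_upwards [eventually_pos_imp_pos hf hf' hp hp' hd hc hff' (hz.mono fun q hq => hq.1),
    eventually_pos_imp_pos hf' hf hp' hp hd' (inv_pos.2 hc) hff'' (hz.mono fun q hq => hq.2)]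
    with q h1 h2
  exact ⟨h1, h2⟩

end Manifold

/-! ### Charts of a Riemannian manifold are locally bilipschitz -/

section Lipschitz

open scoped NNReal

variable {E : Type*} [NormedAddCommGroup E] [NormedSpace ℝ E] {H : Type*} [TopologicalSpace H]
  (I : ModelWithCorners ℝ E H)
  {M : Type*} [MetricSpace M] [ChartedSpace H M] [IsManifold I 1 M]
  [RiemannianBundle (fun p : M => TangentSpace I p)]
  [IsContinuousRiemannianBundle E (fun p : M => TangentSpace I p)]
  [IsRiemannianManifold I M]

attribute [local instance] normedAddCommGroupTangentSpaceVectorSpace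
attribute [local instance] normedSpaceTangentSpaceVectorSpace

/-- The preferred chart is Lipschitz near its centre. The Riemannian distance of two points close to
the centre is the infimum of the lengths of curves in a small ball, where the derivative of the
chart is bounded. -/
theorem exists_lipschitzOnWith_extChartAt (p : M) :
    ∃ C > (0 : ℝ≥0), ∃ r > 0, Metric.ball p r ⊆ (extChartAt I p).source ∧
      LipschitzOnWith C (extChartAt I p) (Metric.ball p r) := by
  rcases eventually_enorm_mfderiv_extChartAt_lt I p with ⟨C, C_pos, hC⟩
  obtain ⟨R, hR, hball⟩ := Metric.eventually_nhds_iff_ball.1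
    (hC.and (extChartAt_source_mem_nhds (I := I) p))
  refine ⟨C, C_pos, R / 4, by positivity, fun q hq => ?_, ?_⟩
  · exact (hball q (Metric.ball_subset_ball (by linarith) hq)).2
  intro a ha b hb
  -- A short curve from `a` to `b` stays in the ball where the derivative of the chart is bounded.
  have hab : edist a b < ENNReal.ofReal (R / 2) := by
    rw [edist_lt_ofReal]
    have h1 := Metric.mem_ball.1 ha
    have h2 := Metric.mem_ball'.1 hb
    linarith [dist_triangle a p b]
  have key : ∀ r : ℝ≥0∞, edist a b < r → r ≤ ENNReal.ofReal (R / 2) →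
      edist (extChartAt I p a) (extChartAt I p b) ≤ C * r := by
    intro r hr hrR
    rw [IsRiemannianManifold.out (I := I)] at hr
    rcases exists_lt_locally_constant_of_riemannianEDist_lt hr zero_lt_one
      with ⟨γ, hγa, hγb, γ_smooth, hγ, -⟩
    have hin : ∀ t ∈ Icc (0 : ℝ) 1, γ t ∈ Metric.ball p R := by
      intro t ht
      have h1 : edist a (γ t) < ENNReal.ofReal (R / 2) := by
        rw [IsRiemannianManifold.out (I := I)]
        calc riemannianEDist I a (γ t) ≤ pathELength I γ 0 t :=
              riemannianEDist_le_pathELength γ_smooth.contMDiffOn hγa rfl ht.1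
          _ ≤ pathELength I γ 0 1 := pathELength_mono le_rfl ht.2
          _ < _ := hγ.trans_le hrR
      rw [edist_lt_ofReal] at h1
      have h2 := Metric.mem_ball'.1 ha
      rw [Metric.mem_ball']
      linarith [dist_triangle p a (γ t)]
    let γ' := extChartAt I p ∘ γ
    have hγ' : CMDiff[Icc 0 1] 1 γ' :=
      contMDiffOn_extChartAt.comp (I' := I) (t := (chartAt _ p).source)
        γ_smooth.contMDiffOn (fun t' ht' ↦ by
          have : γ t' ∈ (extChartAt I p).source := (hball _ (hin t' ht')).2
          simpa [extChartAt_source] using this)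
    rw [edist_comm, edist_eq_enorm_sub, ← hγa, ← hγb]
    calc
      ‖γ' 1 - γ' 0‖ₑ
    _ ≤ ∫⁻ t' in Icc 0 1, ‖derivWithin γ' (Icc 0 1) t'‖ₑ := by
      apply enorm_sub_le_lintegral_derivWithin_Icc_of_contDiffOn_Icc _ zero_le_one
      rwa [← contMDiffOn_iff_contDiffOn]
    _ = ∫⁻ t' in Icc 0 1, ‖mfderiv[Icc 0 1] γ' t' 1‖ₑ := by
      simp_rw [← fderivWithin_derivWithin, mfderivWithin_eq_fderivWithin]
      rfl
    _ ≤ ∫⁻ t' in Icc 0 1, C * ‖mfderiv[Icc 0 1] γ t' 1‖ₑ := by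
      apply setLIntegral_mono' measurableSet_Icc (fun t' ht' ↦ ?_)
      have h1 : mfderiv[Icc 0 1] γ' t' =
          (mfderiv% (extChartAt I p) (γ t')) ∘L (mfderiv[Icc 0 1] γ t') := by
        apply mfderiv_comp_mfderivWithin
        · refine mdifferentiableAt_extChartAt ?_
          have : γ t' ∈ (extChartAt I p).source := (hball _ (hin t' ht')).2
          simpa [extChartAt_source] using this
        · exact (γ_smooth.mdifferentiable one_ne_zero).mdifferentiableOn _ ht'
        · rw [uniqueMDiffWithinAt_iff_uniqueDiffWithinAt]
          exact uniqueDiffOn_Icc zero_lt_one _ ht'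
      have : mfderiv[Icc 0 1] γ' t' 1 =
          (mfderiv% (extChartAt I p) (γ t')) (mfderiv[Icc 0 1] γ t' 1) :=
        congr($h1 1)
      rw [this]
      apply (ContinuousLinearMap.le_opENorm _ _).trans
      gcongr
      exact (hball _ (hin t' ht')).1.le
    _ = C * pathELength I γ 0 1 := by
      rw [lintegral_const_mul' _ _ ENNReal.coe_ne_top,
          pathELength_eq_lintegral_mfderivWithin_Icc]
    _ ≤ C * r := by
      gcongr
  refine le_of_forall_gt fun c hc => ?_
  obtain ⟨r, hr, hrc⟩ : ∃ r, edist a b < r ∧ C * r < c := by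
    have hC0 : (C : ℝ≥0∞) ≠ 0 := by simpa using C_pos.ne'
    have : edist a b < c / C := by
      rwa [ENNReal.lt_div_iff_mul_lt (Or.inl hC0) (Or.inl ENNReal.coe_ne_top), mul_comm]
    obtain ⟨r, h1, h2⟩ := exists_between this
    refine ⟨r, h1, ?_⟩
    rwa [ENNReal.lt_div_iff_mul_lt (Or.inl hC0) (Or.inl ENNReal.coe_ne_top), mul_comm] at h2
  refine (key (min r (ENNReal.ofReal (R / 2))) (lt_min hr hab) (min_le_right _ _)).trans_lt
    (lt_of_le_of_lt ?_ hrc)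
  gcongr
  exact min_le_left _ _

variable [I.Boundaryless]

/-- The inverse of the preferred chart is Lipschitz near the centre, as one sees from the images of
straight segments. -/
theorem exists_lipschitzOnWith_extChartAt_symm (p : M) :
    ∃ C > (0 : ℝ≥0), ∃ ρ > 0, Metric.ball (extChartAt I p p) ρ ⊆ (extChartAt I p).target ∧
      LipschitzOnWith C (extChartAt I p).symm (Metric.ball (extChartAt I p p) ρ) := by
  rcases eventually_enorm_mfderivWithin_symm_extChartAt_lt I p with ⟨C, C_pos, hC⟩
  rw [show 𝓝[range I] (extChartAt I p p) = 𝓝 (extChartAt I p p) by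
    rw [ModelWithCorners.range_eq_univ, nhdsWithin_univ]] at hC
  obtain ⟨ρ, hρ, hball⟩ := Metric.eventually_nhds_iff_ball.1
    (hC.and (extChartAt_target_mem_nhds p))
  refine ⟨C, C_pos, ρ, hρ, fun y hy => (hball y hy).2, ?_⟩
  intro y hy z hz
  rw [IsRiemannianManifold.out (I := I)]
  let η := ContinuousAffineMap.lineMap (R := ℝ) y z
  set γ := (extChartAt I p).symm ∘ η with hγ
  have hη : ∀ t ∈ Icc (0 : ℝ) 1, η t ∈ Metric.ball (extChartAt I p p) ρ := by
    intro t ht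
    apply (convex_ball _ ρ).segment_subset hy hz
    rw [segment_eq_image_lineMap]
    exact ⟨t, ht, rfl⟩
  have η_smooth : CMDiff[Icc 0 1] 1 η := by
    apply ContMDiff.contMDiffOn
    rw [contMDiff_iff_contDiff]
    exact ContinuousAffineMap.contDiff _
  have hη1 : Icc 0 1 ⊆ ⇑η ⁻¹' (extChartAt I p).target := fun t ht => (hball _ (hη t ht)).2
  have : riemannianEDist I ((extChartAt I p).symm y) ((extChartAt I p).symm z)
      ≤ pathELength I γ 0 1 := by
    apply riemannianEDist_le_pathELength _ _ _ zero_le_one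
    · exact (contMDiffOn_extChartAt_symm p).comp η_smooth hη1
    · simp [γ, η, ContinuousAffineMap.coe_lineMap_eq]
    · simp [γ, η, ContinuousAffineMap.coe_lineMap_eq]
  apply this.trans
  rw [← lintegral_fderiv_lineMap_eq_edist, pathELength_eq_lintegral_mfderivWithin_Icc,
    ← lintegral_const_mul' _ _ ENNReal.coe_ne_top]
  apply setLIntegral_mono' measurableSet_Icc (fun t ht ↦ ?_)
  have h1 : mfderiv[Icc 0 1] γ t =
      (mfderiv[range I] (extChartAt I p).symm (η t)) ∘L (mfderiv[Icc 0 1] η t) := by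
    apply mfderivWithin_comp
    · exact mdifferentiableWithinAt_extChartAt_symm (hη1 ht)
    · exact η_smooth.mdifferentiableOn one_ne_zero t ht
    · exact hη1.trans (preimage_mono (extChartAt_target_subset_range p))
    · rw [uniqueMDiffWithinAt_iff_uniqueDiffWithinAt]
      exact uniqueDiffOn_Icc zero_lt_one t ht
  have : mfderiv[Icc 0 1] γ t 1 =
      (mfderiv[range I] (extChartAt I p).symm (η t)) (mfderiv[Icc 0 1] η t 1) :=
    congr($h1 1)
  rw [this]
  apply (ContinuousLinearMap.le_opENorm _ _).trans
  gcongr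
  · exact (hball _ (hη t ht)).1.le
  · simp only [mfderivWithin_eq_fderivWithin]
    exact le_of_eq rfl

theorem exists_bilipschitz_extChartAt (p : M) :
    ∃ L > (0 : ℝ≥0), ∃ ρ > 0, Metric.ball (extChartAt I p p) ρ ⊆ (extChartAt I p).target ∧
      LipschitzOnWith L (extChartAt I p).symm (Metric.ball (extChartAt I p p) ρ) ∧
      LipschitzOnWith L (extChartAt I p)
        ((extChartAt I p).symm '' Metric.ball (extChartAt I p p) ρ) := by
  obtain ⟨C, hC, ρ, hρ, htarget, hlip⟩ := exists_lipschitzOnWith_extChartAt_symm I p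
  obtain ⟨C', hC', r, hr, hsource, hlip'⟩ := exists_lipschitzOnWith_extChartAt I p
  have : (extChartAt I p).symm ⁻¹' Metric.ball p r ∈ 𝓝 (extChartAt I p p) :=
    (continuousAt_extChartAt_symm p).preimage_mem_nhds (by simpa using Metric.ball_mem_nhds p hr)
  obtain ⟨ε, hε, hεr⟩ := Metric.mem_nhds_iff.1 this
  refine ⟨max C C', lt_max_of_lt_left hC, min ρ ε, lt_min hρ hε,
    (Metric.ball_subset_ball (min_le_left _ _)).trans htarget,
    (hlip.mono (Metric.ball_subset_ball (min_le_left _ _))).weaken (le_max_left _ _),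
    (hlip'.mono ?_).weaken (le_max_right _ _)⟩
  rintro _ ⟨y, hy, rfl⟩
  exact hεr (Metric.ball_subset_ball (min_le_right _ _) hy)

end Lipschitz

/-! ### Hausdorff measures, and the volume of regions of small width -/

section Measure

open scoped NNReal

theorem euclideanHausdorffMeasure_image_le {X Y : Type*} [EMetricSpace X] [MeasurableSpace X]
    [BorelSpace X] [EMetricSpace Y] [MeasurableSpace Y] [BorelSpace Y] {K : ℝ≥0} {f : X → Y}
    {s : Set X} (hf : LipschitzOnWith K f s) (d : ℕ) :
    μHE[d] (f '' s) ≤ (K : ℝ≥0∞) ^ d * μHE[d] s := by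
  have h := hf.hausdorffMeasure_image_le (d := d) (by positivity)
  simp only [Measure.euclideanHausdorffMeasure_def, Measure.smul_apply, ENNReal.smul_def,
    smul_eq_mul]
  rw [mul_left_comm]
  gcongr
  simpa using h

/-- The projection of `ℝ^(n+1)` to the last `n` coordinates. -/
noncomputable def tailProj (n : ℕ) (y : EuclideanSpace ℝ (Fin (n + 1))) :
    EuclideanSpace ℝ (Fin n) :=
  WithLp.toLp 2 fun i => y i.succ

theorem lipschitzWith_tailProj (n : ℕ) : LipschitzWith 1 (tailProj n) := by
  refine LipschitzWith.of_dist_le_mul fun y z => ?_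
  rw [NNReal.coe_one, one_mul, EuclideanSpace.dist_eq, EuclideanSpace.dist_eq]
  refine Real.sqrt_le_sqrt ?_
  rw [Fin.sum_univ_succ]
  simp only [tailProj]
  linarith [sq_nonneg (dist (y 0) (z 0))]

theorem volume_rectangle {n : ℕ} (s : Set ℝ) (t : Set (EuclideanSpace ℝ (Fin n))) :
    volume {y : EuclideanSpace ℝ (Fin (n + 1)) | y 0 ∈ s ∧ tailProj n y ∈ t}
      = volume s * volume t := by
  have h1 := (EuclideanSpace.volume_preserving_symm_measurableEquiv_toLp (Fin (n + 1)))
  have h2 := volume_preserving_piFinSuccAbove (fun _ : Fin (n + 1) => ℝ) 0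
  have h3 := (EuclideanSpace.volume_preserving_symm_measurableEquiv_toLp (Fin n))
  have h4 : volume ((MeasurableEquiv.toLp 2 (Fin n → ℝ)) ⁻¹' t) = volume t := by
    exact (h3.symm _).measure_preimage_equiv t
  rw [← h4, ← Measure.prod_prod, ← Measure.volume_eq_prod, ← h2.measure_preimage_equiv,
    ← h1.measure_preimage_equiv]
  rfl

/-- A set in `ℝ^(n+1)` from whose points one can reach `Λ` by moving the distance at most `h` in the
direction of the first coordinate axis has small volume: cut the space into slabs of height `h`,
and compare with the projections of the pieces of `Λ`. -/
theorem volume_le_of_shift_mem {n : ℕ} {Λ I : Set (EuclideanSpace ℝ (Fin (n + 1)))}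
    (hΛ : MeasurableSet Λ) {h : ℝ} (hh : 0 < h)
    (hI : ∀ y ∈ I, ∃ τ ∈ Icc 0 h, y + τ • EuclideanSpace.single 0 (1 : ℝ) ∈ Λ) :
    volume I ≤ ENNReal.ofReal (2 * h) * μHE[n] Λ := by
  set Λk : ℤ → Set (EuclideanSpace ℝ (Fin (n + 1))) :=
    fun k => Λ ∩ {y | y 0 ∈ Ico (k * h) ((k + 1) * h)} with hΛk
  have hcoord : Measurable fun y : EuclideanSpace ℝ (Fin (n + 1)) => y 0 := by fun_prop
  have hmeas : ∀ k, MeasurableSet (Λk k) := fun k => hΛ.inter (hcoord measurableSet_Ico)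
  have hdisj : Pairwise (Disjoint on Λk) := by
    intro k l hkl
    refine Set.disjoint_left.2 ?_
    rintro y ⟨-, hy1, hy2⟩ ⟨-, hy3, hy4⟩
    have h1 : (k : ℝ) < l + 1 := lt_of_mul_lt_mul_right (hy1.trans_lt hy4) hh.le
    have h2 : (l : ℝ) < k + 1 := lt_of_mul_lt_mul_right (hy3.trans_lt hy2) hh.le
    have h1' : k < l + 1 := by exact_mod_cast h1
    have h2' : l < k + 1 := by exact_mod_cast h2
    exact hkl (by omega)
  -- A point of `I` lies in the slab of the point of `Λ` above it, or in the previous slab.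
  have hsub : I ⊆ ⋃ k : ℤ, {y | y 0 ∈ Ico ((k - 1) * h) ((k + 1) * h) ∧
      tailProj n y ∈ tailProj n '' Λk k} := by
    intro y hy
    obtain ⟨τ, hτ, hyτ⟩ := hI y hy
    set z := y + τ • EuclideanSpace.single 0 (1 : ℝ) with hz
    have hz0 : z 0 = y 0 + τ := by simp [hz]
    have hk1 : (⌊z 0 / h⌋ : ℝ) * h ≤ z 0 := (le_div_iff₀ hh).1 (Int.floor_le _)
    have hk2 : z 0 < (⌊z 0 / h⌋ + 1) * h := (div_lt_iff₀ hh).1 (Int.lt_floor_add_one _)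
    refine mem_iUnion.2 ⟨⌊z 0 / h⌋, ⟨?_, ?_⟩, z, ⟨hyτ, hk1, hk2⟩, ?_⟩
    · linarith [hτ.2]
    · linarith [hτ.1]
    · ext i
      simp [tailProj, hz]
  calc volume I ≤ ∑' k : ℤ, volume {y : EuclideanSpace ℝ (Fin (n + 1)) |
        y 0 ∈ Ico ((k - 1) * h) ((k + 1) * h) ∧ tailProj n y ∈ tailProj n '' Λk k} :=
        (measure_mono hsub).trans (measure_iUnion_le _)
    _ ≤ ∑' k : ℤ, ENNReal.ofReal (2 * h) * μHE[n] (Λk k) := by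
        refine ENNReal.tsum_le_tsum fun k => ?_
        rw [volume_rectangle, Real.volume_Ico]
        gcongr
        · linarith
        · rw [← EuclideanSpace.euclideanHausdorffMeasure_eq_volume]
          simpa using euclideanHausdorffMeasure_image_le
            ((lipschitzWith_tailProj n).lipschitzOnWith (s := Λk k)) n
    _ = ENNReal.ofReal (2 * h) * μHE[n] (⋃ k, Λk k) := by
        rw [ENNReal.tsum_mul_left, measure_iUnion hdisj hmeas]
    _ ≤ ENNReal.ofReal (2 * h) * μHE[n] Λ := by
        gcongr
        exact iUnion_subset fun k => inter_subset_left

end Measure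

section Riemannian

open scoped NNReal

variable {n : ℕ}
  {M : Type*} [MetricSpace M] [ChartedSpace (EuclideanSpace ℝ (Fin (n + 1))) M]
  [IsManifold (𝓡 (n + 1)) 1 M]
  [RiemannianBundle (fun p : M => TangentSpace (𝓡 (n + 1)) p)]
  [IsContinuousRiemannianBundle (EuclideanSpace ℝ (Fin (n + 1)))
    (fun p : M => TangentSpace (𝓡 (n + 1)) p)]
  [IsRiemannianManifold (𝓡 (n + 1)) M] [MeasurableSpace M] [BorelSpace M]

variable (n) in
theorem isLocallyFiniteMeasure_euclideanHausdorffMeasure :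
    IsLocallyFiniteMeasure (μHE[n + 1] : Measure M) := by
  refine ⟨fun p => ?_⟩
  obtain ⟨L, hL, ρ, hρ, htarget, hlip, -⟩ := exists_bilipschitz_extChartAt (𝓡 (n + 1)) p
  refine ⟨(extChartAt (𝓡 (n + 1)) p).symm '' Metric.ball (extChartAt (𝓡 (n + 1)) p p) ρ, ?_, ?_⟩
  · refine Filter.mem_of_superset (Filter.inter_mem (extChartAt_source_mem_nhds (I := 𝓡 (n + 1)) p)
      ((continuousAt_extChartAt (I := 𝓡 (n + 1)) p).preimage_mem_nhds (Metric.ball_mem_nhds _ hρ))) ?_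
    rintro q ⟨hq, hqB⟩
    exact ⟨_, hqB, (extChartAt (𝓡 (n + 1)) p).left_inv hq⟩
  · refine (euclideanHausdorffMeasure_image_le hlip (n + 1)).trans_lt ?_
    rw [EuclideanSpace.euclideanHausdorffMeasure_eq_volume]
    exact ENNReal.mul_lt_top (by simp) measure_ball_lt_top

variable (n) in
theorem euclideanHausdorffMeasure_pos_of_mem_nhds {p : M} {U : Set M} (hU : U ∈ 𝓝 p) :
    0 < μHE[n + 1] U := by
  set e := extChartAt (𝓡 (n + 1)) p with he
  obtain ⟨L, hL, ρ, hρ, htarget, -, hlip⟩ := exists_bilipschitz_extChartAt (𝓡 (n + 1)) p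
  have h1 : e.symm ⁻¹' U ∩ Metric.ball (e p) ρ ∈ 𝓝 (e p) :=
    Filter.inter_mem ((continuousAt_extChartAt_symm p).preimage_mem_nhds (by simpa [he] using hU))
      (Metric.ball_mem_nhds _ hρ)
  have h2 : 0 < volume (e.symm ⁻¹' U ∩ Metric.ball (e p) ρ) := Measure.measure_pos_of_mem_nhds _ h1
  have h3 : e '' (e.symm '' (e.symm ⁻¹' U ∩ Metric.ball (e p) ρ))
      = e.symm ⁻¹' U ∩ Metric.ball (e p) ρ := by
    rw [image_image]
    refine (image_congr fun y hy => e.right_inv (htarget hy.2)).trans (image_id' _)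
  have h4 := euclideanHausdorffMeasure_image_le
    (hlip.mono (image_mono (inter_subset_right (s := e.symm ⁻¹' U)))) (n + 1)
  rw [h3, EuclideanSpace.euclideanHausdorffMeasure_eq_volume] at h4
  have h5 := h2.trans_le h4
  refine (ENNReal.mul_pos_iff.1 h5).2.trans_le (measure_mono ?_)
  rintro _ ⟨y, ⟨hy, -⟩, rfl⟩
  exact hy

/-- The local version of `euclideanHausdorffMeasure_le_of_small_components`, with a bound which is linear
in the diameter `η` of the components. -/
theorem exists_nhds_euclideanHausdorffMeasure_le (p : M) :
    ∃ B ∈ 𝓝 p, ∃ K : ℝ≥0∞, K ≠ ⊤ ∧ ∃ η₀ > 0, ∀ η : ℝ, 0 < η → η < η₀ → ∀ Λ I : Set M, IsClosed Λ →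
      I ⊆ Λᶜ → (∀ q ∈ I, ∀ q' ∈ connectedComponentIn Λᶜ q, dist q q' ≤ η) →
      μHE[n + 1] (I ∩ B) ≤ K * ENNReal.ofReal η * μHE[n] Λ := by
  set e := extChartAt (𝓡 (n + 1)) p with he
  obtain ⟨L, hL, ρ, hρ, htarget, hlip', hlip⟩ := exists_bilipschitz_extChartAt (𝓡 (n + 1)) p
  have hL' : (0 : ℝ) < L := hL
  refine ⟨e.source ∩ e ⁻¹' Metric.ball (e p) (ρ / 2), Filter.inter_mem
    (extChartAt_source_mem_nhds p) ((continuousAt_extChartAt p).preimage_mem_nhds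
    (Metric.ball_mem_nhds _ (half_pos hρ))), (L : ℝ≥0∞) ^ (n + 1) * ENNReal.ofReal (4 * L) * L ^ n,
    by finiteness, ρ / (4 * L), by positivity, ?_⟩
  intro η hη hηρ Λ I hΛ hI hcomp
  have hLη : 2 * L * η < ρ / 2 := by
    rw [lt_div_iff₀ (by positivity)] at hηρ
    linarith
  -- A vertical segment of this height has end points of distance greater than `η` in `M`, and cannot
  -- be contained in a component of the complement of `Λ`.
  set h : ℝ := 2 * L * η with hh
  have hh0 : 0 < h := by positivity
  set B := Metric.ball (e p) ρ with hB
  set I' := e '' (I ∩ (e.source ∩ e ⁻¹' Metric.ball (e p) (ρ / 2))) with hI'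
  set Λ' := B ∩ e.symm ⁻¹' Λ with hΛ'
  have hcont : ContinuousOn e.symm B := (continuousOn_extChartAt_symm p).mono htarget
  have hΛ'm : MeasurableSet Λ' := by
    have : Λ' = B \ (B ∩ e.symm ⁻¹' Λᶜ) := by
      ext y; simp only [hΛ', mem_inter_iff, mem_preimage, mem_sdiff, mem_compl_iff]; tauto
    rw [this]
    exact measurableSet_ball.diff
      (hcont.isOpen_inter_preimage Metric.isOpen_ball hΛ.isOpen_compl).measurableSet
  have hI'B : I' ⊆ Metric.ball (e p) (ρ / 2) := by
    rintro _ ⟨q, ⟨-, -, hq⟩, rfl⟩; exact hq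
  have hshift : ∀ y ∈ I', ∃ τ ∈ Icc 0 h, y + τ • EuclideanSpace.single 0 (1 : ℝ) ∈ Λ' := by
    intro y hy
    by_contra! hno
    set σ : ℝ → EuclideanSpace ℝ (Fin (n + 1)) :=
      fun τ => y + τ • EuclideanSpace.single 0 (1 : ℝ) with hσ
    have hdist : ∀ τ, dist (σ τ) y = |τ| := by
      intro τ
      simp [hσ, dist_eq_norm, norm_smul]
    have hσB : ∀ τ ∈ Icc 0 h, σ τ ∈ B := by
      intro τ hτ
      have h1 := hdist τ
      rw [abs_of_nonneg hτ.1] at h1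
      have h2 := Metric.mem_ball.1 (hI'B hy)
      exact Metric.mem_ball.2 (by linarith [dist_triangle (σ τ) y (e p), hτ.2])
    obtain ⟨q, ⟨hqI, hqs, hqB⟩, hqy⟩ := hy
    have hy0 : e.symm y = q := by rw [← hqy, e.left_inv hqs]
    have hpre : IsPreconnected ((e.symm ∘ σ) '' Icc 0 h) := by
      refine isPreconnected_Icc.image _ (hcont.comp (by fun_prop) hσB)
    have hsub : (e.symm ∘ σ) '' Icc 0 h ⊆ connectedComponentIn Λᶜ q := by
      refine hpre.subset_connectedComponentIn ⟨0, ⟨le_rfl, hh0.le⟩, by simp [hσ, hy0]⟩ ?_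
      rintro _ ⟨τ, hτ, rfl⟩ hmem
      exact hno τ hτ ⟨hσB τ hτ, hmem⟩
    have h1 := hcomp q hqI _ (hsub ⟨h, ⟨hh0.le, le_rfl⟩, rfl⟩)
    have h2 : dist y (σ h) ≤ L * dist q (e.symm (σ h)) := by
      have hyB : y ∈ B := Metric.ball_subset_ball (by linarith) (hI'B ⟨q, ⟨hqI, hqs, hqB⟩, hqy⟩)
      have hb := hσB h ⟨hh0.le, le_rfl⟩
      have := hlip.dist_le_mul (e.symm y) ⟨y, hyB, rfl⟩ (e.symm (σ h)) ⟨_, hb, rfl⟩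
      rwa [← he, e.right_inv (htarget hyB), e.right_inv (htarget hb), hy0] at this
    rw [dist_comm, hdist, abs_of_pos hh0] at h2
    have h3 : h ≤ L * η := h2.trans (by gcongr; exact h1)
    have : (0 : ℝ) < L * η := by positivity
    linarith
  have hvol := volume_le_of_shift_mem hΛ'm hh0 hshift
  have h1 : I ∩ (e.source ∩ e ⁻¹' Metric.ball (e p) (ρ / 2)) = e.symm '' I' := by
    rw [hI', image_image]
    exact (image_id' _).symm.trans (image_congr fun q hq => (e.left_inv hq.2.1).symm)
  have h2 : Λ' = e '' (e.symm '' Λ') := by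
    rw [image_image]
    exact (image_id' _).symm.trans (image_congr fun y hy => (e.right_inv (htarget hy.1)).symm)
  have h3 : μHE[n] Λ' ≤ (L : ℝ≥0∞) ^ n * μHE[n] Λ := by
    rw [h2]
    refine (euclideanHausdorffMeasure_image_le (hlip.mono (image_mono inter_subset_left)) n).trans ?_
    gcongr
    rintro _ ⟨y, ⟨-, hy⟩, rfl⟩
    exact hy
  calc μHE[n + 1] (I ∩ (e.source ∩ e ⁻¹' Metric.ball (e p) (ρ / 2)))
      ≤ (L : ℝ≥0∞) ^ (n + 1) * volume I' := by
        rw [h1, ← EuclideanSpace.euclideanHausdorffMeasure_eq_volume]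
        exact euclideanHausdorffMeasure_image_le
          (hlip'.mono (hI'B.trans (Metric.ball_subset_ball (by linarith)))) (n + 1)
    _ ≤ (L : ℝ≥0∞) ^ (n + 1) * (ENNReal.ofReal (2 * h) * ((L : ℝ≥0∞) ^ n * μHE[n] Λ)) := by
        gcongr
        exact hvol.trans (by gcongr)
    _ = _ := by
        have : 2 * h = 4 * L * η := by rw [hh]; ring
        rw [this, ENNReal.ofReal_mul (by positivity)]
        ring

/-- On a compact manifold, a region all of whose connected components are small has small volume,
in terms of the area of a set which separates these components. -/
theorem euclideanHausdorffMeasure_le_of_small_components [CompactSpace M] {A ε : ℝ≥0∞}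
    (hA : A ≠ ⊤) (hε : ε ≠ 0) :
    ∃ η : ℝ, 0 < η ∧ ∀ Λ I : Set M, IsClosed Λ → μHE[n] Λ ≤ A → I ⊆ Λᶜ →
      (∀ q ∈ I, ∀ q' ∈ connectedComponentIn Λᶜ q, dist q q' ≤ η) → μHE[n + 1] I ≤ ε := by
  choose B hB K hK η₀ hη₀ H using exists_nhds_euclideanHausdorffMeasure_le (n := n) (M := M)
  obtain ⟨t, ht⟩ := isCompact_univ.elim_nhds_subcover' (fun p _ => B p) fun p _ => hB p
  have hX : (∑ p ∈ t, K p) * A ≠ ⊤ :=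
    ENNReal.mul_ne_top (ENNReal.sum_ne_top.2 fun p _ => hK p) hA
  obtain ⟨c, hc, hcε⟩ := ENNReal.exists_nnreal_pos_mul_lt hX hε
  obtain ⟨η₁, hη₁, hη₁t⟩ : ∃ η₁ > 0, ∀ p ∈ t, η₁ ≤ η₀ p := by
    rcases t.eq_empty_or_nonempty with rfl | hne
    · exact ⟨1, one_pos, by simp⟩
    · obtain ⟨p₀, -, hp₀⟩ := t.exists_min_image (fun p => η₀ p) hne
      exact ⟨η₀ p₀, hη₀ _, hp₀⟩
  refine ⟨min c (η₁ / 2), by positivity, fun Λ I hΛ hΛA hI hcomp => ?_⟩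
  set η : ℝ := min c (η₁ / 2) with hη
  have hηpos : 0 < η := by positivity
  calc μHE[n + 1] I ≤ μHE[n + 1] (⋃ p ∈ t, I ∩ B p) := by
        refine measure_mono fun q hq => ?_
        have := ht (mem_univ q)
        simp only [mem_iUnion] at this ⊢
        obtain ⟨p, hp, hqp⟩ := this
        exact ⟨p, hp, hq, hqp⟩
    _ ≤ ∑ p ∈ t, μHE[n + 1] (I ∩ B p) := measure_biUnion_finset_le _ _
    _ ≤ ∑ p ∈ t, K p * ENNReal.ofReal η * A := by
        refine Finset.sum_le_sum fun p hp => ?_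
        refine (H p η hηpos ?_ Λ I hΛ hI hcomp).trans (by gcongr)
        have h1 := hη₁t p hp
        have h2 : η ≤ η₁ / 2 := min_le_right _ _
        linarith
    _ = ENNReal.ofReal η * ((∑ p ∈ t, K p) * A) := by
        rw [← Finset.sum_mul, ← Finset.sum_mul]; ring
    _ ≤ c * ((∑ p ∈ t, K p) * A) := by
        gcongr
        rw [← ENNReal.ofReal_coe_nnreal]
        exact ENNReal.ofReal_le_ofReal (min_le_left _ _)
    _ ≤ ε := hcε.le

end Riemannian

/-! ### Metrics and second derivatives in coordinates -/

section Coordinates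

set_option maxSynthPendingDepth 3

variable {E E' F : Type*} [NormedAddCommGroup E] [NormedSpace ℝ E]
  [NormedAddCommGroup E'] [NormedSpace ℝ E'] [NormedAddCommGroup F] [NormedSpace ℝ F]

/-- The Christoffel symbols of the first kind of a metric `G` on an open set of a vector space, as a
function of three vectors. -/
noncomputable def metricChristoffel (G : E → E →L[ℝ] E →L[ℝ] ℝ) (y a b w : E) : ℝ :=
  (fderiv ℝ G y a b w + fderiv ℝ G y b a w - fderiv ℝ G y w a b) / 2

/-- The second derivative of `f` at `y`. -/
noncomputable def secondDeriv (f : E → F) (y a b : E) : F :=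
  fderiv ℝ (fderiv ℝ f) y a b

/-- The covariant Hessian of a function `f` whose gradient at `y` is `w`, for the metric `G`. -/
noncomputable def metricHessian (G : E → E →L[ℝ] E →L[ℝ] ℝ) (f : E → ℝ) (y w a b : E) : ℝ :=
  secondDeriv f y a b - metricChristoffel G y a b w

theorem fderiv_comp_eventually {ψ : E → E'} {φ : F → E} {u : F} (hψ : ContDiffAt ℝ 2 ψ (φ u))
    (hφ : ContDiffAt ℝ 2 φ u) :
    ∀ᶠ z in 𝓝 u, fderiv ℝ (ψ ∘ φ) z = (fderiv ℝ ψ (φ z)).comp (fderiv ℝ φ z) := by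
  have h1 : ∀ᶠ z in 𝓝 u, ContDiffAt ℝ 2 ψ (φ z) :=
    hφ.continuousAt.eventually (hψ.eventually (by simp))
  filter_upwards [h1, hφ.eventually (by simp)] with z hz hz'
  exact fderiv_comp z (hz.differentiableAt (by simp)) (hz'.differentiableAt (by simp))

theorem hasFDerivAt_fderiv {ψ : E → F} {y : E} (hψ : ContDiffAt ℝ 2 ψ y) :
    HasFDerivAt (fderiv ℝ ψ) (fderiv ℝ (fderiv ℝ ψ) y) y :=
  ((hψ.fderiv_right (m := 1) (by norm_num)).differentiableAt (by simp)).hasFDerivAt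

theorem secondDeriv_comp {ψ : E → E'} {φ : F → E} {u : F} (hψ : ContDiffAt ℝ 2 ψ (φ u))
    (hφ : ContDiffAt ℝ 2 φ u) (a b : F) :
    secondDeriv (ψ ∘ φ) u a b
      = secondDeriv ψ (φ u) (fderiv ℝ φ u a) (fderiv ℝ φ u b)
        + fderiv ℝ ψ (φ u) (secondDeriv φ u a b) := by
  have h1 : HasFDerivAt (fun z => fderiv ℝ ψ (φ z))
      ((fderiv ℝ (fderiv ℝ ψ) (φ u)).comp (fderiv ℝ φ u)) u :=
    (hasFDerivAt_fderiv hψ).comp u (hφ.differentiableAt (by simp)).hasFDerivAt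
  have h2 := h1.clm_comp (hasFDerivAt_fderiv hφ)
  rw [secondDeriv, Filter.EventuallyEq.fderiv_eq (fderiv_comp_eventually hψ hφ), h2.fderiv]
  simp [secondDeriv, add_comm]

theorem secondDeriv_symm {ψ : E → F} {y : E} (hψ : ContDiffAt ℝ 2 ψ y) (a b : E) :
    secondDeriv ψ y a b = secondDeriv ψ y b a :=
  (hψ.isSymmSndFDerivAt (by simp)) a b

/-- The transformation law of the Christoffel symbols under a change of coordinates. -/
theorem metricChristoffel_transform {G : E → E →L[ℝ] E →L[ℝ] ℝ} {G' : E' → E' →L[ℝ] E' →L[ℝ] ℝ}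
    {ψ : E → E'} {y : E} (hψ : ContDiffAt ℝ 2 ψ y) (hG : DifferentiableAt ℝ G y)
    (hG' : DifferentiableAt ℝ G' (ψ y))
    (hGG' : ∀ᶠ z in 𝓝 y, ∀ v w, G z v w = G' (ψ z) (fderiv ℝ ψ z v) (fderiv ℝ ψ z w))
    (hsymm : ∀ v w, G' (ψ y) v w = G' (ψ y) w v) (a b w : E) :
    metricChristoffel G y a b w
      = metricChristoffel G' (ψ y) (fderiv ℝ ψ y a) (fderiv ℝ ψ y b) (fderiv ℝ ψ y w)
        + G' (ψ y) (secondDeriv ψ y a b) (fderiv ℝ ψ y w) := by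
  have key : ∀ a b w, fderiv ℝ G y a b w
      = fderiv ℝ G' (ψ y) (fderiv ℝ ψ y a) (fderiv ℝ ψ y b) (fderiv ℝ ψ y w)
        + G' (ψ y) (secondDeriv ψ y a b) (fderiv ℝ ψ y w)
        + G' (ψ y) (fderiv ℝ ψ y b) (secondDeriv ψ y a w) := by
    intro a b w
    have h1 : HasFDerivAt (fun z => G' (ψ z)) ((fderiv ℝ G' (ψ y)).comp (fderiv ℝ ψ y)) y :=
      hG'.hasFDerivAt.comp y (hψ.differentiableAt (by simp)).hasFDerivAt
    have h2 : ∀ v : E, HasFDerivAt (fun z => fderiv ℝ ψ z v)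
        ((fderiv ℝ (fderiv ℝ ψ) y).flip v) y := by
      intro v
      have := (hasFDerivAt_fderiv hψ).clm_apply (hasFDerivAt_const v y)
      simpa using this
    have h3 := (h1.clm_apply (h2 b)).clm_apply (h2 w)
    have h4 : HasFDerivAt (fun z => G z b w) (((fderiv ℝ G y).flip b).flip w) y := by
      have := (hG.hasFDerivAt.clm_apply (hasFDerivAt_const b y)).clm_apply (hasFDerivAt_const w y)
      refine this.congr_fderiv ?_
      ext v
      simp
    have h5 := h4.unique (h3.congr_of_eventuallyEq (hGG'.mono fun z hz => hz b w))
    have h6 := congrArg (fun L => L a) h5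
    simp only [ContinuousLinearMap.flip_apply] at h6
    rw [h6]
    simp [secondDeriv]
    ring
  simp only [metricChristoffel, key]
  have s1 := secondDeriv_symm hψ b a
  have s2 := secondDeriv_symm hψ w a
  have s3 := secondDeriv_symm hψ w b
  rw [s1, s2, s3, hsymm (fderiv ℝ ψ y b) (secondDeriv ψ y a w),
    hsymm (fderiv ℝ ψ y a) (secondDeriv ψ y b w)]
  ring

theorem metricChristoffel_symm {G : E → E →L[ℝ] E →L[ℝ] ℝ} {y : E} (hG : DifferentiableAt ℝ G y)
    (hsymm : ∀ᶠ z in 𝓝 y, ∀ v w, G z v w = G z w v) (a b w : E) :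
    metricChristoffel G y a b w = metricChristoffel G y b a w := by
  have h : ∀ v w, HasFDerivAt (fun z => G z v w) (((fderiv ℝ G y).flip v).flip w) y := by
    intro v w
    have := (hG.hasFDerivAt.clm_apply (hasFDerivAt_const v y)).clm_apply (hasFDerivAt_const w y)
    refine this.congr_fderiv ?_
    ext v
    simp
  have h1 := (h a b).unique ((h b a).congr_of_eventuallyEq (hsymm.mono fun z hz => hz a b))
  have h2 := congrArg (fun L => L w) h1
  simp only [ContinuousLinearMap.flip_apply] at h2
  simp only [metricChristoffel, h2]
  ring

/-- The Christoffel symbols are bounded in terms of the derivative of the metric. As they are linear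
in `w`, they are small for a small vector `w`. -/
theorem abs_metricChristoffel_le (G : E → E →L[ℝ] E →L[ℝ] ℝ) (y a w : E) :
    |metricChristoffel G y a a w| ≤ 3 / 2 * (‖fderiv ℝ G y‖ * ‖w‖) * ‖a‖ ^ 2 := by
  have h : ∀ u v x : E, |fderiv ℝ G y u v x| ≤ ‖fderiv ℝ G y‖ * ‖u‖ * ‖v‖ * ‖x‖ := by
    intro u v x
    rw [← Real.norm_eq_abs]
    refine ((fderiv ℝ G y u v).le_opNorm x).trans ?_
    gcongr
    refine ((fderiv ℝ G y u).le_opNorm v).trans ?_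
    gcongr
    exact (fderiv ℝ G y).le_opNorm u
  have h1 := abs_le.1 (h a a w)
  have h2 := abs_le.1 (h w a a)
  rw [metricChristoffel, abs_le]
  constructor <;> nlinarith

/-- The second fundamental form `g(∇_a ∂_b φ, w)` of a map `φ`, for the metric `G`. -/
noncomputable def coordSecondForm (G : E → E →L[ℝ] E →L[ℝ] ℝ) (φ : F → E) (u : F) (w : E)
    (a b : F) : ℝ :=
  G (φ u) (secondDeriv φ u a b) w + metricChristoffel G (φ u) (fderiv ℝ φ u a) (fderiv ℝ φ u b) w

/-- The second fundamental form does not depend on the coordinates in the ambient space. -/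
theorem coordSecondForm_transform {G : E → E →L[ℝ] E →L[ℝ] ℝ} {G' : E' → E' →L[ℝ] E' →L[ℝ] ℝ}
    {ψ : E → E'} {φ : F → E} {u : F} (hφ : ContDiffAt ℝ 2 φ u)
    (hψ : ContDiffAt ℝ 2 ψ (φ u)) (hG : DifferentiableAt ℝ G (φ u))
    (hG' : DifferentiableAt ℝ G' (ψ (φ u)))
    (hGG' : ∀ᶠ z in 𝓝 (φ u), ∀ v w, G z v w = G' (ψ z) (fderiv ℝ ψ z v) (fderiv ℝ ψ z w))
    (hsymm : ∀ v w, G' (ψ (φ u)) v w = G' (ψ (φ u)) w v) (w : E) (a b : F) :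
    coordSecondForm G' (ψ ∘ φ) u (fderiv ℝ ψ (φ u) w) a b = coordSecondForm G φ u w a b := by
  have h1 : fderiv ℝ (ψ ∘ φ) u = (fderiv ℝ ψ (φ u)).comp (fderiv ℝ φ u) :=
    (fderiv_comp_eventually hψ hφ).self_of_nhds
  simp only [coordSecondForm]
  rw [secondDeriv_comp hψ hφ, h1, metricChristoffel_transform hψ hG hG' hGG' hsymm,
    hGG'.self_of_nhds]
  simp only [Function.comp_apply, ContinuousLinearMap.coe_comp, map_add,
    _root_.add_apply]
  ring

/-- The second fundamental form in the direction of the gradient of `f` measures the difference of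
the second derivatives of `f ∘ φ` and of `f`. -/
theorem coordSecondForm_gradient {G : E → E →L[ℝ] E →L[ℝ] ℝ} {φ : F → E} {u : F} {f : E → ℝ}
    (hφ : ContDiffAt ℝ 2 φ u) (hf : ContDiffAt ℝ 2 f (φ u)) {w : E}
    (hw : ∀ v, G (φ u) v w = fderiv ℝ f (φ u) v) (a b : F) :
    coordSecondForm G φ u w a b = secondDeriv (f ∘ φ) u a b
      - metricHessian G f (φ u) w (fderiv ℝ φ u a) (fderiv ℝ φ u b) := by
  rw [coordSecondForm, hw, secondDeriv_comp hf hφ, metricHessian]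
  ring

/-- At a local maximum, the second derivative is nonpositive. -/
theorem secondDeriv_nonpos_of_isLocalMax {f : E → ℝ} {y : E} (hf : ContDiffAt ℝ 2 f y)
    (hmax : IsLocalMax f y) (a : E) : secondDeriv f y a a ≤ 0 := by
  by_contra! hpos
  set g : ℝ → ℝ := fun t => f (y + t • a) with hg
  have hline : ∀ t : ℝ, HasDerivAt (fun t : ℝ => y + t • a) a t := by
    intro t
    simpa using ((hasDerivAt_id t).smul_const a).const_add y
  have hc : ContinuousAt (fun t : ℝ => y + t • a) 0 := (hline 0).continuousAt
  have hy0 : y + (0 : ℝ) • a = y := by simp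
  have h1 : ∀ᶠ t in 𝓝 (0 : ℝ), ContDiffAt ℝ 2 f (y + t • a) := by
    have := hf.eventually (by simp)
    rw [← hy0] at this
    exact hc.eventually this
  have hd1 : ∀ᶠ t in 𝓝 (0 : ℝ), deriv g t = fderiv ℝ f (y + t • a) a := by
    filter_upwards [h1] with t ht
    exact ((ht.differentiableAt (by simp)).hasFDerivAt.comp_hasDerivAt t (hline t)).deriv
  have hd2 : deriv (deriv g) 0 = secondDeriv f y a a := by
    rw [Filter.EventuallyEq.deriv_eq hd1]
    have h2 : HasFDerivAt (fun z => fderiv ℝ f z a) ((fderiv ℝ (fderiv ℝ f) y).flip a)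
        (y + (0 : ℝ) • a) := by
      have := (hasFDerivAt_fderiv hf).clm_apply (hasFDerivAt_const a y)
      rw [hy0]
      simpa using this
    have := (h2.comp_hasDerivAt (0 : ℝ) (hline 0)).deriv
    rw [secondDeriv, ← ContinuousLinearMap.flip_apply, ← this]
    rfl
  have hgmax : IsLocalMax g 0 := by
    have : Filter.Tendsto (fun t : ℝ => y + t • a) (𝓝 0) (𝓝 y) := by simpa using hc.tendsto
    have h3 := this.eventually hmax
    filter_upwards [h3] with t ht
    simpa [hg] using ht
  have hgc : ContinuousAt g 0 := by
    have : ContinuousAt f (y + (0 : ℝ) • a) := by rw [hy0]; exact hf.continuousAt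
    exact ContinuousAt.comp (f := fun t : ℝ => y + t • a) this hc
  have hgmin : IsLocalMin g 0 :=
    isLocalMin_of_deriv_deriv_pos (by rw [hd2]; exact hpos) hgmax.deriv_eq_zero hgc
  -- The function is then constant near the point, so that its second derivative vanishes.
  have hconst : g =ᶠ[𝓝 0] fun _ => g 0 := by
    filter_upwards [hgmax, hgmin] with t ht ht'
    exact le_antisymm ht ht'
  have : deriv (deriv g) 0 = 0 := by
    rw [hconst.deriv.deriv_eq]
    simp
  linarith

end Coordinates

section LinearAlgebra

open Matrix

variable {ι : Type*} [Fintype ι] [DecidableEq ι]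

open scoped MatrixOrder Matrix.Norms.L2Operator in
/-- The product of two positive definite matrices has positive trace, as it is similar to a positive
definite matrix. -/
theorem trace_inv_mul_pos [Nonempty ι] {P Q : Matrix ι ι ℝ} (hP : P.PosDef) (hQ : Q.PosDef) :
    0 < (P⁻¹ * Q).trace := by
  obtain ⟨B, hBP⟩ := CStarAlgebra.nonneg_iff_eq_star_mul_self.mp hP.inv.posSemidef.nonneg
  have hB : IsUnit B := by
    have h1 := hP.inv.isUnit
    rw [Matrix.isUnit_iff_isUnit_det, hBP, det_mul] at h1
    exact (Matrix.isUnit_iff_isUnit_det B).2 (isUnit_of_mul_isUnit_right h1)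
  have h1 : (B * Q * Bᴴ).PosDef :=
    hQ.mul_mul_conjTranspose_same (Matrix.vecMul_injective_iff_isUnit.2 hB)
  rw [hBP, star_eq_conjTranspose, Matrix.mul_assoc, trace_mul_comm]
  exact h1.trace_pos

theorem trace_inv_mul_congr {P Q A : Matrix ι ι ℝ} (hA : IsUnit A) :
    ((Aᵀ * P * A)⁻¹ * (Aᵀ * Q * A)).trace = (P⁻¹ * Q).trace := by
  have hdet : IsUnit A.det := (Matrix.isUnit_iff_isUnit_det A).1 hA
  have hdet' : IsUnit (Aᵀ).det := by rwa [det_transpose]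
  rw [Matrix.mul_inv_rev, Matrix.mul_inv_rev]
  calc (A⁻¹ * (P⁻¹ * Aᵀ⁻¹) * (Aᵀ * Q * A)).trace
      = (A⁻¹ * (P⁻¹ * (Aᵀ⁻¹ * Aᵀ) * Q * A)).trace := by simp only [Matrix.mul_assoc]
    _ = (P⁻¹ * Q * (A * A⁻¹)).trace := by
        rw [nonsing_inv_mul _ hdet', Matrix.mul_one, trace_mul_comm, Matrix.mul_assoc]
    _ = _ := by rw [mul_nonsing_inv _ hdet, Matrix.mul_one]

/-- Two linear forms which vanish on the same hyperplane are proportional. -/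
theorem exists_eq_smul_of_comp_eq_zero {V H : Type*} [AddCommGroup V] [Module ℝ V]
    [FiniteDimensional ℝ V] [AddCommGroup H] [Module ℝ H] [FiniteDimensional ℝ H]
    (hdim : Module.finrank ℝ V = Module.finrank ℝ H + 1) {T : H →ₗ[ℝ] V} (hT : Injective T)
    {ℓ ℓ' : V →ₗ[ℝ] ℝ} (hℓ : ℓ ≠ 0) (h : ∀ v, ℓ (T v) = 0) (h' : ∀ v, ℓ' (T v) = 0) :
    ∃ c : ℝ, ℓ' = c • ℓ := by
  have hle : LinearMap.range T ≤ LinearMap.ker ℓ := by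
    rintro _ ⟨v, rfl⟩; exact h v
  have hfin : Module.finrank ℝ (LinearMap.ker ℓ) = Module.finrank ℝ (LinearMap.range T) := by
    have h1 := LinearMap.finrank_range_add_finrank_ker ℓ
    have h2 : Module.finrank ℝ (LinearMap.range ℓ) = 1 := by
      rw [LinearMap.range_eq_top.2 (LinearMap.surjective hℓ)]
      simp
    rw [LinearMap.finrank_range_of_inj hT]
    omega
  have heq := Submodule.eq_of_le_of_finrank_eq hle hfin.symm
  obtain ⟨v₀, hv₀⟩ : ∃ v, ℓ v ≠ 0 := by
    by_contra! hz
    exact hℓ (LinearMap.ext hz)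
  refine ⟨ℓ' v₀ / ℓ v₀, LinearMap.ext fun v => ?_⟩
  have hker : v - (ℓ v / ℓ v₀) • v₀ ∈ LinearMap.ker ℓ := by
    simp [hv₀]
  rw [← heq] at hker
  obtain ⟨x, hx⟩ := hker
  have h3 := h' x
  rw [hx, map_sub, map_smul, smul_eq_mul, sub_eq_zero] at h3
  rw [h3, LinearMap.smul_apply, smul_eq_mul]
  field_simp

end LinearAlgebra

/-! ### The Riemannian metric in charts -/

section Metric

set_option maxSynthPendingDepth 3

variable {n : ℕ}
  {M : Type*} [TopologicalSpace M] [ChartedSpace (EuclideanSpace ℝ (Fin (n + 1))) M]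
  [RiemannianBundle (fun p : M => TangentSpace (𝓡 (n + 1)) p)]

/-- The Riemannian metric at `q`, as a function on the model space (to which the tangent space at
`q` is identified). -/
noncomputable def tangentInner (q : M) (v w : EuclideanSpace ℝ (Fin (n + 1))) : ℝ :=
  @inner ℝ (TangentSpace (𝓡 (n + 1)) q) _ v w

theorem tangentInner_symm (q : M) (v w : EuclideanSpace ℝ (Fin (n + 1))) :
    tangentInner q v w = tangentInner q w v :=
  real_inner_comm (F := TangentSpace (𝓡 (n + 1)) q) w v

theorem tangentInner_add_right (q : M) (v w w' : EuclideanSpace ℝ (Fin (n + 1))) :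
    tangentInner q v (w + w') = tangentInner q v w + tangentInner q v w' :=
  inner_add_right (E := TangentSpace (𝓡 (n + 1)) q) (𝕜 := ℝ) v w w'

theorem tangentInner_smul_right (q : M) (c : ℝ) (v w : EuclideanSpace ℝ (Fin (n + 1))) :
    tangentInner q v (c • w) = c * tangentInner q v w :=
  real_inner_smul_right (F := TangentSpace (𝓡 (n + 1)) q) v w c

theorem tangentInner_self_pos (q : M) {v : EuclideanSpace ℝ (Fin (n + 1))} (hv : v ≠ 0) :
    0 < tangentInner q v v :=
  (real_inner_self_pos (F := TangentSpace (𝓡 (n + 1)) q)).2 hv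

theorem tangentInner_add_left (q : M) (v v' w : EuclideanSpace ℝ (Fin (n + 1))) :
    tangentInner q (v + v') w = tangentInner q v w + tangentInner q v' w := by
  rw [tangentInner_symm, tangentInner_add_right, tangentInner_symm q w v, tangentInner_symm q w v']

theorem tangentInner_smul_left (q : M) (c : ℝ) (v w : EuclideanSpace ℝ (Fin (n + 1))) :
    tangentInner q (c • v) w = c * tangentInner q v w := by
  rw [tangentInner_symm, tangentInner_smul_right, tangentInner_symm q w v]

omit [RiemannianBundle (fun p : M => TangentSpace (𝓡 (n + 1)) p)] in
/-- The derivative of the inverse of the preferred chart around `p`, as an endomorphism of the model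
space. -/
noncomputable def symmDeriv (p : M) (y : EuclideanSpace ℝ (Fin (n + 1))) :
    EuclideanSpace ℝ (Fin (n + 1)) →L[ℝ] EuclideanSpace ℝ (Fin (n + 1)) :=
  mfderiv 𝓘(ℝ, EuclideanSpace ℝ (Fin (n + 1))) (𝓡 (n + 1)) (extChartAt (𝓡 (n + 1)) p).symm y

theorem chartMetric_eq (p : M) (y v w : EuclideanSpace ℝ (Fin (n + 1))) :
    chartMetric p y v w
      = tangentInner ((extChartAt (𝓡 (n + 1)) p).symm y) (symmDeriv p y v) (symmDeriv p y w) :=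
  rfl

/-- The metric in the preferred chart around `p`, as a function with values in the bilinear
forms. -/
noncomputable def metricForm (p : M) (y : EuclideanSpace ℝ (Fin (n + 1))) :
    EuclideanSpace ℝ (Fin (n + 1)) →L[ℝ] EuclideanSpace ℝ (Fin (n + 1)) →L[ℝ] ℝ :=
  (LinearMap.mk₂ ℝ (chartMetric p y)
    (fun v v' w => by simp only [chartMetric_eq, map_add, tangentInner_add_left])
    (fun c v w => by simp only [chartMetric_eq, map_smul, tangentInner_smul_left, smul_eq_mul])
    (fun v w w' => by simp only [chartMetric_eq, map_add, tangentInner_add_right])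
    (fun c v w => by simp only [chartMetric_eq, map_smul, tangentInner_smul_right,
      smul_eq_mul])).toContinuousBilinearMap

theorem metricForm_apply (p : M) (y v w : EuclideanSpace ℝ (Fin (n + 1))) :
    metricForm p y v w = chartMetric p y v w := rfl

theorem metricForm_symm (p : M) (y v w : EuclideanSpace ℝ (Fin (n + 1))) :
    metricForm p y v w = metricForm p y w v := by
  simp only [metricForm_apply, chartMetric_eq]
  exact tangentInner_symm _ _ _

variable [IsManifold (𝓡 (n + 1)) ∞ M]

omit [RiemannianBundle (fun p : M => TangentSpace (𝓡 (n + 1)) p)] in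
theorem contMDiffAt_extChartAt_symm {p : M} {y : EuclideanSpace ℝ (Fin (n + 1))}
    (hy : y ∈ (extChartAt (𝓡 (n + 1)) p).target) :
    ContMDiffAt 𝓘(ℝ, EuclideanSpace ℝ (Fin (n + 1))) (𝓡 (n + 1)) ∞
      (extChartAt (𝓡 (n + 1)) p).symm y :=
  (contMDiffOn_extChartAt_symm (n := ∞) p).contMDiffAt ((isOpen_extChartAt_target p).mem_nhds hy)

omit [RiemannianBundle (fun p : M => TangentSpace (𝓡 (n + 1)) p)] in
theorem symmDeriv_injective {p : M} {y : EuclideanSpace ℝ (Fin (n + 1))}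
    (hy : y ∈ (extChartAt (𝓡 (n + 1)) p).target) : Injective (symmDeriv p y) := by
  have h := isInvertible_mfderivWithin_extChartAt_symm (I := 𝓡 (n + 1)) hy
  rw [ModelWithCorners.range_eq_univ, mfderivWithin_univ] at h
  obtain ⟨L, hL⟩ := h
  intro v w hvw
  apply L.injective
  have : ∀ v : EuclideanSpace ℝ (Fin (n + 1)), L v = symmDeriv p y v := fun v =>
    congrArg (fun T => T v) hL
  rw [this, this, hvw]

omit [RiemannianBundle (fun p : M => TangentSpace (𝓡 (n + 1)) p)] in
theorem symmDeriv_surjective {p : M} {y : EuclideanSpace ℝ (Fin (n + 1))}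
    (hy : y ∈ (extChartAt (𝓡 (n + 1)) p).target) : Surjective (symmDeriv p y) :=
  LinearMap.surjective_of_injective (f := (symmDeriv p y).toLinearMap) (symmDeriv_injective hy)

omit [RiemannianBundle (fun p : M => TangentSpace (𝓡 (n + 1)) p)] in
/-- A change of charts. -/
theorem contDiffAt_transition {p p' : M} {y : EuclideanSpace ℝ (Fin (n + 1))}
    (hy : y ∈ (extChartAt (𝓡 (n + 1)) p).target)
    (hy' : (extChartAt (𝓡 (n + 1)) p).symm y ∈ (extChartAt (𝓡 (n + 1)) p').source) :
    ContDiffAt ℝ ∞ (extChartAt (𝓡 (n + 1)) p' ∘ (extChartAt (𝓡 (n + 1)) p).symm) y := by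
  rw [← contMDiffAt_iff_contDiffAt]
  exact (contMDiffAt_extChartAt' (by simpa using hy')).comp y (contMDiffAt_extChartAt_symm hy)

omit [RiemannianBundle (fun p : M => TangentSpace (𝓡 (n + 1)) p)] in
theorem eventually_mem_transition {p p' : M} {y : EuclideanSpace ℝ (Fin (n + 1))}
    (hy : y ∈ (extChartAt (𝓡 (n + 1)) p).target)
    (hy' : (extChartAt (𝓡 (n + 1)) p).symm y ∈ (extChartAt (𝓡 (n + 1)) p').source) :
    ∀ᶠ z in 𝓝 y, z ∈ (extChartAt (𝓡 (n + 1)) p).target ∧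
      (extChartAt (𝓡 (n + 1)) p).symm z ∈ (extChartAt (𝓡 (n + 1)) p').source := by
  refine ((isOpen_extChartAt_target p).mem_nhds hy |> Filter.Eventually.and <| ?_)
  exact (contMDiffAt_extChartAt_symm hy).continuousAt.eventually
    ((isOpen_extChartAt_source p').mem_nhds hy')

omit [RiemannianBundle (fun p : M => TangentSpace (𝓡 (n + 1)) p)] in
theorem symmDeriv_transition {p p' : M} {y : EuclideanSpace ℝ (Fin (n + 1))}
    (hy : y ∈ (extChartAt (𝓡 (n + 1)) p).target)
    (hy' : (extChartAt (𝓡 (n + 1)) p).symm y ∈ (extChartAt (𝓡 (n + 1)) p').source)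
    (v : EuclideanSpace ℝ (Fin (n + 1))) :
    symmDeriv p y v = symmDeriv p' (extChartAt (𝓡 (n + 1)) p' ((extChartAt (𝓡 (n + 1)) p).symm y))
      (fderiv ℝ (extChartAt (𝓡 (n + 1)) p' ∘ (extChartAt (𝓡 (n + 1)) p).symm) y v) := by
  set e := extChartAt (𝓡 (n + 1)) p with he
  set e' := extChartAt (𝓡 (n + 1)) p' with he'
  have h1 : e.symm =ᶠ[𝓝 y] e'.symm ∘ (e' ∘ e.symm) := by
    filter_upwards [eventually_mem_transition hy hy'] with z hz
    exact (e'.left_inv hz.2).symm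
  have h2 : MDifferentiableAt 𝓘(ℝ, EuclideanSpace ℝ (Fin (n + 1))) (𝓡 (n + 1)) e'.symm
      ((e' ∘ e.symm) y) :=
    (contMDiffAt_extChartAt_symm (e'.map_source hy')).mdifferentiableAt (by simp)
  have h3 : MDifferentiableAt 𝓘(ℝ, EuclideanSpace ℝ (Fin (n + 1)))
      𝓘(ℝ, EuclideanSpace ℝ (Fin (n + 1))) (e' ∘ e.symm) y :=
    ((contDiffAt_transition hy hy').differentiableAt (by simp)).mdifferentiableAt
  have h4 := mfderiv_comp y h2 h3
  rw [← h1.mfderiv_eq, mfderiv_eq_fderiv] at h4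
  exact congrArg (fun T : EuclideanSpace ℝ (Fin (n + 1)) →L[ℝ] EuclideanSpace ℝ (Fin (n + 1)) =>
    T v) h4

omit [RiemannianBundle (fun p : M => TangentSpace (𝓡 (n + 1)) p)] in
theorem symmDeriv_self (p : M) (v : EuclideanSpace ℝ (Fin (n + 1))) :
    symmDeriv p (extChartAt (𝓡 (n + 1)) p p) v = v := by
  set e := extChartAt (𝓡 (n + 1)) p with he
  have hy : e p ∈ e.target := mem_extChartAt_target p
  have h1 : MDifferentiableAt 𝓘(ℝ, EuclideanSpace ℝ (Fin (n + 1))) (𝓡 (n + 1)) e.symm (e p) :=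
    (contMDiffAt_extChartAt_symm hy).mdifferentiableAt (by simp)
  have h2 : symmDeriv p (e p) = fderiv ℝ (e ∘ e.symm) (e p) := by
    rw [symmDeriv, h1.mfderiv, writtenInExtChartAt, ModelWithCorners.range_eq_univ,
      fderivWithin_univ]
    have h5 : e.symm (e p) = p := extChartAt_to_inv p
    rw [h5]
    rfl
  have h3 : e ∘ e.symm =ᶠ[𝓝 (e p)] id := by
    filter_upwards [(isOpen_extChartAt_target p).mem_nhds hy] with z hz
    exact e.right_inv hz
  rw [h2, h3.fderiv_eq]
  simp

omit [RiemannianBundle (fun p : M => TangentSpace (𝓡 (n + 1)) p)] [IsManifold (𝓡 (n + 1)) ∞ M] in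
theorem mfderiv_extChartAt_self (p : M) (v : EuclideanSpace ℝ (Fin (n + 1))) :
    mfderiv (𝓡 (n + 1)) 𝓘(ℝ, EuclideanSpace ℝ (Fin (n + 1))) (extChartAt (𝓡 (n + 1)) p) p v
      = v := by
  set e := extChartAt (𝓡 (n + 1)) p with he
  have h1 : MDifferentiableAt (𝓡 (n + 1)) 𝓘(ℝ, EuclideanSpace ℝ (Fin (n + 1))) e p :=
    (contMDiffAt_extChartAt (n := ∞)).mdifferentiableAt (by simp)
  have h3 : e ∘ e.symm =ᶠ[𝓝 (e p)] id := by
    filter_upwards [(isOpen_extChartAt_target p).mem_nhds (mem_extChartAt_target p)] with z hz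
    exact e.right_inv hz
  rw [h1.mfderiv, writtenInExtChartAt, ModelWithCorners.range_eq_univ, fderivWithin_univ]
  have h4 : fderiv ℝ (e ∘ e.symm) (e p) v = v := by
    rw [h3.fderiv_eq]; simp
  exact h4

theorem metricForm_transition {p p' : M} {y : EuclideanSpace ℝ (Fin (n + 1))}
    (hy : y ∈ (extChartAt (𝓡 (n + 1)) p).target)
    (hy' : (extChartAt (𝓡 (n + 1)) p).symm y ∈ (extChartAt (𝓡 (n + 1)) p').source)
    (v w : EuclideanSpace ℝ (Fin (n + 1))) :
    metricForm p y v w = metricForm p' ((extChartAt (𝓡 (n + 1)) p' ∘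
        (extChartAt (𝓡 (n + 1)) p).symm) y)
      (fderiv ℝ (extChartAt (𝓡 (n + 1)) p' ∘ (extChartAt (𝓡 (n + 1)) p).symm) y v)
      (fderiv ℝ (extChartAt (𝓡 (n + 1)) p' ∘ (extChartAt (𝓡 (n + 1)) p).symm) y w) := by
  simp only [metricForm_apply, chartMetric_eq, Function.comp_apply]
  rw [(extChartAt (𝓡 (n + 1)) p').left_inv hy', symmDeriv_transition hy hy' v,
    symmDeriv_transition hy hy' w]

theorem metricForm_self_pos {p : M} {y v : EuclideanSpace ℝ (Fin (n + 1))}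
    (hy : y ∈ (extChartAt (𝓡 (n + 1)) p).target) (hv : v ≠ 0) : 0 < metricForm p y v v := by
  rw [metricForm_apply, chartMetric_eq]
  refine tangentInner_self_pos _ fun h => hv (symmDeriv_injective hy ?_)
  rw [h, map_zero]

variable [IsContMDiffRiemannianBundle (𝓡 (n + 1)) ∞ (EuclideanSpace ℝ (Fin (n + 1)))
    (fun p : M => TangentSpace (𝓡 (n + 1)) p)]

theorem contDiffOn_metricForm (p : M) :
    ContDiffOn ℝ ∞ (metricForm p) (extChartAt (𝓡 (n + 1)) p).target := by
  rw [contDiffOn_clm_apply]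
  intro v
  rw [contDiffOn_clm_apply]
  intro w
  set e := extChartAt (𝓡 (n + 1)) p with he
  have hunique : UniqueMDiffOn 𝓘(ℝ, EuclideanSpace ℝ (Fin (n + 1))) e.target :=
    (isOpen_extChartAt_target p).uniqueMDiffOn
  have h1 : ContMDiffOn 𝓘(ℝ, EuclideanSpace ℝ (Fin (n + 1))) (𝓡 (n + 1)) ∞ e.symm e.target :=
    contMDiffOn_extChartAt_symm p
  have h2 := h1.contMDiffOn_tangentMapWithin (m := ∞) (by simp) hunique
  have h3 : ∀ v : EuclideanSpace ℝ (Fin (n + 1)),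
      ContMDiffOn 𝓘(ℝ, EuclideanSpace ℝ (Fin (n + 1))) (𝓡 (n + 1)).tangent ∞
      (fun z => (⟨e.symm z, symmDeriv p z v⟩ : TangentBundle (𝓡 (n + 1)) M)) e.target := by
    intro v
    have h4 : ContMDiffOn 𝓘(ℝ, EuclideanSpace ℝ (Fin (n + 1)))
        𝓘(ℝ, EuclideanSpace ℝ (Fin (n + 1))).tangent ∞
        (fun z => (⟨z, v⟩ : TangentBundle 𝓘(ℝ, EuclideanSpace ℝ (Fin (n + 1)))
          (EuclideanSpace ℝ (Fin (n + 1))))) e.target := by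
      exact (contMDiffOn_vectorSpace_iff_contDiffOn (V := fun _ => v)).2 contDiffOn_const
    refine (h2.comp h4 fun z hz => hz).congr fun z hz => ?_
    simp only [tangentMapWithin, Function.comp_apply]
    rw [mfderivWithin_of_isOpen (isOpen_extChartAt_target p) hz]
    rfl
  have h5 := ContMDiffOn.inner_bundle (h3 v) (h3 w)
  rw [contMDiffOn_iff_contDiffOn] at h5
  exact h5

theorem contDiffAt_metricForm {p : M} {y : EuclideanSpace ℝ (Fin (n + 1))}
    (hy : y ∈ (extChartAt (𝓡 (n + 1)) p).target) : ContDiffAt ℝ ∞ (metricForm p) y :=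
  (contDiffOn_metricForm p).contDiffAt ((isOpen_extChartAt_target p).mem_nhds hy)

/-- The Christoffel symbols of `M` in a chart are those of the metric in this chart. Inside of the
target of the chart, the metric is smooth, so that none of the derivatives is a junk value. -/
theorem christoffel_eq {p : M} {y : EuclideanSpace ℝ (Fin (n + 1))}
    (hy : y ∈ (extChartAt (𝓡 (n + 1)) p).target) (a b w : EuclideanSpace ℝ (Fin (n + 1))) :
    christoffel p y a b w = metricChristoffel (metricForm p) y a b w := by
  have hd : DifferentiableAt ℝ (metricForm p) y :=
    (contDiffAt_metricForm hy).differentiableAt (by simp)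
  have h : ∀ v w, fderiv ℝ (fun z => chartMetric p z v w) y
      = ((fderiv ℝ (metricForm p) y).flip v).flip w := by
    intro v w
    have := (hd.hasFDerivAt.clm_apply (hasFDerivAt_const v y)).clm_apply (hasFDerivAt_const w y)
    refine HasFDerivAt.fderiv (this.congr_fderiv ?_)
    ext v
    simp
  simp only [christoffel, metricChristoffel, h, ContinuousLinearMap.flip_apply]

end Metric

/-! ### Mean curvature and the Hessian of a function -/

section Curvature

set_option maxSynthPendingDepth 3

theorem two_le_infty : (2 : WithTop ℕ∞) ≤ (∞ : WithTop ℕ∞) := WithTop.coe_le_coe.2 le_top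

variable {n : ℕ}
  {M : Type*} [TopologicalSpace M] [ChartedSpace (EuclideanSpace ℝ (Fin (n + 1))) M]
  {S : Type*} [TopologicalSpace S] [ChartedSpace (EuclideanSpace ℝ (Fin n)) S]

/-- The map `φ` in the preferred charts around `x` and `p`, where `p` need not be `φ x`. -/
noncomputable def coordMap (p : M) (φ : S → M) (x : S) :
    EuclideanSpace ℝ (Fin n) → EuclideanSpace ℝ (Fin (n + 1)) :=
  extChartAt (𝓡 (n + 1)) p ∘ φ ∘ (extChartAt (𝓡 n) x).symm

variable (n) in
/-- The derivative of `φ` at `x`, as a linear map between the model spaces. -/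
noncomputable def pushforward (φ : S → M) (x : S) :
    EuclideanSpace ℝ (Fin n) →L[ℝ] EuclideanSpace ℝ (Fin (n + 1)) :=
  mfderiv (𝓡 n) (𝓡 (n + 1)) φ x

theorem coordMap_apply {p : M} {φ : S → M} {x x' : S} (hx : x' ∈ (extChartAt (𝓡 n) x).source) :
    coordMap p φ x (extChartAt (𝓡 n) x x') = extChartAt (𝓡 (n + 1)) p (φ x') := by
  simp only [coordMap, Function.comp_apply, (extChartAt (𝓡 n) x).left_inv hx]

theorem eventually_symm_comp_coordMap {p : M} {φ : S → M} {x : S}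
    (hφ : ContMDiffAt (𝓡 n) (𝓡 (n + 1)) ∞ φ x) (hp : φ x ∈ (extChartAt (𝓡 (n + 1)) p).source) :
    ∀ᶠ z in 𝓝 (extChartAt (𝓡 n) x x), (extChartAt (𝓡 (n + 1)) p).symm (coordMap p φ x z)
      = φ ((extChartAt (𝓡 n) x).symm z) := by
  have h1 : ContinuousAt (φ ∘ (extChartAt (𝓡 n) x).symm) (extChartAt (𝓡 n) x x) := by
    refine ContinuousAt.comp ?_ (continuousAt_extChartAt_symm x)
    rw [extChartAt_to_inv]
    exact hφ.continuousAt
  have h2 : (extChartAt (𝓡 (n + 1)) p).source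
      ∈ 𝓝 ((φ ∘ (extChartAt (𝓡 n) x).symm) (extChartAt (𝓡 n) x x)) := by
    rw [Function.comp_apply, extChartAt_to_inv]
    exact (isOpen_extChartAt_source p).mem_nhds hp
  filter_upwards [h1.eventually h2] with z hz
  exact (extChartAt (𝓡 (n + 1)) p).left_inv hz

theorem eventually_coordMap_transition {p p' : M} {φ : S → M} {x : S}
    (hφ : ContMDiffAt (𝓡 n) (𝓡 (n + 1)) ∞ φ x) (hp : φ x ∈ (extChartAt (𝓡 (n + 1)) p).source) :
    coordMap p' φ x =ᶠ[𝓝 (extChartAt (𝓡 n) x x)]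
      (extChartAt (𝓡 (n + 1)) p' ∘ (extChartAt (𝓡 (n + 1)) p).symm) ∘ coordMap p φ x := by
  filter_upwards [eventually_symm_comp_coordMap hφ hp] with z hz
  rw [Function.comp_apply, Function.comp_apply, hz]
  rfl

theorem comp_coordMap_eventuallyEq {p : M} {φ : S → M} {x : S} {f : M → ℝ}
    (hφ : ContMDiffAt (𝓡 n) (𝓡 (n + 1)) ∞ φ x) (hp : φ x ∈ (extChartAt (𝓡 (n + 1)) p).source) :
    (f ∘ (extChartAt (𝓡 (n + 1)) p).symm) ∘ coordMap p φ x =ᶠ[𝓝 (extChartAt (𝓡 n) x x)]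
      (f ∘ φ) ∘ (extChartAt (𝓡 n) x).symm := by
  filter_upwards [eventually_symm_comp_coordMap hφ hp] with z hz
  rw [Function.comp_apply, Function.comp_apply, hz]
  rfl

theorem isLocalMax_comp_coordMap {p : M} {φ : S → M} {x : S} {f : M → ℝ}
    (hφ : ContMDiffAt (𝓡 n) (𝓡 (n + 1)) ∞ φ x) (hp : φ x ∈ (extChartAt (𝓡 (n + 1)) p).source)
    (hmax : IsLocalMax (f ∘ φ) x) :
    IsLocalMax ((f ∘ (extChartAt (𝓡 (n + 1)) p).symm) ∘ coordMap p φ x)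
      (extChartAt (𝓡 n) x x) := by
  have h1 := comp_coordMap_eventuallyEq (f := f) hφ hp
  have h2 : Filter.Tendsto (extChartAt (𝓡 n) x).symm (𝓝 (extChartAt (𝓡 n) x x)) (𝓝 x) := by
    have := (continuousAt_extChartAt_symm (I := 𝓡 n) x).tendsto
    rwa [extChartAt_to_inv] at this
  have h3 := h2.eventually hmax
  filter_upwards [h1, h3] with z hz hz'
  rw [hz, h1.self_of_nhds]
  simpa using hz'

variable [IsManifold (𝓡 (n + 1)) ∞ M]

/-- The derivative of the inverse of a chart is the derivative of a transition map, as the tangent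
space at `q` is identified with the model space by the preferred chart around `q`. -/
theorem symmDeriv_eq_fderiv {p : M} {q : M} (hq : q ∈ (extChartAt (𝓡 (n + 1)) p).source)
    (v : EuclideanSpace ℝ (Fin (n + 1))) :
    symmDeriv p (extChartAt (𝓡 (n + 1)) p q) v
      = fderiv ℝ (extChartAt (𝓡 (n + 1)) q ∘ (extChartAt (𝓡 (n + 1)) p).symm)
        (extChartAt (𝓡 (n + 1)) p q) v := by
  have hy := (extChartAt (𝓡 (n + 1)) p).map_source hq
  have h0 : (extChartAt (𝓡 (n + 1)) p).symm (extChartAt (𝓡 (n + 1)) p q) = q :=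
    (extChartAt (𝓡 (n + 1)) p).left_inv hq
  have h := symmDeriv_transition (p' := q) hy (by rw [h0]; exact mem_extChartAt_source q) v
  rw [h0, symmDeriv_self] at h
  exact h

theorem differential_symmDeriv {p q : M} (hq : q ∈ (extChartAt (𝓡 (n + 1)) p).source) {f : M → ℝ}
    (hf : ContMDiffAt (𝓡 (n + 1)) 𝓘(ℝ) ∞ f q) (v : EuclideanSpace ℝ (Fin (n + 1))) :
    differential (n + 1) f q (symmDeriv p (extChartAt (𝓡 (n + 1)) p q) v)
      = fderiv ℝ (f ∘ (extChartAt (𝓡 (n + 1)) p).symm) (extChartAt (𝓡 (n + 1)) p q) v := by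
  set e := extChartAt (𝓡 (n + 1)) p with he
  set e' := extChartAt (𝓡 (n + 1)) q with he'
  have hy := e.map_source hq
  have h0 : e.symm (e q) = q := e.left_inv hq
  have hy' : e.symm (e q) ∈ e'.source := by rw [h0]; exact mem_extChartAt_source q
  have h1 : f ∘ e.symm =ᶠ[𝓝 (e q)] (f ∘ e'.symm) ∘ (e' ∘ e.symm) := by
    filter_upwards [eventually_mem_transition hy hy'] with z hz
    simp only [Function.comp_apply]
    rw [e'.left_inv hz.2]
  have h2 : DifferentiableAt ℝ (f ∘ e'.symm) ((e' ∘ e.symm) (e q)) := by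
    rw [Function.comp_apply, h0]
    exact (contDiffAt_comp_extChartAt_symm (mem_extChartAt_source q) hf).differentiableAt (by simp)
  rw [h1.fderiv_eq, fderiv_comp _ h2 ((contDiffAt_transition hy hy').differentiableAt (by simp)),
    symmDeriv_eq_fderiv hq, differential_eq_fderiv_extChartAt (hf.mdifferentiableAt (by simp)),
    Function.comp_apply, h0]
  rfl

variable [IsManifold (𝓡 n) ∞ S]

theorem contDiffAt_coordMap {p : M} {φ : S → M} {x x' : S} (hφ : ContMDiffAt (𝓡 n) (𝓡 (n + 1)) ∞ φ x')
    (hx : x' ∈ (extChartAt (𝓡 n) x).source) (hp : φ x' ∈ (extChartAt (𝓡 (n + 1)) p).source) :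
    ContDiffAt ℝ ∞ (coordMap p φ x) (extChartAt (𝓡 n) x x') := by
  rw [← contMDiffAt_iff_contDiffAt]
  have h0 : (extChartAt (𝓡 n) x).symm (extChartAt (𝓡 n) x x') = x' := (extChartAt (𝓡 n) x).left_inv hx
  have h1 : ContMDiffAt 𝓘(ℝ, EuclideanSpace ℝ (Fin n)) (𝓡 n) ∞ (extChartAt (𝓡 n) x).symm
      (extChartAt (𝓡 n) x x') :=
    (contMDiffOn_extChartAt_symm (n := ∞) x).contMDiffAt
      ((isOpen_extChartAt_target x).mem_nhds ((extChartAt (𝓡 n) x).map_source hx))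
  have h2 : ContMDiffAt (𝓡 (n + 1)) 𝓘(ℝ, EuclideanSpace ℝ (Fin (n + 1))) ∞
      (extChartAt (𝓡 (n + 1)) p) (φ x') := contMDiffAt_extChartAt' (by simpa using hp)
  have h3 : ContMDiffAt 𝓘(ℝ, EuclideanSpace ℝ (Fin n)) (𝓡 (n + 1)) ∞
      (φ ∘ (extChartAt (𝓡 n) x).symm) (extChartAt (𝓡 n) x x') :=
    ContMDiffAt.comp _ (by rwa [h0]) h1
  exact ContMDiffAt.comp _ (by rw [Function.comp_apply, h0]; exact h2) h3

theorem symmDeriv_fderiv_coordMap {p : M} {φ : S → M} {x : S}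
    (hφ : ContMDiffAt (𝓡 n) (𝓡 (n + 1)) ∞ φ x) (hp : φ x ∈ (extChartAt (𝓡 (n + 1)) p).source)
    (a : EuclideanSpace ℝ (Fin n)) :
    symmDeriv p (extChartAt (𝓡 (n + 1)) p (φ x))
      (fderiv ℝ (coordMap p φ x) (extChartAt (𝓡 n) x x) a) = pushforward n φ x a := by
  have h0 : pushforward n φ x = fderiv ℝ (coordMap (φ x) φ x) (extChartAt (𝓡 n) x x) := by
    rw [pushforward, (hφ.mdifferentiableAt (by simp)).mfderiv, writtenInExtChartAt,
      ModelWithCorners.range_eq_univ, fderivWithin_univ]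
    rfl
  have hc := coordMap_apply (p := p) (φ := φ) (mem_extChartAt_source (I := 𝓡 n) x)
  have hy := (extChartAt (𝓡 (n + 1)) p).map_source hp
  have hψ : DifferentiableAt ℝ (extChartAt (𝓡 (n + 1)) (φ x) ∘ (extChartAt (𝓡 (n + 1)) p).symm)
      (coordMap p φ x (extChartAt (𝓡 n) x x)) := by
    rw [hc]
    refine (contDiffAt_transition hy ?_).differentiableAt (by simp)
    rw [(extChartAt (𝓡 (n + 1)) p).left_inv hp]
    exact mem_extChartAt_source _
  have hφ' := (contDiffAt_coordMap hφ (mem_extChartAt_source x) hp).differentiableAt (by simp)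
  rw [h0, (eventually_coordMap_transition (p' := φ x) hφ hp).fderiv_eq, fderiv_comp _ hψ hφ', hc,
    symmDeriv_eq_fderiv hp]
  rfl

/-- The chain rule for a function on `M` along `φ`, in charts. -/
theorem fderiv_comp_coordMap {p : M} {φ : S → M} {x : S} {f : M → ℝ}
    (hφ : ContMDiffAt (𝓡 n) (𝓡 (n + 1)) ∞ φ x) (hp : φ x ∈ (extChartAt (𝓡 (n + 1)) p).source)
    (hf : ContMDiffAt (𝓡 (n + 1)) 𝓘(ℝ) ∞ f (φ x)) (a : EuclideanSpace ℝ (Fin n)) :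
    fderiv ℝ ((f ∘ (extChartAt (𝓡 (n + 1)) p).symm) ∘ coordMap p φ x) (extChartAt (𝓡 n) x x) a
      = differential (n + 1) f (φ x) (pushforward n φ x a) := by
  have hc := coordMap_apply (p := p) (φ := φ) (mem_extChartAt_source (I := 𝓡 n) x)
  rw [← symmDeriv_fderiv_coordMap hφ hp, differential_symmDeriv hp hf]
  rw [fderiv_comp _ (by
      rw [hc]; exact (contDiffAt_comp_extChartAt_symm hp hf).differentiableAt (by simp))
    ((contDiffAt_coordMap hφ (mem_extChartAt_source x) hp).differentiableAt (by simp)), hc]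
  rfl

/-- The differential of a function vanishes on the tangent space of a hypersurface at a local
maximum of its restriction. -/
theorem differential_pushforward_eq_zero {φ : S → M} {x : S} {f : M → ℝ}
    (hφ : ContMDiffAt (𝓡 n) (𝓡 (n + 1)) ∞ φ x)
    (hf : ContMDiffAt (𝓡 (n + 1)) 𝓘(ℝ) ∞ f (φ x)) (hmax : IsLocalMax (f ∘ φ) x)
    (a : EuclideanSpace ℝ (Fin n)) :
    differential (n + 1) f (φ x) (pushforward n φ x a) = 0 := by
  rw [← fderiv_comp_coordMap (p := φ x) hφ (mem_extChartAt_source _) hf,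
    (isLocalMax_comp_coordMap hφ (mem_extChartAt_source _) hmax).fderiv_eq_zero]
  rfl

variable [RiemannianBundle (fun p : M => TangentSpace (𝓡 (n + 1)) p)]

/-- The first fundamental form may be computed in the chart of `M` around any point `p`. -/
theorem firstFundamentalForm_eq {p : M} {φ : S → M} {x : S}
    (hφ : ContMDiffAt (𝓡 n) (𝓡 (n + 1)) ∞ φ x) (hp : φ x ∈ (extChartAt (𝓡 (n + 1)) p).source)
    (i j : Fin n) :
    firstFundamentalForm φ x i j = metricForm p (extChartAt (𝓡 (n + 1)) p (φ x))
      (fderiv ℝ (coordMap p φ x) (extChartAt (𝓡 n) x x) (EuclideanSpace.single i 1))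
      (fderiv ℝ (coordMap p φ x) (extChartAt (𝓡 n) x x) (EuclideanSpace.single j 1)) := by
  have key : ∀ p : M, φ x ∈ (extChartAt (𝓡 (n + 1)) p).source →
      metricForm p (extChartAt (𝓡 (n + 1)) p (φ x))
        (fderiv ℝ (coordMap p φ x) (extChartAt (𝓡 n) x x) (EuclideanSpace.single i 1))
        (fderiv ℝ (coordMap p φ x) (extChartAt (𝓡 n) x x) (EuclideanSpace.single j 1))
      = tangentInner (φ x) (pushforward n φ x (EuclideanSpace.single i 1))
        (pushforward n φ x (EuclideanSpace.single j 1)) := by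
    intro p hp
    rw [metricForm_apply, chartMetric_eq, symmDeriv_fderiv_coordMap hφ hp,
      symmDeriv_fderiv_coordMap hφ hp, (extChartAt (𝓡 (n + 1)) p).left_inv hp]
  rw [key p hp, ← key (φ x) (mem_extChartAt_source _)]
  rfl

variable [IsContMDiffRiemannianBundle (𝓡 (n + 1)) ∞ (EuclideanSpace ℝ (Fin (n + 1)))
    (fun p : M => TangentSpace (𝓡 (n + 1)) p)]

/-- The second fundamental form may be computed in the chart of `M` around any point `p`. -/
theorem secondFundamentalForm_eq {p : M} {φ : S → M} {x : S}
    (hφ : ContMDiffAt (𝓡 n) (𝓡 (n + 1)) ∞ φ x) (hp : φ x ∈ (extChartAt (𝓡 (n + 1)) p).source)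
    (w : EuclideanSpace ℝ (Fin (n + 1))) (i j : Fin n) :
    secondFundamentalForm φ x (symmDeriv p (extChartAt (𝓡 (n + 1)) p (φ x)) w) i j
      = coordSecondForm (metricForm p) (coordMap p φ x) (extChartAt (𝓡 n) x x) w
        (EuclideanSpace.single i 1) (EuclideanSpace.single j 1) := by
  have hself : ∀ w : EuclideanSpace ℝ (Fin (n + 1)), secondFundamentalForm φ x w i j
      = coordSecondForm (metricForm (φ x)) (coordMap (φ x) φ x) (extChartAt (𝓡 n) x x) w
        (EuclideanSpace.single i 1) (EuclideanSpace.single j 1) := by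
    intro w
    have h1 : fderiv ℝ (partialDeriv φ x j) (extChartAt (𝓡 n) x x) (EuclideanSpace.single i 1)
        = secondDeriv (coordMap (φ x) φ x) (extChartAt (𝓡 n) x x) (EuclideanSpace.single i 1)
          (EuclideanSpace.single j 1) := by
      have h2 := (hasFDerivAt_fderiv ((contDiffAt_coordMap hφ (mem_extChartAt_source x)
        (mem_extChartAt_source (φ x))).of_le two_le_infty)).clm_apply
        (hasFDerivAt_const (EuclideanSpace.single j (1 : ℝ)) (extChartAt (𝓡 n) x x))
      have h3 : partialDeriv φ x j
          = fun u => fderiv ℝ (coordMap (φ x) φ x) u (EuclideanSpace.single j 1) := rfl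
      rw [h3, h2.fderiv]
      simp [secondDeriv]
    have h4 : coordMap (φ x) φ x (extChartAt (𝓡 n) x x) = extChartAt (𝓡 (n + 1)) (φ x) (φ x) :=
      coordMap_apply (mem_extChartAt_source x)
    simp only [secondFundamentalForm, Matrix.of_apply, coordSecondForm]
    rw [h1, h4]
    refine congrArg₂ (· + ·) ?_ ?_
    · exact congrArg (chartMetric (φ x) (extChartAt (𝓡 (n + 1)) (φ x) (φ x)) _)
        (mfderiv_extChartAt_self (φ x) w)
    · exact (christoffel_eq (mem_extChartAt_target _) _ _ _).trans
        (congrArg (metricChristoffel (metricForm (φ x)) (extChartAt (𝓡 (n + 1)) (φ x) (φ x))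
          (partialDeriv φ x i (extChartAt (𝓡 n) x x)) (partialDeriv φ x j (extChartAt (𝓡 n) x x)))
          (mfderiv_extChartAt_self (φ x) w))
  have hc := coordMap_apply (p := p) (φ := φ) (mem_extChartAt_source (I := 𝓡 n) x)
  have hy := (extChartAt (𝓡 (n + 1)) p).map_source hp
  have hy' : (extChartAt (𝓡 (n + 1)) p).symm (extChartAt (𝓡 (n + 1)) p (φ x))
      ∈ (extChartAt (𝓡 (n + 1)) (φ x)).source := by
    rw [(extChartAt (𝓡 (n + 1)) p).left_inv hp]
    exact mem_extChartAt_source _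
  have hev := eventually_coordMap_transition (p' := φ x) hφ hp
  have hcongr : ∀ (ψ : EuclideanSpace ℝ (Fin n) → EuclideanSpace ℝ (Fin (n + 1))),
      coordMap (φ x) φ x =ᶠ[𝓝 (extChartAt (𝓡 n) x x)] ψ → ∀ w a b,
      coordSecondForm (metricForm (φ x)) (coordMap (φ x) φ x) (extChartAt (𝓡 n) x x) w a b
        = coordSecondForm (metricForm (φ x)) ψ (extChartAt (𝓡 n) x x) w a b := by
    intro ψ hψ w a b
    simp only [coordSecondForm, secondDeriv, hψ.fderiv.fderiv_eq, hψ.fderiv_eq, hψ.eq_of_nhds]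
  rw [hself, hcongr _ hev, symmDeriv_eq_fderiv hp, ← hc]
  refine coordSecondForm_transform ?_ ?_ ?_ ?_ ?_ ?_ w _ _
  · exact (contDiffAt_coordMap hφ (mem_extChartAt_source x) hp).of_le two_le_infty
  · rw [hc]; exact (contDiffAt_transition hy hy').of_le two_le_infty
  · rw [hc]; exact (contDiffAt_metricForm hy).differentiableAt (by simp)
  · rw [hc]
    refine (contDiffAt_metricForm ?_).differentiableAt (by simp)
    exact (extChartAt (𝓡 (n + 1)) (φ x)).map_source hy'
  · rw [hc]
    filter_upwards [eventually_mem_transition hy hy'] with z hz v w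
    exact metricForm_transition hz.1 hz.2 v w
  · intro v w
    exact metricForm_symm _ _ v w

end Curvature

/-! ### Traces of bilinear forms -/

section RelativeTrace

variable {n : ℕ}

/-- The trace of the bilinear form `Q` with respect to the (nondegenerate) bilinear form `P`. -/
noncomputable def relTrace (P Q : LinearMap.BilinForm ℝ (EuclideanSpace ℝ (Fin n))) : ℝ :=
  ((LinearMap.BilinForm.toMatrix (EuclideanSpace.basisFun (Fin n) ℝ).toBasis P)⁻¹ *
    LinearMap.BilinForm.toMatrix (EuclideanSpace.basisFun (Fin n) ℝ).toBasis Q).trace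

theorem posDef_toMatrix {P : LinearMap.BilinForm ℝ (EuclideanSpace ℝ (Fin n))}
    (hs : ∀ v w, P v w = P w v) (hP : ∀ v, v ≠ 0 → 0 < P v v) :
    (LinearMap.BilinForm.toMatrix (EuclideanSpace.basisFun (Fin n) ℝ).toBasis P).PosDef := by
  refine Matrix.PosDef.of_dotProduct_mulVec_pos ?_ ?_
  · ext i j
    simp only [Matrix.conjTranspose_apply, LinearMap.BilinForm.toMatrix_apply, star_trivial]
    exact hs _ _
  · intro x hx
    rw [star_trivial, LinearMap.BilinForm.dotProduct_toMatrix_mulVec]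
    refine hP _ fun h => hx ?_
    simpa using h

theorem relTrace_pos (hn : 0 < n) {P Q : LinearMap.BilinForm ℝ (EuclideanSpace ℝ (Fin n))}
    (hs : ∀ v w, P v w = P w v) (hP : ∀ v, v ≠ 0 → 0 < P v v)
    (hs' : ∀ v w, Q v w = Q w v) (hQ : ∀ v, v ≠ 0 → 0 < Q v v) : 0 < relTrace P Q := by
  have : Nonempty (Fin n) := ⟨⟨0, hn⟩⟩
  exact trace_inv_mul_pos (posDef_toMatrix hs hP) (posDef_toMatrix hs' hQ)

theorem relTrace_neg (P Q : LinearMap.BilinForm ℝ (EuclideanSpace ℝ (Fin n))) :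
    relTrace P (-Q) = -relTrace P Q := by
  have h : LinearMap.BilinForm.toMatrix (EuclideanSpace.basisFun (Fin n) ℝ).toBasis (-Q)
      = -LinearMap.BilinForm.toMatrix (EuclideanSpace.basisFun (Fin n) ℝ).toBasis Q := by
    ext i j
    simp only [LinearMap.BilinForm.toMatrix_apply, Matrix.neg_apply]
    rfl
  rw [relTrace, relTrace, h, Matrix.mul_neg, Matrix.trace_neg]

/-- The relative trace does not depend on the basis. -/
theorem relTrace_comp (P Q : LinearMap.BilinForm ℝ (EuclideanSpace ℝ (Fin n)))
    {T : EuclideanSpace ℝ (Fin n) →ₗ[ℝ] EuclideanSpace ℝ (Fin n)} (hT : Injective T) :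
    relTrace (P.comp T T) (Q.comp T T) = relTrace P Q := by
  simp only [relTrace, LinearMap.BilinForm.toMatrix_comp
    (EuclideanSpace.basisFun (Fin n) ℝ).toBasis]
  refine trace_inv_mul_congr ?_
  rw [LinearMap.isUnit_toMatrix_iff]
  exact (LinearMap.isUnit_iff_ker_eq_bot T).2 (LinearMap.ker_eq_bot.2 hT)

theorem relTrace_comp_comp {E : Type*} [AddCommGroup E] [Module ℝ E]
    (P Q : LinearMap.BilinForm ℝ E) (D : EuclideanSpace ℝ (Fin n) →ₗ[ℝ] E)
    {T : EuclideanSpace ℝ (Fin n) →ₗ[ℝ] EuclideanSpace ℝ (Fin n)} (hT : Injective T) :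
    relTrace (P.comp (D ∘ₗ T) (D ∘ₗ T)) (Q.comp (D ∘ₗ T) (D ∘ₗ T))
      = relTrace (P.comp D D) (Q.comp D D) :=
  relTrace_comp (P.comp D D) (Q.comp D D) hT

theorem continuousAt_trace_inv_mul {X ι : Type*} [TopologicalSpace X] [Fintype ι] [DecidableEq ι]
    {x₀ : X} {P Q : X → Matrix ι ι ℝ} (hdet : (P x₀).det ≠ 0)
    (hP : ∀ i j, ContinuousAt (fun x => P x i j) x₀)
    (hQ : ∀ i j, ContinuousAt (fun x => Q x i j) x₀) :
    ContinuousAt (fun x => ((P x)⁻¹ * Q x).trace) x₀ := by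
  have h1 : ContinuousAt P x₀ := continuousAt_pi.2 fun i => continuousAt_pi.2 fun j => hP i j
  have hd : Continuous (fun A : Matrix ι ι ℝ => A.det) := Continuous.matrix_det continuous_id
  have ha : Continuous (fun A : Matrix ι ι ℝ => A.adjugate) :=
    Continuous.matrix_adjugate continuous_id
  have h5 : ContinuousAt (fun x => (P x).det) x₀ := hd.continuousAt.comp' h1
  have h6 : ContinuousAt (fun x => (P x).adjugate) x₀ := ha.continuousAt.comp' h1
  have h3 : ContinuousAt (fun x => (P x)⁻¹) x₀ := by
    simp only [Matrix.inv_def, Ring.inverse_eq_inv']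
    exact (h5.inv₀ hdet).smul h6
  have h4 : ∀ i j, ContinuousAt (fun x => (P x)⁻¹ i j) x₀ := fun i j =>
    continuousAt_pi.1 (continuousAt_pi.1 h3 i) j
  simp only [Matrix.trace, Matrix.diag_apply, Matrix.mul_apply]
  exact tendsto_finsetSum _ fun i _ => tendsto_finsetSum _ fun j _ => (h4 i j).mul (hQ j i)

theorem continuousAt_relTrace {X : Type*} [TopologicalSpace X] {x₀ : X}
    {P Q : X → LinearMap.BilinForm ℝ (EuclideanSpace ℝ (Fin n))}
    (hs : ∀ v w, P x₀ v w = P x₀ w v) (hpos : ∀ v, v ≠ 0 → 0 < P x₀ v v)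
    (hP : ∀ v w, ContinuousAt (fun x => P x v w) x₀)
    (hQ : ∀ v w, ContinuousAt (fun x => Q x v w) x₀) :
    ContinuousAt (fun x => relTrace (P x) (Q x)) x₀ := by
  simp only [relTrace]
  refine continuousAt_trace_inv_mul (posDef_toMatrix hs hpos).det_pos.ne' ?_ ?_
  · intro i j
    simp only [LinearMap.BilinForm.toMatrix_apply]
    exact hP _ _
  · intro i j
    simp only [LinearMap.BilinForm.toMatrix_apply]
    exact hQ _ _

end RelativeTrace

section Forms

set_option maxSynthPendingDepth 3

variable {E : Type*} [NormedAddCommGroup E] [NormedSpace ℝ E]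

/-- A continuous bilinear form as a bilinear form. -/
noncomputable def bilinForm (B : E →L[ℝ] E →L[ℝ] ℝ) : LinearMap.BilinForm ℝ E :=
  LinearMap.mk₂ ℝ (fun v w => B v w) (by simp) (by simp) (by simp) (by simp)

/-- The second derivative of a function as a bilinear form. -/
noncomputable def secondDerivForm (f : E → ℝ) (y : E) : LinearMap.BilinForm ℝ E :=
  bilinForm (fderiv ℝ (fderiv ℝ f) y)

/-- The covariant Hessian as a bilinear form. -/
noncomputable def hessianForm (G : E → E →L[ℝ] E →L[ℝ] ℝ) (f : E → ℝ) (y w : E) :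
    LinearMap.BilinForm ℝ E :=
  LinearMap.mk₂ ℝ (metricHessian G f y w)
    (by intros; simp only [metricHessian, secondDeriv, metricChristoffel, map_add,
          _root_.add_apply]; ring)
    (by intros; simp only [metricHessian, secondDeriv, metricChristoffel, map_smul,
          _root_.smul_apply, smul_eq_mul]; ring)
    (by intros; simp only [metricHessian, secondDeriv, metricChristoffel, map_add,
          _root_.add_apply]; ring)
    (by intros; simp only [metricHessian, secondDeriv, metricChristoffel, map_smul,
          _root_.smul_apply, smul_eq_mul]; ring)

theorem metricHessian_symm {G : E → E →L[ℝ] E →L[ℝ] ℝ} {f : E → ℝ} {y : E}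
    (hG : DifferentiableAt ℝ G y) (hsymm : ∀ᶠ z in 𝓝 y, ∀ v w, G z v w = G z w v)
    (hf : ContDiffAt ℝ 2 f y) (w a b : E) :
    metricHessian G f y w a b = metricHessian G f y w b a := by
  rw [metricHessian, metricHessian, secondDeriv_symm hf, metricChristoffel_symm hG hsymm]

end Forms

/-- A positive definite bilinear form identifies a space with its dual space. -/
theorem isInvertible_of_pos {E : Type*} [NormedAddCommGroup E] [NormedSpace ℝ E]
    [FiniteDimensional ℝ E] {B : E →L[ℝ] E →L[ℝ] ℝ} (hB : ∀ v, v ≠ 0 → 0 < B v v) :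
    B.IsInvertible := by
  have hinj : Injective B := by
    rw [injective_iff_map_eq_zero]
    intro v hv
    by_contra h
    have := hB v h
    rw [hv] at this
    simp at this
  have hfin : Module.finrank ℝ E = Module.finrank ℝ (E →L[ℝ] ℝ) := by
    rw [← (LinearMap.toContinuousLinearMap : (E →ₗ[ℝ] ℝ) ≃ₗ[ℝ] (E →L[ℝ] ℝ)).finrank_eq]
    exact Subspace.dual_finrank_eq.symm
  exact ⟨(LinearEquiv.ofInjectiveOfFinrankEq (B : E →ₗ[ℝ] (E →L[ℝ] ℝ)) hinj
    hfin).toContinuousLinearEquiv, by ext; rfl⟩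

/-! ### Gradients, and the sign of the mean curvature -/

section Gradient

set_option maxSynthPendingDepth 3

variable {n : ℕ}
  {M : Type*} [TopologicalSpace M] [ChartedSpace (EuclideanSpace ℝ (Fin (n + 1))) M]
  [RiemannianBundle (fun p : M => TangentSpace (𝓡 (n + 1)) p)]

/-- The vector `w` is the gradient of `f` at `q`. -/
def IsGradientAt (f : M → ℝ) (q : M) (w : EuclideanSpace ℝ (Fin (n + 1))) : Prop :=
  ∀ v, tangentInner q v w = differential (n + 1) f q v

theorem eq_of_tangentInner_eq {q : M} {w w' : EuclideanSpace ℝ (Fin (n + 1))}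
    (h : ∀ v, tangentInner q v w = tangentInner q v w') : w = w' := by
  by_contra hne
  have h1 := tangentInner_self_pos q (sub_ne_zero.2 hne)
  rw [sub_eq_add_neg, ← neg_one_smul ℝ w', tangentInner_add_right, tangentInner_smul_right, h]
    at h1
  simp at h1

theorem IsGradientAt.unique {f : M → ℝ} {q : M} {w w' : EuclideanSpace ℝ (Fin (n + 1))}
    (h : IsGradientAt f q w) (h' : IsGradientAt f q w') : w = w' :=
  eq_of_tangentInner_eq fun v => (h v).trans (h' v).symm

theorem IsGradientAt.smul {f f' : M → ℝ} {q : M} {w : EuclideanSpace ℝ (Fin (n + 1))}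
    (h : IsGradientAt f q w) {c : ℝ}
    (hc : differential (n + 1) f' q = c • differential (n + 1) f q) :
    IsGradientAt f' q (c • w) := by
  intro v
  rw [tangentInner_smul_right, h, hc]
  rfl

theorem IsGradientAt.differential_pos {f : M → ℝ} {q : M} {w : EuclideanSpace ℝ (Fin (n + 1))}
    (h : IsGradientAt f q w) (hd : differential (n + 1) f q ≠ 0) :
    0 < differential (n + 1) f q w := by
  rw [← h]
  refine tangentInner_self_pos q fun h0 => hd (ContinuousLinearMap.ext fun v => ?_)
  rw [← h, h0, ← zero_smul ℝ (0 : EuclideanSpace ℝ (Fin (n + 1))), tangentInner_smul_right]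
  simp

theorem IsGradientAt.isNormal {S : Type*} [TopologicalSpace S]
    [ChartedSpace (EuclideanSpace ℝ (Fin n)) S] {φ : S → M} {x : S} {f : M → ℝ}
    {w : EuclideanSpace ℝ (Fin (n + 1))} (h : IsGradientAt f (φ x) w)
    (h0 : ∀ v, differential (n + 1) f (φ x) (pushforward n φ x v) = 0) :
    IsNormal (n := n) φ x w := by
  intro v
  exact (h (pushforward n φ x v)).trans (h0 v)

variable [IsManifold (𝓡 (n + 1)) ∞ M]

theorem isInvertible_metricForm {p : M} {y : EuclideanSpace ℝ (Fin (n + 1))}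
    (hy : y ∈ (extChartAt (𝓡 (n + 1)) p).target) : (metricForm p y).IsInvertible :=
  isInvertible_of_pos fun _ hv => metricForm_self_pos hy hv

/-- The gradient of `f` in the preferred chart around `p`. -/
noncomputable def coordGradient (p : M) (f : M → ℝ) (y : EuclideanSpace ℝ (Fin (n + 1))) :
    EuclideanSpace ℝ (Fin (n + 1)) :=
  (metricForm p y).inverse (fderiv ℝ (f ∘ (extChartAt (𝓡 (n + 1)) p).symm) y)

theorem metricForm_coordGradient {p : M} (f : M → ℝ) {y : EuclideanSpace ℝ (Fin (n + 1))}
    (hy : y ∈ (extChartAt (𝓡 (n + 1)) p).target) (v : EuclideanSpace ℝ (Fin (n + 1))) :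
    metricForm p y v (coordGradient p f y)
      = fderiv ℝ (f ∘ (extChartAt (𝓡 (n + 1)) p).symm) y v := by
  rw [metricForm_symm, coordGradient, (isInvertible_metricForm hy).self_apply_inverse]

theorem isGradientAt_symmDeriv {p q : M} {f : M → ℝ}
    (hq : q ∈ (extChartAt (𝓡 (n + 1)) p).source) (hf : ContMDiffAt (𝓡 (n + 1)) 𝓘(ℝ) ∞ f q) :
    IsGradientAt f q (symmDeriv p (extChartAt (𝓡 (n + 1)) p q)
      (coordGradient p f (extChartAt (𝓡 (n + 1)) p q))) := by
  have hy := (extChartAt (𝓡 (n + 1)) p).map_source hq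
  intro v
  obtain ⟨v, rfl⟩ := symmDeriv_surjective hy v
  rw [differential_symmDeriv hq hf, ← metricForm_coordGradient f hy, metricForm_apply,
    chartMetric_eq, (extChartAt (𝓡 (n + 1)) p).left_inv hq]

theorem exists_isGradientAt {q : M} {f : M → ℝ} (hf : ContMDiffAt (𝓡 (n + 1)) 𝓘(ℝ) ∞ f q) :
    ∃ w, IsGradientAt (n := n) f q w :=
  ⟨_, isGradientAt_symmDeriv (mem_extChartAt_source q) hf⟩

variable [IsContMDiffRiemannianBundle (𝓡 (n + 1)) ∞ (EuclideanSpace ℝ (Fin (n + 1)))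
    (fun p : M => TangentSpace (𝓡 (n + 1)) p)]

theorem continuousAt_coordGradient {p : M} {f : M → ℝ} {y : EuclideanSpace ℝ (Fin (n + 1))}
    (hy : y ∈ (extChartAt (𝓡 (n + 1)) p).target)
    (hf : ContDiffAt ℝ 2 (f ∘ (extChartAt (𝓡 (n + 1)) p).symm) y) :
    ContinuousAt (coordGradient p f) y := by
  have h1 : ContinuousAt (fun z => (metricForm p z).inverse) y :=
    ContinuousAt.comp (f := metricForm p)
      ((isInvertible_metricForm hy).contDiffAt_map_inverse (n := 0)).continuousAt
      (contDiffAt_metricForm hy).continuousAt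
  exact h1.clm_apply ((hf.fderiv_right (m := 1) (by norm_num)).continuousAt)

variable {S : Type*} [TopologicalSpace S] [ChartedSpace (EuclideanSpace ℝ (Fin n)) S]

omit [IsManifold (𝓡 (n + 1)) ∞ M] [IsContMDiffRiemannianBundle (𝓡 (n + 1)) ∞
  (EuclideanSpace ℝ (Fin (n + 1))) (fun p : M => TangentSpace (𝓡 (n + 1)) p)] in
theorem meanCurvature_eq_relTrace (φ : S → M) (x : S)
    (w : EuclideanSpace ℝ (Fin (n + 1))) (P Q : LinearMap.BilinForm ℝ (EuclideanSpace ℝ (Fin n)))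
    (hP : ∀ i j, firstFundamentalForm φ x i j
      = P (EuclideanSpace.single i 1) (EuclideanSpace.single j 1))
    (hQ : ∀ i j, secondFundamentalForm φ x w i j
      = Q (EuclideanSpace.single i 1) (EuclideanSpace.single j 1)) :
    meanCurvature φ x w = relTrace P Q := by
  have h1 : firstFundamentalForm φ x
      = LinearMap.BilinForm.toMatrix (EuclideanSpace.basisFun (Fin n) ℝ).toBasis P := by
    ext i j
    rw [hP, LinearMap.BilinForm.toMatrix_apply]
    simp
  have h2 : secondFundamentalForm φ x w
      = LinearMap.BilinForm.toMatrix (EuclideanSpace.basisFun (Fin n) ℝ).toBasis Q := by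
    ext i j
    rw [hQ, LinearMap.BilinForm.toMatrix_apply]
    simp
  exact congrArg₂ (fun A B : Matrix (Fin n) (Fin n) ℝ => (A⁻¹ * B).trace) h1 h2

variable [IsManifold (𝓡 n) ∞ S]

theorem meanCurvature_smul {φ : S → M} {x : S} (hφ : ContMDiffAt (𝓡 n) (𝓡 (n + 1)) ∞ φ x)
    (c : ℝ) (w : EuclideanSpace ℝ (Fin (n + 1))) :
    meanCurvature φ x (c • w) = c * @meanCurvature n M _ _ _ S _ _ φ x w := by
  have h : ∀ w : EuclideanSpace ℝ (Fin (n + 1)), ∀ i j, secondFundamentalForm φ x w i j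
      = coordSecondForm (metricForm (φ x)) (coordMap (φ x) φ x) (extChartAt (𝓡 n) x x) w
        (EuclideanSpace.single i 1) (EuclideanSpace.single j 1) := by
    intro w i j
    have := secondFundamentalForm_eq hφ (mem_extChartAt_source (φ x)) w i j
    rwa [symmDeriv_self] at this
  have h2 : secondFundamentalForm φ x (c • w) = c • @secondFundamentalForm n M _ _ _ S _ _ φ x w := by
    ext i j
    rw [Matrix.smul_apply, smul_eq_mul, h w]
    refine (h (c • w) i j).trans ?_
    simp only [coordSecondForm, metricChristoffel, map_smul, smul_eq_mul, _root_.smul_apply]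
    ring
  refine (congrArg (fun A : Matrix (Fin n) (Fin n) ℝ =>
    ((firstFundamentalForm φ x)⁻¹ * A).trace) h2).trans ?_
  rw [Matrix.mul_smul, Matrix.trace_smul]
  rfl

/-- The mean curvature in direction of the gradient of `f` is the trace of the second derivative of
`f ∘ φ`, minus the trace of the Hessian of `f` over the tangent space. -/
theorem meanCurvature_gradient {p : M} {φ : S → M} {x : S} {f : M → ℝ}
    (hφ : ContMDiffAt (𝓡 n) (𝓡 (n + 1)) ∞ φ x) (hp : φ x ∈ (extChartAt (𝓡 (n + 1)) p).source)
    (hf : ContMDiffAt (𝓡 (n + 1)) 𝓘(ℝ) ∞ f (φ x)) {w : EuclideanSpace ℝ (Fin (n + 1))}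
    (hw : IsGradientAt f (φ x) w) :
    meanCurvature φ x w = relTrace
      ((bilinForm (metricForm p (extChartAt (𝓡 (n + 1)) p (φ x)))).comp
        (fderiv ℝ (coordMap p φ x) (extChartAt (𝓡 n) x x)).toLinearMap
        (fderiv ℝ (coordMap p φ x) (extChartAt (𝓡 n) x x)).toLinearMap)
      (secondDerivForm ((f ∘ (extChartAt (𝓡 (n + 1)) p).symm) ∘ coordMap p φ x)
          (extChartAt (𝓡 n) x x)
        - (hessianForm (metricForm p) (f ∘ (extChartAt (𝓡 (n + 1)) p).symm)
          (extChartAt (𝓡 (n + 1)) p (φ x))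
          (coordGradient p f (extChartAt (𝓡 (n + 1)) p (φ x)))).comp
        (fderiv ℝ (coordMap p φ x) (extChartAt (𝓡 n) x x)).toLinearMap
        (fderiv ℝ (coordMap p φ x) (extChartAt (𝓡 n) x x)).toLinearMap) := by
  have hy := (extChartAt (𝓡 (n + 1)) p).map_source hp
  have hc := coordMap_apply (p := p) (φ := φ) (mem_extChartAt_source (I := 𝓡 n) x)
  refine meanCurvature_eq_relTrace φ x w _ _ (fun i j => ?_) (fun i j => ?_)
  · rw [firstFundamentalForm_eq hφ hp]
    rfl
  · rw [hw.unique (isGradientAt_symmDeriv hp hf), secondFundamentalForm_eq hφ hp,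
      coordSecondForm_gradient (f := f ∘ (extChartAt (𝓡 (n + 1)) p).symm)]
    · rw [hc]
      rfl
    · exact (contDiffAt_coordMap hφ (mem_extChartAt_source x) hp).of_le two_le_infty
    · rw [hc]
      exact (contDiffAt_comp_extChartAt_symm hp hf).of_le two_le_infty
    · intro v
      rw [hc]
      exact metricForm_coordGradient f hy v

end Gradient

/-! ### Comparison with small spheres -/

section Spheres

set_option maxSynthPendingDepth 3

theorem fderiv_norm_sub_sq {E : Type*} [NormedAddCommGroup E] [InnerProductSpace ℝ E] (y₀ : E) :
    fderiv ℝ (fun y : E => ‖y - y₀‖ ^ 2) = fun y => (2 : ℝ) • innerSL ℝ (y - y₀) := by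
  ext y a
  have h := ((hasFDerivAt_id (𝕜 := ℝ) y).sub_const y₀).norm_sq
  rw [show (fun y : E => ‖y - y₀‖ ^ 2) = fun y => ‖id y - y₀‖ ^ 2 from rfl, h.fderiv]
  simp

theorem secondDeriv_norm_sub_sq {E : Type*} [NormedAddCommGroup E] [InnerProductSpace ℝ E]
    (y₀ y a b : E) : secondDeriv (fun y : E => ‖y - y₀‖ ^ 2) y a b = 2 * inner ℝ a b := by
  have h : HasFDerivAt (fun y : E => (2 : ℝ) • innerSL ℝ (y - y₀)) ((2 : ℝ) • innerSL ℝ) y :=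
    ((innerSL ℝ : E →L[ℝ] E →L[ℝ] ℝ).hasFDerivAt.comp y
      ((hasFDerivAt_id (𝕜 := ℝ) y).sub_const y₀)).const_smul (2 : ℝ)
  rw [secondDeriv, fderiv_norm_sub_sq, h.fderiv]
  rfl

variable {n : ℕ}
  {M : Type*} [TopologicalSpace M] [ChartedSpace (EuclideanSpace ℝ (Fin (n + 1))) M]

/-- The square of the Euclidean distance to `p` in the preferred chart around `p`. -/
noncomputable def chartDistSq (p q : M) : ℝ :=
  ‖extChartAt (𝓡 (n + 1)) p q - extChartAt (𝓡 (n + 1)) p p‖ ^ 2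

variable [IsManifold (𝓡 (n + 1)) ∞ M]

theorem contMDiffAt_chartDistSq {p q : M} (hq : q ∈ (extChartAt (𝓡 (n + 1)) p).source) :
    ContMDiffAt (𝓡 (n + 1)) 𝓘(ℝ) ∞ (chartDistSq (n := n) p) q := by
  have h1 : ContMDiffAt (𝓡 (n + 1)) 𝓘(ℝ, EuclideanSpace ℝ (Fin (n + 1))) ∞
      (extChartAt (𝓡 (n + 1)) p) q := contMDiffAt_extChartAt' (by simpa using hq)
  have h2 : ContDiff ℝ ∞ (fun y : EuclideanSpace ℝ (Fin (n + 1)) =>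
      ‖y - extChartAt (𝓡 (n + 1)) p p‖ ^ 2) := (contDiff_id.sub contDiff_const).norm_sq ℝ
  exact h2.contMDiff.contMDiffAt.comp q h1

omit [IsManifold (𝓡 (n + 1)) ∞ M] in
theorem chartDistSq_comp_eventuallyEq {p : M} {y : EuclideanSpace ℝ (Fin (n + 1))}
    (hy : y ∈ (extChartAt (𝓡 (n + 1)) p).target) :
    chartDistSq (n := n) p ∘ (extChartAt (𝓡 (n + 1)) p).symm =ᶠ[𝓝 y]
      fun y => ‖y - extChartAt (𝓡 (n + 1)) p p‖ ^ 2 := by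
  filter_upwards [(isOpen_extChartAt_target p).mem_nhds hy] with z hz
  rw [Function.comp_apply, chartDistSq, (extChartAt (𝓡 (n + 1)) p).right_inv hz]

variable [RiemannianBundle (fun p : M => TangentSpace (𝓡 (n + 1)) p)]
  [IsContMDiffRiemannianBundle (𝓡 (n + 1)) ∞ (EuclideanSpace ℝ (Fin (n + 1)))
    (fun p : M => TangentSpace (𝓡 (n + 1)) p)]

/-- Small coordinate spheres are strictly convex: at the centre of the chart, the gradient of the
squared distance vanishes, so that nearby its Hessian is close to its second derivative `2 ⟨a, b⟩`.
-/
theorem eventually_metricHessian_chartDistSq_pos (p : M) :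
    ∀ᶠ y in 𝓝 (extChartAt (𝓡 (n + 1)) p p), ∀ a, a ≠ 0 →
      0 < metricHessian (metricForm p) (chartDistSq (n := n) p ∘ (extChartAt (𝓡 (n + 1)) p).symm) y
        (coordGradient p (chartDistSq (n := n) p) y) a a := by
  set y₀ := extChartAt (𝓡 (n + 1)) p p with hy₀
  have hy : y₀ ∈ (extChartAt (𝓡 (n + 1)) p).target := mem_extChartAt_target p
  have hgrad : coordGradient p (chartDistSq (n := n) p) y₀ = 0 := by
    rw [coordGradient, (chartDistSq_comp_eventuallyEq hy).fderiv_eq, fderiv_norm_sub_sq]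
    simp only [← hy₀, sub_self, map_zero, smul_zero]
  have hc1 : ContinuousAt (fun y => ‖fderiv ℝ (metricForm p) y‖) y₀ :=
    (((contDiffAt_metricForm hy).of_le two_le_infty).fderiv_right
      (m := 1) (by norm_num)).continuousAt.norm
  have hc2 : ContinuousAt (fun y => ‖coordGradient p (chartDistSq (n := n) p) y‖) y₀ :=
    (continuousAt_coordGradient hy ((contDiffAt_comp_extChartAt_symm (mem_extChartAt_source p)
      (contMDiffAt_chartDistSq (mem_extChartAt_source p))).of_le two_le_infty)).norm
  have hc3 := (hc1.mul hc2).tendsto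
  simp only [Pi.mul_apply, hgrad, norm_zero, mul_zero] at hc3
  filter_upwards [hc3.eventually (gt_mem_nhds one_pos),
    (isOpen_extChartAt_target p).mem_nhds hy] with y h1 h2 a ha
  have h3 : secondDeriv (chartDistSq (n := n) p ∘ (extChartAt (𝓡 (n + 1)) p).symm) y a a
      = 2 * ‖a‖ ^ 2 := by
    rw [secondDeriv, (chartDistSq_comp_eventuallyEq h2).fderiv.fderiv_eq, ← secondDeriv,
      secondDeriv_norm_sub_sq, real_inner_self_eq_norm_sq]
  have h4 := (abs_le.1 (abs_metricChristoffel_le (metricForm p) y a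
    (coordGradient p (chartDistSq (n := n) p) y))).2
  have h5 : 0 < ‖a‖ ^ 2 := by positivity
  have h6 := mul_lt_mul_of_pos_right h1 h5
  rw [Pi.mul_apply] at h6
  rw [metricHessian, h3]
  linarith

variable {S : Type*} [TopologicalSpace S] [ChartedSpace (EuclideanSpace ℝ (Fin n)) S]
  [IsManifold (𝓡 n) ∞ S]

omit [RiemannianBundle (fun p : M => TangentSpace (𝓡 (n + 1)) p)]
  [IsContMDiffRiemannianBundle (𝓡 (n + 1)) ∞ (EuclideanSpace ℝ (Fin (n + 1)))
    (fun p : M => TangentSpace (𝓡 (n + 1)) p)] in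
theorem injective_fderiv_coordMap {p : M} {φ : S → M} {x : S}
    (hφ : ContMDiffAt (𝓡 n) (𝓡 (n + 1)) ∞ φ x) (hi : Injective (pushforward n φ x))
    (hp : φ x ∈ (extChartAt (𝓡 (n + 1)) p).source) :
    Injective (fderiv ℝ (coordMap p φ x) (extChartAt (𝓡 n) x x)) := by
  intro a b hab
  refine hi ?_
  rw [← symmDeriv_fderiv_coordMap hφ hp, ← symmDeriv_fderiv_coordMap hφ hp, hab]

/-- A hypersurface which touches a small sphere from the inside is curved towards the inside, as the
sphere is. -/
theorem meanCurvature_neg_of_isLocalMax (hn : 0 < n) {p : M} {φ : S → M} {x : S} {f : M → ℝ}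
    (hφ : ContMDiffAt (𝓡 n) (𝓡 (n + 1)) ∞ φ x) (hi : Injective (pushforward n φ x))
    (hp : φ x ∈ (extChartAt (𝓡 (n + 1)) p).source)
    (hf : ContMDiffAt (𝓡 (n + 1)) 𝓘(ℝ) ∞ f (φ x)) (hmax : IsLocalMax (f ∘ φ) x)
    (hpos : ∀ a, a ≠ 0 → 0 < metricHessian (metricForm p) (f ∘ (extChartAt (𝓡 (n + 1)) p).symm)
        (extChartAt (𝓡 (n + 1)) p (φ x))
        (coordGradient p f (extChartAt (𝓡 (n + 1)) p (φ x))) a a)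
    {w : EuclideanSpace ℝ (Fin (n + 1))} (hw : IsGradientAt f (φ x) w) :
    meanCurvature φ x w < 0 := by
  have hy := (extChartAt (𝓡 (n + 1)) p).map_source hp
  have hc := coordMap_apply (p := p) (φ := φ) (mem_extChartAt_source (I := 𝓡 n) x)
  have hf' := (contDiffAt_comp_extChartAt_symm hp hf).of_le two_le_infty
  have hg : ContDiffAt ℝ 2 ((f ∘ (extChartAt (𝓡 (n + 1)) p).symm) ∘ coordMap p φ x)
      (extChartAt (𝓡 n) x x) := by
    refine ContDiffAt.comp _ (by rw [hc]; exact hf') ?_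
    exact (contDiffAt_coordMap hφ (mem_extChartAt_source x) hp).of_le two_le_infty
  have hinj := injective_fderiv_coordMap hφ hi hp
  have hne : ∀ v, v ≠ 0 → fderiv ℝ (coordMap p φ x) (extChartAt (𝓡 n) x x) v ≠ 0 :=
    fun v hv h => hv (hinj (h.trans (map_zero _).symm))
  rw [meanCurvature_gradient hφ hp hf hw, ← neg_pos, ← relTrace_neg]
  refine relTrace_pos hn ?_ ?_ ?_ ?_
  · intro v w
    exact metricForm_symm _ _ _ _
  · intro v hv
    exact metricForm_self_pos hy (hne v hv)
  · intro v w
    refine congrArg Neg.neg (congrArg₂ HSub.hSub (secondDeriv_symm hg v w) ?_)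
    exact metricHessian_symm ((contDiffAt_metricForm hy).differentiableAt (by simp))
      (Filter.Eventually.of_forall fun z v w => metricForm_symm p z v w) hf' _ _ _
  · intro v hv
    have h1 := secondDeriv_nonpos_of_isLocalMax hg (isLocalMax_comp_coordMap hφ hp hmax) v
    have h2 := hpos _ (hne v hv)
    exact neg_pos.2 (sub_neg.2 (h1.trans_lt h2))

end Spheres

section Sign

set_option maxSynthPendingDepth 3

variable {n : ℕ}
  {M : Type*} [TopologicalSpace M] [ChartedSpace (EuclideanSpace ℝ (Fin (n + 1))) M]
  [IsManifold (𝓡 (n + 1)) ∞ M]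
  {S : Type*} [TopologicalSpace S] [ChartedSpace (EuclideanSpace ℝ (Fin n)) S]
  [IsManifold (𝓡 n) ∞ S]

theorem fderiv_coordMap_transition {p : M} {φ : S → M} {x₀ x : S}
    (hφ : ContMDiffAt (𝓡 n) (𝓡 (n + 1)) ∞ φ x) (hx : x ∈ (extChartAt (𝓡 n) x₀).source)
    (hp : φ x ∈ (extChartAt (𝓡 (n + 1)) p).source) :
    fderiv ℝ (coordMap p φ x) (extChartAt (𝓡 n) x x)
      = (fderiv ℝ (coordMap p φ x₀) (extChartAt (𝓡 n) x₀ x)).comp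
        (fderiv ℝ (extChartAt (𝓡 n) x₀ ∘ (extChartAt (𝓡 n) x).symm) (extChartAt (𝓡 n) x x)) := by
  have h0 : (extChartAt (𝓡 n) x).symm (extChartAt (𝓡 n) x x) = x := extChartAt_to_inv x
  have h1 : coordMap p φ x =ᶠ[𝓝 (extChartAt (𝓡 n) x x)]
      coordMap p φ x₀ ∘ (extChartAt (𝓡 n) x₀ ∘ (extChartAt (𝓡 n) x).symm) := by
    have h2 : ∀ᶠ z in 𝓝 (extChartAt (𝓡 n) x x),
        (extChartAt (𝓡 n) x).symm z ∈ (extChartAt (𝓡 n) x₀).source := by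
      refine (continuousAt_extChartAt_symm x).eventually ?_
      rw [h0]
      exact (isOpen_extChartAt_source x₀).mem_nhds hx
    filter_upwards [h2] with z hz
    simp only [coordMap, Function.comp_apply, (extChartAt (𝓡 n) x₀).left_inv hz]
  have h3 : DifferentiableAt ℝ (extChartAt (𝓡 n) x₀ ∘ (extChartAt (𝓡 n) x).symm)
      (extChartAt (𝓡 n) x x) := by
    have : ContDiffAt ℝ ∞ (extChartAt (𝓡 n) x₀ ∘ (extChartAt (𝓡 n) x).symm)
        (extChartAt (𝓡 n) x x) :=
      contDiffAt_comp_extChartAt_symm (m := ⊤) (mem_extChartAt_source x)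
        (contMDiffAt_extChartAt' (by simpa using hx))
    exact this.differentiableAt (by simp)
  have h4 : (extChartAt (𝓡 n) x₀ ∘ (extChartAt (𝓡 n) x).symm) (extChartAt (𝓡 n) x x)
      = extChartAt (𝓡 n) x₀ x := by
    rw [Function.comp_apply, h0]
  rw [h1.fderiv_eq, fderiv_comp _ (by
    rw [h4]; exact (contDiffAt_coordMap hφ hx hp).differentiableAt (by simp)) h3, h4]

variable [RiemannianBundle (fun p : M => TangentSpace (𝓡 (n + 1)) p)]
  [IsContMDiffRiemannianBundle (𝓡 (n + 1)) ∞ (EuclideanSpace ℝ (Fin (n + 1)))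
    (fun p : M => TangentSpace (𝓡 (n + 1)) p)]

/-- The mean curvature of a hypersurface in `{f = 0}` in direction of the gradient of `f`, where the
chart around a fixed point `x₀` of the parameter manifold is used for all points `x` near `x₀`. -/
theorem meanCurvature_gradient_of_eventually_zero {p : M} {φ : S → M} {x₀ x : S} {f : M → ℝ}
    (hφ : ContMDiffAt (𝓡 n) (𝓡 (n + 1)) ∞ φ x) (hi : Injective (pushforward n φ x))
    (hx : x ∈ (extChartAt (𝓡 n) x₀).source)
    (hp : φ x ∈ (extChartAt (𝓡 (n + 1)) p).source)
    (hf : ContMDiffAt (𝓡 (n + 1)) 𝓘(ℝ) ∞ f (φ x)) (h0 : ∀ᶠ x' in 𝓝 x, f (φ x') = 0)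
    {w : EuclideanSpace ℝ (Fin (n + 1))} (hw : IsGradientAt f (φ x) w) :
    meanCurvature φ x w = relTrace
      ((bilinForm (metricForm p (extChartAt (𝓡 (n + 1)) p (φ x)))).comp
        (fderiv ℝ (coordMap p φ x₀) (extChartAt (𝓡 n) x₀ x)).toLinearMap
        (fderiv ℝ (coordMap p φ x₀) (extChartAt (𝓡 n) x₀ x)).toLinearMap)
      (-(hessianForm (metricForm p) (f ∘ (extChartAt (𝓡 (n + 1)) p).symm)
          (extChartAt (𝓡 (n + 1)) p (φ x))
          (coordGradient p f (extChartAt (𝓡 (n + 1)) p (φ x)))).comp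
        (fderiv ℝ (coordMap p φ x₀) (extChartAt (𝓡 n) x₀ x)).toLinearMap
        (fderiv ℝ (coordMap p φ x₀) (extChartAt (𝓡 n) x₀ x)).toLinearMap) := by
  set T := fderiv ℝ (extChartAt (𝓡 n) x₀ ∘ (extChartAt (𝓡 n) x).symm) (extChartAt (𝓡 n) x x)
  have hT := fderiv_coordMap_transition hφ hx hp
  have hTi : Injective T := by
    have := injective_fderiv_coordMap hφ hi hp
    rw [hT] at this
    exact Injective.of_comp this
  have hK : secondDerivForm ((f ∘ (extChartAt (𝓡 (n + 1)) p).symm) ∘ coordMap p φ x)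
      (extChartAt (𝓡 n) x x) = 0 := by
    have h1 : (f ∘ (extChartAt (𝓡 (n + 1)) p).symm) ∘ coordMap p φ x
        =ᶠ[𝓝 (extChartAt (𝓡 n) x x)] fun _ => 0 := by
      have h2 : Filter.Tendsto (extChartAt (𝓡 n) x).symm (𝓝 (extChartAt (𝓡 n) x x)) (𝓝 x) := by
        have := (continuousAt_extChartAt_symm (I := 𝓡 n) x).tendsto
        rwa [extChartAt_to_inv] at this
      exact (comp_coordMap_eventuallyEq hφ hp).trans (h2.eventually h0)
    ext a b
    change fderiv ℝ (fderiv ℝ _) _ a b = 0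
    rw [h1.fderiv.fderiv_eq]
    simp
  rw [meanCurvature_gradient hφ hp hf hw, hK, zero_sub, hT, relTrace_neg, relTrace_neg,
    ContinuousLinearMap.toLinearMap_comp, relTrace_comp_comp _ _ _ hTi]

/-- The mean curvature of a hypersurface in `{f = 0}` in direction of the gradient of `f` is
continuous. The definition of the mean curvature at `x` uses the charts around `x` and `φ x`, and
these vary with `x`. -/
theorem continuousAt_meanCurvature_gradient {φ : S → M} {x₀ : S} {f : M → ℝ}
    (hφ : ∀ᶠ x in 𝓝 x₀, ContMDiffAt (𝓡 n) (𝓡 (n + 1)) ∞ φ x ∧ Injective (pushforward n φ x))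
    (hf : ∀ᶠ x in 𝓝 x₀, ContMDiffAt (𝓡 (n + 1)) 𝓘(ℝ) ∞ f (φ x))
    (h0 : ∀ᶠ x in 𝓝 x₀, f (φ x) = 0) {w : S → EuclideanSpace ℝ (Fin (n + 1))}
    (hw : ∀ᶠ x in 𝓝 x₀, IsGradientAt f (φ x) (w x)) :
    ContinuousAt (fun x => meanCurvature φ x (w x)) x₀ := by
  set p := φ x₀ with hp
  have hφ₀ := hφ.self_of_nhds.1
  have hy : extChartAt (𝓡 (n + 1)) p p ∈ (extChartAt (𝓡 (n + 1)) p).target :=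
    mem_extChartAt_target p
  have hev : ∀ᶠ x in 𝓝 x₀, meanCurvature φ x (w x) = relTrace
      ((bilinForm (metricForm p (extChartAt (𝓡 (n + 1)) p (φ x)))).comp
        (fderiv ℝ (coordMap p φ x₀) (extChartAt (𝓡 n) x₀ x)).toLinearMap
        (fderiv ℝ (coordMap p φ x₀) (extChartAt (𝓡 n) x₀ x)).toLinearMap)
      (-(hessianForm (metricForm p) (f ∘ (extChartAt (𝓡 (n + 1)) p).symm)
          (extChartAt (𝓡 (n + 1)) p (φ x))
          (coordGradient p f (extChartAt (𝓡 (n + 1)) p (φ x)))).comp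
        (fderiv ℝ (coordMap p φ x₀) (extChartAt (𝓡 n) x₀ x)).toLinearMap
        (fderiv ℝ (coordMap p φ x₀) (extChartAt (𝓡 n) x₀ x)).toLinearMap) := by
    filter_upwards [hφ, hf, eventually_eventually_nhds.2 h0, hw,
      (isOpen_extChartAt_source (I := 𝓡 n) x₀).mem_nhds (mem_extChartAt_source x₀),
      hφ₀.continuousAt.eventually ((isOpen_extChartAt_source (I := 𝓡 (n + 1)) p).mem_nhds
        (mem_extChartAt_source p))] with x h1 h2 h3 h4 h5 h6
    exact meanCurvature_gradient_of_eventually_zero h1.1 h1.2 h5 h6 h2 h3 h4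
  refine ContinuousAt.congr ?_ (Filter.EventuallyEq.symm hev)
  have hcy : ContinuousAt (fun x => extChartAt (𝓡 (n + 1)) p (φ x)) x₀ :=
    ContinuousAt.comp (g := extChartAt (𝓡 (n + 1)) p) (continuousAt_extChartAt p) hφ₀.continuousAt
  have hcx : ContinuousAt (extChartAt (𝓡 n) x₀) x₀ := continuousAt_extChartAt x₀
  have hcD : ContinuousAt (fun x => fderiv ℝ (coordMap p φ x₀) (extChartAt (𝓡 n) x₀ x)) x₀ :=
    ContinuousAt.comp (g := fderiv ℝ (coordMap p φ x₀))
      (((contDiffAt_coordMap hφ₀ (mem_extChartAt_source x₀) (mem_extChartAt_source p)).of_le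
        two_le_infty).fderiv_right (m := 1) (by norm_num)).continuousAt hcx
  have hcG : ContinuousAt (fun x => metricForm p (extChartAt (𝓡 (n + 1)) p (φ x))) x₀ :=
    ContinuousAt.comp (g := metricForm p) (contDiffAt_metricForm hy).continuousAt hcy
  have hcG' : ContinuousAt (fun x => fderiv ℝ (metricForm p) (extChartAt (𝓡 (n + 1)) p (φ x))) x₀ :=
    ContinuousAt.comp (g := fderiv ℝ (metricForm p))
      (((contDiffAt_metricForm hy).of_le two_le_infty).fderiv_right
        (m := 1) (by norm_num)).continuousAt hcy
  have hf' : ContDiffAt ℝ ∞ (f ∘ (extChartAt (𝓡 (n + 1)) p).symm) (extChartAt (𝓡 (n + 1)) p p) :=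
    contDiffAt_comp_extChartAt_symm (m := ⊤) (mem_extChartAt_source p) hf.self_of_nhds
  have hcw : ContinuousAt (fun x => coordGradient p f (extChartAt (𝓡 (n + 1)) p (φ x))) x₀ :=
    ContinuousAt.comp (g := coordGradient p f)
      (continuousAt_coordGradient hy (hf'.of_le two_le_infty)) hcy
  have hcf : ContinuousAt (fun x => fderiv ℝ (fderiv ℝ (f ∘ (extChartAt (𝓡 (n + 1)) p).symm))
      (extChartAt (𝓡 (n + 1)) p (φ x))) x₀ :=
    ContinuousAt.comp (g := fderiv ℝ (fderiv ℝ (f ∘ (extChartAt (𝓡 (n + 1)) p).symm)))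
      ((hf'.fderiv_right (m := ∞) (by simp)).fderiv_right (m := ∞) (by simp)).continuousAt hcy
  refine continuousAt_relTrace ?_ ?_ ?_ ?_
  · intro v w
    exact metricForm_symm _ _ _ _
  · intro v hv
    refine metricForm_self_pos hy fun h => hv ?_
    exact injective_fderiv_coordMap hφ₀ hφ.self_of_nhds.2 (mem_extChartAt_source p)
      (h.trans (map_zero _).symm)
  · intro v w
    exact (hcG.clm_apply (hcD.clm_apply continuousAt_const)).clm_apply
      (hcD.clm_apply continuousAt_const)
  · intro v w
    have hv := hcD.clm_apply (continuousAt_const (y := v))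
    have hw := hcD.clm_apply (continuousAt_const (y := w))
    have h1 := (((hcG'.clm_apply hv).clm_apply hw).clm_apply hcw).add
      (((hcG'.clm_apply hw).clm_apply hv).clm_apply hcw)
    have h2 := (h1.sub (((hcG'.clm_apply hcw).clm_apply hv).clm_apply hw)).div_const (2 : ℝ)
    exact (((hcf.clm_apply hv).clm_apply hw).sub h2).neg

end Sign

/-! ### Sheets oriented by the mean curvature -/

section Sheets

variable {n : ℕ}
  {M : Type*} [TopologicalSpace M] [ChartedSpace (EuclideanSpace ℝ (Fin (n + 1))) M]
  [RiemannianBundle (fun p : M => TangentSpace (𝓡 (n + 1)) p)]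
  {S : Type*} [TopologicalSpace S] [ChartedSpace (EuclideanSpace ℝ (Fin n)) S]

/-- A decomposition of an almost embedded hypersurface into sheets over an open set `W`, as in
`IsAlmostEmbedding`, in which the defining functions `f i` of the sheets are chosen such that the
mean curvature vector points to the side `{f i > 0}`. -/
structure OrientedSheets (φ : S → M) where
  /-- The open set over which the hypersurface is decomposed. -/
  W : Set M
  /-- The number of sheets. -/
  l : ℕ
  /-- The sheets, as subsets of the parameter manifold. -/
  U : Fin l → Set S
  /-- The defining functions of the sheets. -/
  f : Fin l → M → ℝ
  isOpen_W : IsOpen W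
  isOpen_U : ∀ i, IsOpen (U i)
  isPreconnected_U : ∀ i, IsPreconnected (U i)
  disjoint_U : Pairwise (fun i j => Disjoint (U i) (U j))
  iUnion_U : (⋃ i, U i) = φ ⁻¹' W
  isEmbedding : ∀ i, Topology.IsEmbedding ((U i).domRestrict φ)
  contMDiffAt : ∀ i, ∀ q ∈ W, ContMDiffAt (𝓡 (n + 1)) 𝓘(ℝ) ∞ (f i) q
  differential_ne_zero : ∀ i, ∀ q ∈ W, f i q = 0 → differential (n + 1) (f i) q ≠ 0
  image_U : ∀ i, φ '' U i = {q ∈ W | f i q = 0}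
  one_sided : ∀ i j, j ≠ i → (∀ q ∈ φ '' U j, 0 ≤ f i q) ∨ (∀ q ∈ φ '' U j, f i q ≤ 0)
  meanCurvature_pos : ∀ i, ∀ x ∈ U i, ∀ w : EuclideanSpace ℝ (Fin (n + 1)),
    IsGradientAt (f i) (φ x) w → 0 < meanCurvature φ x w

namespace OrientedSheets

variable {φ : S → M} (T : OrientedSheets (n := n) φ)

theorem mem_W {i : Fin T.l} {x : S} (hx : x ∈ T.U i) : φ x ∈ T.W := by
  have : x ∈ ⋃ i, T.U i := mem_iUnion.2 ⟨i, hx⟩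
  rwa [T.iUnion_U] at this

theorem f_apply {i : Fin T.l} {x : S} (hx : x ∈ T.U i) : T.f i (φ x) = 0 := by
  have : φ x ∈ φ '' T.U i := mem_image_of_mem φ hx
  rw [T.image_U] at this
  exact this.2

theorem exists_mem_U {x : S} (hx : φ x ∈ T.W) : ∃ i, x ∈ T.U i := by
  have : x ∈ φ ⁻¹' T.W := hx
  rwa [← T.iUnion_U, mem_iUnion] at this

theorem exists_of_f_eq_zero {i : Fin T.l} {q : M} (hq : q ∈ T.W) (h : T.f i q = 0) :
    ∃ x ∈ T.U i, φ x = q := by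
  have : q ∈ φ '' T.U i := by rw [T.image_U]; exact ⟨hq, h⟩
  exact this

theorem eq_of_mem {i j : Fin T.l} {x : S} (hi : x ∈ T.U i) (hj : x ∈ T.U j) : i = j := by
  by_contra h
  exact (T.disjoint_U h).notMem_of_mem_left hi hj

theorem injOn (i : Fin T.l) : InjOn φ (T.U i) := by
  intro x hx y hy h
  have := (T.isEmbedding i).injective (a₁ := ⟨x, hx⟩) (a₂ := ⟨y, hy⟩) h
  exact congrArg Subtype.val this

/-- A neighbourhood of a point of a sheet determines the sheet in the ambient space locally. -/
theorem eventually_exists_of_f_eq_zero {i : Fin T.l} {x : S} (hx : x ∈ T.U i) {V : Set S}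
    (hV : V ∈ 𝓝 x) : ∀ᶠ q in 𝓝 (φ x), T.f i q = 0 → ∃ x' ∈ V, φ x' = q := by
  have h1 : (Subtype.val ⁻¹' V : Set (T.U i)) ∈ 𝓝 (⟨x, hx⟩ : T.U i) :=
    continuous_subtype_val.continuousAt.preimage_mem_nhds hV
  rw [(T.isEmbedding i).isInducing.nhds_eq_comap, Filter.mem_comap] at h1
  obtain ⟨N, hN, hNV⟩ := h1
  filter_upwards [hN, T.isOpen_W.mem_nhds (T.mem_W hx)] with q hq hqW h0
  obtain ⟨x', hx', rfl⟩ := T.exists_of_f_eq_zero hqW h0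
  exact ⟨x', hNV (show (⟨x', hx'⟩ : T.U i) ∈ _ from hq), rfl⟩

theorem eventually_f_eq_zero_iff (T' : OrientedSheets (n := n) φ) {i : Fin T.l} {i' : Fin T'.l}
    {x : S} (hx : x ∈ T.U i) (hx' : x ∈ T'.U i') :
    ∀ᶠ q in 𝓝 (φ x), T.f i q = 0 ↔ T'.f i' q = 0 := by
  filter_upwards [T.eventually_exists_of_f_eq_zero hx ((T'.isOpen_U i').mem_nhds hx'),
    T'.eventually_exists_of_f_eq_zero hx' ((T.isOpen_U i).mem_nhds hx)] with q h1 h2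
  constructor
  · intro h
    obtain ⟨x', h3, rfl⟩ := h1 h
    exact T'.f_apply h3
  · intro h
    obtain ⟨x', h3, rfl⟩ := h2 h
    exact T.f_apply h3

end OrientedSheets

variable [IsManifold (𝓡 (n + 1)) ∞ M] [IsManifold (𝓡 n) ∞ S]

omit [RiemannianBundle (fun p : M => TangentSpace (𝓡 (n + 1)) p)] in
theorem differential_pushforward_eq_zero_of_eventually {φ : S → M} {x : S} {f : M → ℝ}
    (hφ : ContMDiffAt (𝓡 n) (𝓡 (n + 1)) ∞ φ x)
    (hf : ContMDiffAt (𝓡 (n + 1)) 𝓘(ℝ) ∞ f (φ x)) (h0 : ∀ᶠ x' in 𝓝 x, f (φ x') = 0)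
    (a : EuclideanSpace ℝ (Fin n)) :
    differential (n + 1) f (φ x) (pushforward n φ x a) = 0 := by
  refine differential_pushforward_eq_zero hφ hf ?_ a
  filter_upwards [h0] with z hz
  rw [Function.comp_apply, Function.comp_apply, hz, h0.self_of_nhds]

omit [RiemannianBundle (fun p : M => TangentSpace (𝓡 (n + 1)) p)] [IsManifold (𝓡 (n + 1)) ∞ M]
  [IsManifold (𝓡 n) ∞ S] in
/-- A linear form which vanishes on the tangent space of a hypersurface in `{f = 0}` is a multiple
of the differential of `f`. -/
theorem exists_eq_smul_differential {φ : S → M} {x : S} {f : M → ℝ}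
    (hi : Injective (pushforward n φ x))
    (h0 : ∀ a, differential (n + 1) f (φ x) (pushforward n φ x a) = 0)
    (hd : differential (n + 1) f (φ x) ≠ 0) {ℓ : EuclideanSpace ℝ (Fin (n + 1)) →L[ℝ] ℝ}
    (hℓ : ∀ a, ℓ (pushforward n φ x a) = 0) :
    ∃ c : ℝ, ℓ = c • differential (n + 1) f (φ x) := by
  obtain ⟨c, hc⟩ := exists_eq_smul_of_comp_eq_zero (by simp)
    (T := (pushforward n φ x).toLinearMap) (ℓ := (differential (n + 1) f (φ x)).toLinearMap)
    (ℓ' := ℓ.toLinearMap) hi (fun h => hd (ContinuousLinearMap.coe_injective h)) h0 hℓ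
  exact ⟨c, ContinuousLinearMap.coe_injective hc⟩

variable [IsContMDiffRiemannianBundle (𝓡 (n + 1)) ∞ (EuclideanSpace ℝ (Fin (n + 1)))
    (fun p : M => TangentSpace (𝓡 (n + 1)) p)]

/-- Two oriented defining functions of a hypersurface have the same positive side. -/
theorem OrientedSheets.eventually_pos_iff {φ : S → M} (T T' : OrientedSheets (n := n) φ)
    (hφ : ContMDiff (𝓡 n) (𝓡 (n + 1)) ∞ φ) (hi : ∀ x, Injective (pushforward n φ x))
    {i : Fin T.l} {i' : Fin T'.l} {x : S} (hx : x ∈ T.U i) (hx' : x ∈ T'.U i') :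
    ∀ᶠ q in 𝓝 (φ x), 0 < T.f i q ↔ 0 < T'.f i' q := by
  have hf := T.contMDiffAt i _ (T.mem_W hx)
  have hf' := T'.contMDiffAt i' _ (T'.mem_W hx')
  have hd := T.differential_ne_zero i _ (T.mem_W hx) (T.f_apply hx)
  have hd' := T'.differential_ne_zero i' _ (T'.mem_W hx') (T'.f_apply hx')
  have h0 : ∀ a, differential (n + 1) (T.f i) (φ x) (pushforward n φ x a) = 0 :=
    differential_pushforward_eq_zero_of_eventually (hφ x) hf (by
      filter_upwards [(T.isOpen_U i).mem_nhds hx] with z hz using T.f_apply hz)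
  have h0' : ∀ a, differential (n + 1) (T'.f i') (φ x) (pushforward n φ x a) = 0 :=
    differential_pushforward_eq_zero_of_eventually (hφ x) hf' (by
      filter_upwards [(T'.isOpen_U i').mem_nhds hx'] with z hz using T'.f_apply hz)
  obtain ⟨c, hc⟩ := exists_eq_smul_differential (hi x) h0 hd h0'
  obtain ⟨w, hw⟩ := exists_isGradientAt hf
  have h1 := T.meanCurvature_pos i x hx w hw
  have h2 := T'.meanCurvature_pos i' x hx' (c • w) (hw.smul hc)
  rw [meanCurvature_smul (hφ x)] at h2
  exact eventually_pos_iff_pos (hf.of_le (by simp)) (hf'.of_le (by simp)) (T.f_apply hx)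
    (T'.f_apply hx') hd (pos_of_mul_pos_left h2 h1.le) hc
    (T'.eventually_f_eq_zero_iff T hx' hx)

/-- The normal space is one-dimensional, so that the mean curvature does not vanish in any normal
direction if it does not vanish in one of them. -/
theorem meanCurvature_gradient_ne_zero {φ : S → M} {x : S} {f : M → ℝ}
    (hφ : ContMDiffAt (𝓡 n) (𝓡 (n + 1)) ∞ φ x) (hi : Injective (pushforward n φ x))
    (h0 : ∀ a, differential (n + 1) f (φ x) (pushforward n φ x a) = 0)
    (hd : differential (n + 1) f (φ x) ≠ 0)
    (hH : ∃ w, IsNormal (n := n) φ x w ∧ meanCurvature φ x w ≠ 0)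
    {w : EuclideanSpace ℝ (Fin (n + 1))} (hw : IsGradientAt f (φ x) w) :
    meanCurvature φ x w ≠ 0 := by
  obtain ⟨w', hn, hne⟩ := hH
  let ℓ : EuclideanSpace ℝ (Fin (n + 1)) →L[ℝ] ℝ := LinearMap.toContinuousLinearMap
    { toFun := fun v => tangentInner (φ x) v w'
      map_add' := fun v v' => tangentInner_add_left _ _ _ _
      map_smul' := fun c v => tangentInner_smul_left _ _ _ _ }
  obtain ⟨c, hc⟩ := exists_eq_smul_differential hi h0 hd (ℓ := ℓ) (fun a => hn a)
  have h1 : w' = c • w := eq_of_tangentInner_eq (q := φ x) fun v => by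
    rw [tangentInner_smul_right, hw v]
    exact DFunLike.congr_fun hc v
  intro h
  refine hne ?_
  rw [h1]
  refine (meanCurvature_smul hφ c w).trans ?_
  rw [h, mul_zero]

/-- The mean curvature vector points to the same side of a sheet at all of its points. -/
theorem meanCurvature_gradient_pos_or_neg {φ : S → M} {U : Set S} {f : M → ℝ}
    (hφ : ContMDiff (𝓡 n) (𝓡 (n + 1)) ∞ φ) (hi : ∀ x, Injective (pushforward n φ x))
    (hH : ∀ x, ∃ w, IsNormal (n := n) φ x w ∧ meanCurvature φ x w ≠ 0)
    (hU : IsOpen U) (hU' : IsPreconnected U)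
    (hf : ∀ x ∈ U, ContMDiffAt (𝓡 (n + 1)) 𝓘(ℝ) ∞ f (φ x)) (h0 : ∀ x ∈ U, f (φ x) = 0)
    (hd : ∀ x ∈ U, differential (n + 1) f (φ x) ≠ 0) :
    (∀ x ∈ U, ∀ w : EuclideanSpace ℝ (Fin (n + 1)),
      IsGradientAt f (φ x) w → 0 < meanCurvature φ x w) ∨
    (∀ x ∈ U, ∀ w : EuclideanSpace ℝ (Fin (n + 1)),
      IsGradientAt f (φ x) w → meanCurvature φ x w < 0) := by
  have hex : ∀ x, ∃ w : EuclideanSpace ℝ (Fin (n + 1)), x ∈ U → IsGradientAt f (φ x) w := by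
    intro x
    by_cases hx : x ∈ U
    · obtain ⟨w, hw⟩ := exists_isGradientAt (hf x hx)
      exact ⟨w, fun _ => hw⟩
    · exact ⟨0, fun h => absurd h hx⟩
  choose w hw using hex
  have h0' : ∀ x ∈ U, ∀ᶠ x' in 𝓝 x, f (φ x') = 0 := fun x hx => by
    filter_upwards [hU.mem_nhds hx] with z hz using h0 z hz
  have hne : ∀ x ∈ U, meanCurvature φ x (w x) ≠ 0 := fun x hx =>
    meanCurvature_gradient_ne_zero (hφ x) (hi x)
      (differential_pushforward_eq_zero_of_eventually (hφ x) (hf x hx) (h0' x hx)) (hd x hx)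
      (hH x) (hw x hx)
  have hc : ContinuousOn (fun x => meanCurvature φ x (w x)) U := fun x hx =>
    (continuousAt_meanCurvature_gradient (.of_forall fun x => ⟨hφ x, hi x⟩)
      (by filter_upwards [hU.mem_nhds hx] with z hz using hf z hz) (h0' x hx)
      (by filter_upwards [hU.mem_nhds hx] with z hz using hw z hz)).continuousWithinAt
  by_contra! hcon
  obtain ⟨⟨x, hx, v, hv, hle⟩, ⟨y, hy, v', hv', hle'⟩⟩ := hcon
  rw [hv.unique (hw x hx)] at hle
  rw [hv'.unique (hw y hy)] at hle'
  obtain ⟨z, hz, h⟩ := hU'.intermediate_value hx hy hc ⟨hle, hle'⟩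
  exact hne z hz h

/-- A sheet is oriented by replacing its defining function `f i` by `-f i` if necessary. -/
theorem exists_orientedSheets {φ : S → M} (hφ : IsAlmostEmbedding (n := n) φ)
    (hH : ∀ x, ∃ w, IsNormal (n := n) φ x w ∧ meanCurvature φ x w ≠ 0) {p : M} (hp : p ∈ range φ) :
    ∃ T : OrientedSheets (n := n) φ, p ∈ T.W := by
  obtain ⟨W, hW, hpW, l, U, f, hU, hdisj, hcover, hemb, hsheet⟩ := hφ.sheets p hp
  have hmem : ∀ i, ∀ x ∈ U i, φ x ∈ W ∧ f i (φ x) = 0 := by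
    intro i x hx
    have : φ x ∈ φ '' U i := mem_image_of_mem φ hx
    rwa [(hsheet i).2.2.1] at this
  have hf : ∀ i, ∀ q ∈ W, ContMDiffAt (𝓡 (n + 1)) 𝓘(ℝ) ∞ (f i) q := fun i q hq =>
    (hsheet i).1.contMDiffAt (hW.mem_nhds hq)
  have hd : ∀ i, ∀ q ∈ W, f i q = 0 → differential (n + 1) (f i) q ≠ 0 := fun i =>
    (hsheet i).2.1
  have horient : ∀ i, ∃ g : M → ℝ, (g = f i ∨ g = fun q => -f i q) ∧
      ∀ x ∈ U i, ∀ w : EuclideanSpace ℝ (Fin (n + 1)),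
        IsGradientAt g (φ x) w → 0 < meanCurvature φ x w := by
    intro i
    rcases meanCurvature_gradient_pos_or_neg hφ.contMDiff hφ.immersion hH (hU i).1
      (hU i).2.isPreconnected (fun x hx => hf i _ (hmem i x hx).1) (fun x hx => (hmem i x hx).2)
      (fun x hx => hd i _ (hmem i x hx).1 (hmem i x hx).2) with h | h
    · exact ⟨f i, .inl rfl, h⟩
    · refine ⟨fun q => -f i q, .inr rfl, fun x hx w hw => ?_⟩
      have h1 := h x hx ((-1 : ℝ) • w) (hw.smul (by
        rw [differential_neg]; ext v; simp))
      rw [meanCurvature_smul (hφ.contMDiff x)] at h1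
      linarith
  choose g hg hpos using horient
  have hzero : ∀ i q, g i q = 0 ↔ f i q = 0 := by
    intro i q
    rcases hg i with h | h <;> simp [h]
  refine ⟨⟨W, l, U, g, hW, fun i => (hU i).1, fun i => (hU i).2.isPreconnected, hdisj, hcover,
    hemb, ?_, ?_, ?_, ?_, hpos⟩, hpW⟩
  · intro i q hq
    rcases hg i with h | h <;> rw [h]
    · exact hf i q hq
    · exact (hf i q hq).neg
  · intro i q hq h0
    have := hd i q hq ((hzero i q).1 h0)
    rcases hg i with h | h <;> rw [h]
    · exact this
    · rwa [differential_neg, neg_ne_zero]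
  · intro i
    simp only [hzero]
    exact (hsheet i).2.2.1
  · intro i j hij
    rcases hg i with h | h <;> simp only [h, Left.nonneg_neg_iff, Left.neg_nonpos_iff]
    · exact (hsheet i).2.2.2 j hij
    · exact ((hsheet i).2.2.2 j hij).symm

/-- The sides of the sheets to which the mean curvature vector points, as germs which depend only on
the point of the parameter manifold. -/
theorem exists_side {φ : S → M} (hφ : IsAlmostEmbedding (n := n) φ)
    (hH : ∀ x, ∃ w, IsNormal (n := n) φ x w ∧ meanCurvature φ x w ≠ 0) :
    ∃ P : S → M → Prop, ∀ (x : S) (T : OrientedSheets (n := n) φ) (i : Fin T.l), x ∈ T.U i →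
      ∀ᶠ q in 𝓝 (φ x), P x q ↔ 0 < T.f i q := by
  have h : ∀ x, ∃ T : OrientedSheets (n := n) φ, ∃ i : Fin T.l, x ∈ T.U i := by
    intro x
    obtain ⟨T, hT⟩ := exists_orientedSheets hφ hH (mem_range_self x)
    exact ⟨T, T.exists_mem_U hT⟩
  choose T i hTi using h
  exact ⟨fun x q => 0 < (T x).f (i x) q, fun x T' i' hx =>
    (T x).eventually_pos_iff T' hφ.contMDiff hφ.immersion (hTi x) hx⟩

end Sheets

/-! ### The multiplicity function of a component -/

theorem IsPreconnected.eq_of_eventually_eq {X Y : Type*} [TopologicalSpace X] {C : Set X}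
    (hC : IsPreconnected C) {s : X → Y} (hs : ∀ x ∈ C, ∀ᶠ z in 𝓝 x, s z = s x) {x y : X}
    (hx : x ∈ C) (hy : y ∈ C) : s x = s y := by
  let _ : TopologicalSpace Y := ⊥
  have : DiscreteTopology Y := ⟨rfl⟩
  refine hC.constant (fun x hx => ContinuousAt.continuousWithinAt ?_) hx hy
  exact continuousAt_const.congr (Filter.EventuallyEq.symm (hs x hx))

theorem isPreconnected_setOf_lt_norm_sub {E : Type*} [NormedAddCommGroup E] [NormedSpace ℝ E]
    (hE : 1 < Module.rank ℝ E) (y₀ : E) {r : ℝ} (hr : 0 ≤ r) :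
    IsPreconnected {y : E | r < ‖y - y₀‖} := by
  have h1 : IsPreconnected (Ioi r ×ˢ Metric.sphere (0 : E) 1) :=
    isPreconnected_Ioi.prod (isPreconnected_sphere hE 0 1)
  have h2 : {y : E | r < ‖y - y₀‖}
      = (fun q : ℝ × E => y₀ + q.1 • q.2) '' (Ioi r ×ˢ Metric.sphere (0 : E) 1) := by
    ext y
    constructor
    · intro hy
      have h3 : 0 < ‖y - y₀‖ := hr.trans_lt hy
      refine ⟨(‖y - y₀‖, ‖y - y₀‖⁻¹ • (y - y₀)), ⟨hy, ?_⟩, ?_⟩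
      · rw [mem_sphere_zero_iff_norm, norm_smul, norm_inv, norm_norm, inv_mul_cancel₀ h3.ne']
      · simp only [smul_smul, mul_inv_cancel₀ h3.ne', one_smul, add_sub_cancel]
    · rintro ⟨⟨t, v⟩, ⟨ht, hv⟩, rfl⟩
      have ht' : 0 < t := hr.trans_lt ht
      rw [mem_sphere_zero_iff_norm] at hv
      simp only [mem_ofPred_eq, add_sub_cancel_left, norm_smul, hv, mul_one, Real.norm_eq_abs,
        abs_of_pos ht']
      exact ht
  rw [h2]
  exact h1.image _ (by fun_prop)

section Multiplicity

variable {n : ℕ}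
  {M : Type*} [TopologicalSpace M] [ChartedSpace (EuclideanSpace ℝ (Fin (n + 1))) M]
  [RiemannianBundle (fun p : M => TangentSpace (𝓡 (n + 1)) p)]
  {S : Type*} [TopologicalSpace S] [ChartedSpace (EuclideanSpace ℝ (Fin n)) S]

open Classical in
/-- The number of sheets through `q` which belong to the part `K` of the parameter manifold, and on
whose positive side `z` lies.  Here, `P x` is the positive side of the sheet at `x`. -/
noncomputable def jump (φ : S → M) (P : S → M → Prop) (K : Set S) (q z : M) : ℤ :=
  ∑ᶠ x ∈ {x | φ x = q ∧ x ∈ K}, if P x z then 1 else 0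

omit [TopologicalSpace M] [ChartedSpace (EuclideanSpace ℝ (Fin (n + 1))) M]
  [RiemannianBundle (fun p : M => TangentSpace (𝓡 (n + 1)) p)] [TopologicalSpace S]
  [ChartedSpace (EuclideanSpace ℝ (Fin n)) S] in
theorem jump_eq_zero {φ : S → M} {P : S → M → Prop} {K : Set S} {q z : M}
    (h : ∀ x ∈ K, φ x = q → ¬P x z) : jump φ P K q z = 0 := by
  rw [jump, finsum_mem_congr rfl (g := fun _ => 0) fun x hx => if_neg (h x hx.2 hx.1)]
  simp

namespace OrientedSheets

variable {φ : S → M} (T : OrientedSheets (n := n) φ)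

theorem finite_fiber {q : M} (hq : q ∈ T.W) : {x | φ x = q}.Finite := by
  have h : ∀ x : {x | φ x = q}, ∃ i, (x : S) ∈ T.U i := fun x =>
    T.exists_mem_U (by rw [x.2]; exact hq)
  choose i hi using h
  have hinj : Injective i := by
    intro x y hxy
    have h1 := hi y
    rw [← hxy] at h1
    exact Subtype.ext (T.injOn _ (hi x) h1 (x.2.trans y.2.symm))
  exact Finite.of_injective i hinj

open Classical in
/-- The number of sheets in `K` on whose positive side a point lies. -/
noncomputable def count (K : Set S) (z : M) : ℤ :=
  ∑ i, if T.U i ⊆ K ∧ 0 < T.f i z then 1 else 0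

/-- The number of sheets on whose positive side a point lies changes by `jump` near `q`. The sheets
which do not pass through `q` do not contribute to the change. -/
theorem eventually_count_eq [Nonempty S] {P : S → M → Prop}
    (hP : ∀ (x : S) (i : Fin T.l), x ∈ T.U i → ∀ᶠ q in 𝓝 (φ x), P x q ↔ 0 < T.f i q)
    {K : Set S} (hK : ∀ i, ∀ x ∈ T.U i, x ∈ K → T.U i ⊆ K) {q : M} (hq : q ∈ T.W) :
    ∀ᶠ z in 𝓝 q, T.count K z = T.count K q + jump φ P K q z := by
  classical
  have hex : ∀ i, ∃ x, T.f i q = 0 → x ∈ T.U i ∧ φ x = q := by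
    intro i
    by_cases h : T.f i q = 0
    · obtain ⟨x, hx⟩ := T.exists_of_f_eq_zero hq h
      exact ⟨x, fun _ => hx⟩
    · exact ⟨Classical.arbitrary S, fun h' => absurd h' h⟩
  choose x hx using hex
  -- The sheets in `K` through `q`.
  set J : Finset (Fin T.l) := Finset.univ.filter fun i => T.U i ⊆ K ∧ T.f i q = 0 with hJ
  have hjump : ∀ z, jump φ P K q z = ∑ i ∈ J, if P (x i) z then 1 else 0 := by
    intro z
    rw [jump, ← finsum_mem_coe_finset]
    refine (finsum_mem_eq_of_bijOn x ⟨?_, ?_, ?_⟩ fun _ _ => rfl).symm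
    · intro i hi
      simp only [hJ, Finset.coe_filter, Finset.mem_univ, true_and, mem_ofPred_eq] at hi
      exact ⟨(hx i hi.2).2, hi.1 (hx i hi.2).1⟩
    · intro i hi j hj hij
      simp only [hJ, Finset.coe_filter, Finset.mem_univ, true_and, mem_ofPred_eq] at hi hj
      have h1 := (hx i hi.2).1
      rw [hij] at h1
      exact T.eq_of_mem h1 (hx j hj.2).1
    · rintro y ⟨hy, hyK⟩
      obtain ⟨i, hi⟩ := T.exists_mem_U (x := y) (by rw [hy]; exact hq)
      have h0 : T.f i q = 0 := by rw [← hy]; exact T.f_apply hi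
      refine ⟨i, ?_, T.injOn i (hx i h0).1 hi ((hx i h0).2.trans hy.symm)⟩
      simp only [hJ, Finset.coe_filter, Finset.mem_univ, true_and, mem_ofPred_eq]
      exact ⟨hK i y hi hyK, h0⟩
  have hterm : ∀ i, ∀ᶠ z in 𝓝 q, (if T.U i ⊆ K ∧ 0 < T.f i z then (1 : ℤ) else 0)
      = (if T.U i ⊆ K ∧ 0 < T.f i q then 1 else 0)
        + if T.U i ⊆ K ∧ T.f i q = 0 then (if P (x i) z then 1 else 0) else 0 := by
    intro i
    have hc : ContinuousAt (T.f i) q := (T.contMDiffAt i q hq).continuousAt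
    rcases lt_trichotomy (T.f i q) 0 with h | h | h
    · filter_upwards [hc.eventually (gt_mem_nhds h)] with z hz
      simp [h.ne, hz.not_gt, h.not_gt]
    · have h1 := hP (x i) i (hx i h).1
      rw [(hx i h).2] at h1
      filter_upwards [h1] with z hz
      by_cases hU : T.U i ⊆ K <;> simp [h, hz, hU]
    · filter_upwards [hc.eventually (lt_mem_nhds h)] with z hz
      simp [h.ne', hz, h]
  filter_upwards [Filter.eventually_all.2 hterm] with z hz
  rw [count, count, hjump, Finset.sum_congr rfl fun i _ => hz i, Finset.sum_add_distrib, hJ,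
    Finset.sum_filter]

end OrientedSheets

/-- A component of a hypersurface, contained in a ball of a chart, has a multiplicity function: it
vanishes outside of the ball, and it jumps by one across every sheet of the component. -/
theorem exists_multiplicity [T2Space M] [Nonempty S] (hn : 0 < n) {φ : S → M} (hφ : Continuous φ)
    (hT : ∀ p ∈ range φ, ∃ T : OrientedSheets (n := n) φ, p ∈ T.W) {P : S → M → Prop}
    (hP : ∀ (x : S) (T : OrientedSheets (n := n) φ) (i : Fin T.l), x ∈ T.U i →
      ∀ᶠ q in 𝓝 (φ x), P x q ↔ 0 < T.f i q)
    {K : Set S} (hK : IsCompact K)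
    (hKU : ∀ (T : OrientedSheets (n := n) φ) i, ∀ x ∈ T.U i, x ∈ K → T.U i ⊆ K)
    {p : M} {r : ℝ} (hr : 0 ≤ r)
    (hKr : ∀ x ∈ K, φ x ∈ (extChartAt (𝓡 (n + 1)) p).source ∧
      ‖extChartAt (𝓡 (n + 1)) p (φ x) - extChartAt (𝓡 (n + 1)) p p‖ ≤ r)
    (hball : Metric.closedBall (extChartAt (𝓡 (n + 1)) p p) r
      ⊆ (extChartAt (𝓡 (n + 1)) p).target) :
    ∃ s : M → ℤ, (∀ q, ¬(q ∈ (extChartAt (𝓡 (n + 1)) p).source ∧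
        ‖extChartAt (𝓡 (n + 1)) p q - extChartAt (𝓡 (n + 1)) p p‖ ≤ r) → s q = 0) ∧
      ∀ q, ∀ᶠ z in 𝓝 q, s z = s q + jump φ P K q z := by
  classical
  set e := extChartAt (𝓡 (n + 1)) p with he
  set y₀ := e p with hy₀
  have hes : IsOpen e.source := isOpen_extChartAt_source p
  have het : IsOpen e.target := isOpen_extChartAt_target p
  have hec : ContinuousOn e e.source := continuousOn_extChartAt p
  have hec' : ContinuousOn e.symm e.target := continuousOn_extChartAt_symm p
  -- The local functions are the numbers of sheets, and zero in the complement of the component.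
  let W : Option (OrientedSheets (n := n) φ) → Set (EuclideanSpace ℝ (Fin (n + 1))) := fun a =>
    a.elim (e '' (φ '' K))ᶜ fun T => e.target ∩ e.symm ⁻¹' T.W
  let σ : Option (OrientedSheets (n := n) φ) → EuclideanSpace ℝ (Fin (n + 1)) → ℤ := fun a y =>
    a.elim 0 fun T => T.count K (e.symm y)
  have hcompact : IsCompact (e '' (φ '' K)) := by
    refine (hK.image hφ).image_of_continuousOn (hec.mono ?_)
    rintro _ ⟨x, hx, rfl⟩
    exact (hKr x hx).1
  have hWo : ∀ a, IsOpen (W a) := by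
    rintro (_ | T)
    · exact hcompact.isClosed.isOpen_compl
    · exact hec'.isOpen_inter_preimage het T.isOpen_W
  have hcov : ⋃ a, W a = univ := by
    rw [eq_univ_iff_forall]
    intro y
    by_cases hy : y ∈ e '' (φ '' K)
    · obtain ⟨_, ⟨x, hx, rfl⟩, rfl⟩ := hy
      obtain ⟨T, hT⟩ := hT _ (mem_range_self x)
      refine mem_iUnion.2 ⟨some T, e.map_source (hKr x hx).1, ?_⟩
      rw [mem_preimage, e.left_inv (hKr x hx).1]
      exact hT
    · exact mem_iUnion.2 ⟨none, hy⟩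
  -- In the chart, all local functions have the same jumps.
  have hσ : ∀ a, ∀ y ∈ W a, y ∈ e.target →
      ∀ᶠ z in 𝓝 y, σ a z = σ a y + jump φ P K (e.symm y) (e.symm z) := by
    rintro (_ | T) y hy hyt
    · refine Filter.Eventually.of_forall fun z => ?_
      rw [jump_eq_zero]
      · rfl
      · intro x hx hxy
        refine absurd (mem_image_of_mem e (mem_image_of_mem φ hx)) ?_
        rw [hxy, e.right_inv hyt]
        exact hy
    · exact (hec'.continuousAt (het.mem_nhds hyt)).eventually
        (T.eventually_count_eq (fun x i hx => hP x T i hx) (hKU T) hy.2)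
  obtain ⟨s₀, hs₀⟩ := exists_int_step_of_cocycle W hWo hcov σ (by
    intro a b y hy
    by_cases hyt : y ∈ e.target
    · filter_upwards [hσ a y hy.1 hyt, hσ b y hy.2 hyt] with z h1 h2
      rw [h1, h2]
      ring
    · rcases a with _ | T
      · rcases b with _ | T'
        · exact Filter.Eventually.of_forall fun z => rfl
        · exact absurd hy.2.1 hyt
      · exact absurd hy.1.1 hyt)
  have hs₀' : ∀ y ∈ e.target, ∀ᶠ z in 𝓝 y, s₀ z = s₀ y + jump φ P K (e.symm y) (e.symm z) := by
    intro y hy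
    obtain ⟨a, ha⟩ := mem_iUnion.1 (hcov.ge (mem_univ y))
    filter_upwards [hσ a y ha hy, hs₀ a y ha] with z h1 h2
    linarith
  -- Outside of the ball, the function is constant.
  have hrank : 1 < Module.rank ℝ (EuclideanSpace ℝ (Fin (n + 1))) := by
    rw [← Module.finrank_eq_rank, finrank_euclideanSpace_fin]
    exact_mod_cast Nat.lt_add_of_pos_left hn
  have hout : ∀ y, r < ‖y - y₀‖ → y ∈ W none := by
    rintro y hy ⟨_, ⟨x, hx, rfl⟩, rfl⟩
    exact ((hKr x hx).2.trans_lt hy).false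
  obtain ⟨c, hc⟩ : ∃ c, ∀ y, r < ‖y - y₀‖ → s₀ y = c := by
    by_cases hne : ∃ y, r < ‖y - y₀‖
    · obtain ⟨y, hy⟩ := hne
      refine ⟨s₀ y, fun z hz => ?_⟩
      refine IsPreconnected.eq_of_eventually_eq (isPreconnected_setOf_lt_norm_sub hrank y₀ hr)
        (fun x hx => ?_) hz hy
      filter_upwards [hs₀ none x (hout x hx)] with z hz
      simpa [σ] using hz
    · exact ⟨0, fun y hy => absurd ⟨y, hy⟩ hne⟩
  set B : Set M := {q | q ∈ e.source ∧ ‖e q - y₀‖ ≤ r} with hB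
  have hBclosed : IsClosed B := by
    have h1 : B = e.symm '' Metric.closedBall y₀ r := by
      ext q
      constructor
      · intro hq
        exact ⟨e q, by rw [mem_closedBall_iff_norm]; exact hq.2, e.left_inv hq.1⟩
      · rintro ⟨y, hy, rfl⟩
        refine ⟨e.map_target (hball hy), ?_⟩
        rw [e.right_inv (hball hy), ← mem_closedBall_iff_norm]
        exact hy
    rw [h1]
    exact ((isCompact_closedBall y₀ r).image_of_continuousOn (hec'.mono hball)).isClosed
  refine ⟨fun q => if q ∈ B then s₀ (e q) - c else 0, fun q hq => if_neg hq, fun q => ?_⟩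
  have hsource : ∀ q ∈ e.source, (if q ∈ B then s₀ (e q) - c else 0) = s₀ (e q) - c := by
    intro q hq
    split_ifs with h
    · rfl
    · rw [hc (e q) (not_le.1 fun h' => h ⟨hq, h'⟩), sub_self]
  by_cases hq : q ∈ e.source
  · have h1 := (hec.continuousAt (hes.mem_nhds hq)).eventually (hs₀' (e q) (e.map_source hq))
    filter_upwards [h1, hes.mem_nhds hq] with z h2 h3
    rw [e.left_inv hq, e.left_inv h3] at h2
    rw [hsource q hq, hsource z h3, h2]
    ring
  · have hqB : q ∉ B := fun h => hq h.1
    filter_upwards [hBclosed.isOpen_compl.mem_nhds hqB] with z hz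
    rw [if_neg hz, if_neg hqB, jump_eq_zero, add_zero]
    rintro x hx rfl
    exact absurd (hKr x hx).1 hq

end Multiplicity

section Regular

variable {n : ℕ}
  {M : Type*} [TopologicalSpace M] [ChartedSpace (EuclideanSpace ℝ (Fin (n + 1))) M]
  [RiemannianBundle (fun p : M => TangentSpace (𝓡 (n + 1)) p)]
  {S : Type*} [TopologicalSpace S] [ChartedSpace (EuclideanSpace ℝ (Fin n)) S]

omit [TopologicalSpace M] [ChartedSpace (EuclideanSpace ℝ (Fin (n + 1))) M]
  [RiemannianBundle (fun p : M => TangentSpace (𝓡 (n + 1)) p)] [TopologicalSpace S]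
  [ChartedSpace (EuclideanSpace ℝ (Fin n)) S] in
theorem jump_of_mem_regularPoints {φ : S → M} {P : S → M → Prop} {K : Set S} {x : S} {z : M}
    (hx : x ∈ regularPoints φ) (hxK : x ∈ K) (hz : P x z) : jump φ P K (φ x) z = 1 := by
  have h : {y | φ y = φ x ∧ y ∈ K} = {x} := by
    ext y
    exact ⟨fun h => hx y h.1, by rintro rfl; exact ⟨rfl, hxK⟩⟩
  rw [jump, h, finsum_mem_singleton, if_pos hz]

/-- Since the sheets do not cross, a function with the jumps of a multiplicity function has the same
value at all regular points of a sheet near a given point. -/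
theorem OrientedSheets.exists_eventually_eq {φ : S → M} (T : OrientedSheets (n := n) φ)
    (hφ : Continuous φ) {P : S → M → Prop}
    (hP : ∀ (x : S) (i : Fin T.l), x ∈ T.U i → ∀ᶠ q in 𝓝 (φ x), P x q ↔ 0 < T.f i q)
    {K : Set S} {s : M → ℤ} {x : S} (hx : φ x ∈ T.W)
    (hs : ∀ᶠ z in 𝓝 (φ x), s z = s (φ x) + jump φ P K (φ x) z) :
    ∃ k, s (φ x) ≤ k ∧ ∀ᶠ x' in 𝓝 x, x' ∈ regularPoints φ → s (φ x') = k := by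
  classical
  obtain ⟨i, hi⟩ := T.exists_mem_U hx
  have hQ : ∀ y, φ y = φ x → ∃ Q : Prop, ∀ᶠ x' in 𝓝 x, x' ∈ regularPoints φ →
      (P y (φ x') ↔ Q) := by
    intro y hy
    obtain ⟨j, hj⟩ := T.exists_mem_U (x := y) (by rw [hy]; exact hx)
    have h1 := hP y j hj
    rw [hy] at h1
    have h2 := hφ.continuousAt.eventually h1
    have h3 : ∀ᶠ x' in 𝓝 x, x' ∈ T.U i := (T.isOpen_U i).mem_nhds hi
    by_cases hij : i = j
    -- The points of a sheet do not lie on its positive side.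
    · subst hij
      refine ⟨False, ?_⟩
      filter_upwards [h2, h3] with x' h4 h5 _
      rw [h4, T.f_apply h5]
      simp
    · -- A regular point of one sheet does not lie on the other sheet.
      have hne : ∀ x' ∈ T.U i, x' ∈ regularPoints φ → T.f j (φ x') ≠ 0 := by
        intro x' hx' hreg h0
        obtain ⟨y', hy', h⟩ := T.exists_of_f_eq_zero (T.mem_W hx') h0
        rw [hreg y' h] at hy'
        exact hij (T.eq_of_mem hx' hy')
      rcases T.one_sided j i hij with h | h
      · refine ⟨True, ?_⟩
        filter_upwards [h2, h3] with x' h4 h5 h6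
        rw [h4, iff_true]
        exact lt_of_le_of_ne (h _ (mem_image_of_mem φ h5)) (hne x' h5 h6).symm
      · refine ⟨False, ?_⟩
        filter_upwards [h2, h3] with x' h4 h5 h6
        rw [h4, iff_false, not_lt]
        exact h _ (mem_image_of_mem φ h5)
  have hfin : {y | φ y = φ x ∧ y ∈ K}.Finite := (T.finite_fiber hx).subset fun y hy => hy.1
  have hQ' : ∀ y, ∃ Q : Prop, φ y = φ x → ∀ᶠ x' in 𝓝 x, x' ∈ regularPoints φ →
      (P y (φ x') ↔ Q) := by
    intro y
    by_cases hy : φ y = φ x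
    · obtain ⟨Q, h⟩ := hQ y hy
      exact ⟨Q, fun _ => h⟩
    · exact ⟨True, fun h => absurd h hy⟩
  choose Q hQ using hQ'
  refine ⟨s (φ x) + ∑ᶠ y ∈ {y | φ y = φ x ∧ y ∈ K}, (if Q y then 1 else 0 : ℤ), ?_, ?_⟩
  · refine le_add_of_nonneg_right (finsum_mem_induction (fun a : ℤ => 0 ≤ a) le_rfl
      (fun _ _ => add_nonneg) fun y _ => ?_)
    split_ifs <;> simp
  · filter_upwards [hφ.continuousAt.eventually hs,
      (Filter.eventually_all_finite hfin).2 fun y hy => hQ y hy.1] with x' h1 h2 hreg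
    rw [h1, jump]
    exact congrArg (s (φ x) + ·) (finsum_mem_congr rfl fun y hy => if_congr (h2 y hy hreg) rfl rfl)

variable [IsManifold (𝓡 (n + 1)) ∞ M] [IsManifold (𝓡 n) ∞ S]
  [IsContMDiffRiemannianBundle (𝓡 (n + 1)) ∞ (EuclideanSpace ℝ (Fin (n + 1)))
    (fun p : M => TangentSpace (𝓡 (n + 1)) p)]

/-- At a local maximum of the distance to the centre of a small ball, the differential of the squared
distance is a negative multiple of the differential of the oriented defining function. -/
theorem OrientedSheets.exists_differential_chartDistSq_eq (hn : 0 < n) {φ : S → M}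
    (T : OrientedSheets (n := n) φ)
    (hφ : ContMDiff (𝓡 n) (𝓡 (n + 1)) ∞ φ) (hi : ∀ x, Injective (pushforward n φ x)) {p : M} {y : S}
    (hy : φ y ∈ (extChartAt (𝓡 (n + 1)) p).source)
    (hpos : ∀ a, a ≠ 0 → 0 < metricHessian (metricForm p)
      (chartDistSq (n := n) p ∘ (extChartAt (𝓡 (n + 1)) p).symm)
      (extChartAt (𝓡 (n + 1)) p (φ y))
      (coordGradient p (chartDistSq (n := n) p) (extChartAt (𝓡 (n + 1)) p (φ y))) a a)
    (hmax : IsLocalMax (chartDistSq (n := n) p ∘ φ) y) {i : Fin T.l} (hyi : y ∈ T.U i) :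
    ∃ c : ℝ, c < 0 ∧ differential (n + 1) (chartDistSq (n := n) p) (φ y)
      = c • differential (n + 1) (T.f i) (φ y) := by
  have hf := T.contMDiffAt i _ (T.mem_W hyi)
  have hd := T.differential_ne_zero i _ (T.mem_W hyi) (T.f_apply hyi)
  have hu := contMDiffAt_chartDistSq hy
  obtain ⟨c, hc⟩ := exists_eq_smul_differential (hi y)
    (differential_pushforward_eq_zero_of_eventually (hφ y) hf (by
      filter_upwards [(T.isOpen_U i).mem_nhds hyi] with z hz using T.f_apply hz)) hd
    (differential_pushforward_eq_zero (hφ y) hu hmax)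
  obtain ⟨w, hw⟩ := exists_isGradientAt hf
  have h1 := T.meanCurvature_pos i y hyi w hw
  have h2 := meanCurvature_neg_of_isLocalMax hn (hφ y) (hi y) hy hu hmax hpos (hw.smul hc)
  rw [meanCurvature_smul (hφ y)] at h2
  exact ⟨c, by by_contra! h; nlinarith, hc⟩

/-- The multiplicity function vanishes at the point of the component which is farthest from the centre
of the ball: all sheets through this point have their negative sides towards the exterior of the
ball, where the multiplicity function vanishes. -/
theorem OrientedSheets.multiplicity_eq_zero_of_farthest (hn : 0 < n) {φ : S → M}
    (T : OrientedSheets (n := n) φ)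
    (hφ : ContMDiff (𝓡 n) (𝓡 (n + 1)) ∞ φ) (hi : ∀ x, Injective (pushforward n φ x))
    {P : S → M → Prop}
    (hP : ∀ (x : S) (i : Fin T.l), x ∈ T.U i → ∀ᶠ q in 𝓝 (φ x), P x q ↔ 0 < T.f i q)
    {K : Set S} (hK : IsOpen K) {s : M → ℤ} {p : M} {x : S} (hxK : x ∈ K) (hxW : φ x ∈ T.W)
    (hx : φ x ∈ (extChartAt (𝓡 (n + 1)) p).source)
    (hpos : ∀ a, a ≠ 0 → 0 < metricHessian (metricForm p)
      (chartDistSq (n := n) p ∘ (extChartAt (𝓡 (n + 1)) p).symm)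
      (extChartAt (𝓡 (n + 1)) p (φ x))
      (coordGradient p (chartDistSq (n := n) p) (extChartAt (𝓡 (n + 1)) p (φ x))) a a)
    (hmax : ∀ y ∈ K, chartDistSq (n := n) p (φ y) ≤ chartDistSq (n := n) p (φ x))
    (hs0 : ∀ q, chartDistSq (n := n) p (φ x) < chartDistSq (n := n) p q → s q = 0)
    (hs : ∀ᶠ z in 𝓝 (φ x), s z = s (φ x) + jump φ P K (φ x) z) : s (φ x) = 0 := by
  have hu := contMDiffAt_chartDistSq hx
  have hmax' : ∀ y ∈ K, φ y = φ x → IsLocalMax (chartDistSq (n := n) p ∘ φ) y := by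
    intro y hy hyx
    filter_upwards [hK.mem_nhds hy] with z hz
    rw [Function.comp_apply, Function.comp_apply, hyx]
    exact hmax z hz
  have hc : ∀ y ∈ K, φ y = φ x → ∀ i, y ∈ T.U i → ∃ c : ℝ, c < 0 ∧
      differential (n + 1) (chartDistSq (n := n) p) (φ x)
        = c • differential (n + 1) (T.f i) (φ x) := by
    intro y hy hyx i hyi
    have := T.exists_differential_chartDistSq_eq hn hφ hi (p := p) (y := y) (by rwa [hyx])
      (by rwa [hyx]) (hmax' y hy hyx) hyi
    rwa [hyx] at this
  have hdu : differential (n + 1) (chartDistSq (n := n) p) (φ x) ≠ 0 := by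
    obtain ⟨i, hxi⟩ := T.exists_mem_U hxW
    obtain ⟨c, hc0, hc⟩ := hc x hxK rfl i hxi
    rw [hc]
    exact smul_ne_zero hc0.ne (T.differential_ne_zero i _ hxW (T.f_apply hxi))
  -- Along a curve which leaves the ball, the multiplicity vanishes, and all sheets of the component
  -- are left to their negative sides.
  obtain ⟨ν, hν⟩ := exists_pos_differential_of_ne_zero hdu
  have h1 : ∀ᶠ t in 𝓝[>] (0 : ℝ), chartDistSq (n := n) p (φ x) < chartDistSq (n := n) p
      ((extChartAt (𝓡 (n + 1)) (φ x)).symm (extChartAt (𝓡 (n + 1)) (φ x) (φ x) + t • ν)) := by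
    have hd : differential (n + 1)
        (fun q => chartDistSq (n := n) p q - chartDistSq (n := n) p (φ x)) (φ x)
        = differential (n + 1) (chartDistSq (n := n) p) (φ x) := by
      have h2 := hu.mdifferentiableAt (by simp)
      have h3 : MDifferentiableAt (𝓡 (n + 1)) 𝓘(ℝ)
        (fun q => chartDistSq (n := n) p q - chartDistSq (n := n) p (φ x)) (φ x) :=
        h2.sub mdifferentiableAt_const
      rw [differential_eq_fderiv_extChartAt h2, differential_eq_fderiv_extChartAt h3]
      exact fderiv_sub_const _
    have h2 := eventually_pos_along_chart
      (f := fun q => chartDistSq (n := n) p q - chartDistSq (n := n) p (φ x))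
      ((hu.mdifferentiableAt (by simp)).sub mdifferentiableAt_const) (sub_self _)
      (by rw [hd]; exact hν)
    filter_upwards [h2] with t ht
    exact sub_pos.1 ht
  have h2 : ∀ y ∈ {y | φ y = φ x ∧ y ∈ K}, ∀ᶠ t in 𝓝[>] (0 : ℝ), ¬P y
      ((extChartAt (𝓡 (n + 1)) (φ x)).symm (extChartAt (𝓡 (n + 1)) (φ x) (φ x) + t • ν)) := by
    rintro y ⟨hyx, hyK⟩
    obtain ⟨i, hyi⟩ := T.exists_mem_U (x := y) (by rwa [hyx])
    obtain ⟨c, hc0, hc⟩ := hc y hyK hyx i hyi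
    have h3 := hP y i hyi
    rw [hyx] at h3
    have h4 := eventually_pos_along_chart (f := fun q => -T.f i q) (p := φ x) (ν := ν)
      ((T.contMDiffAt i _ hxW).mdifferentiableAt (by simp)).neg
      (by rw [← hyx, T.f_apply hyi, neg_zero]) (by
        rw [hc] at hν
        rw [differential_neg]
        have hν' : 0 < c * differential (n + 1) (T.f i) (φ x) ν := hν
        change 0 < -(differential (n + 1) (T.f i) (φ x) ν)
        by_contra! h
        nlinarith)
    filter_upwards [(tendsto_along_chart (φ x) ν).eventually h3, h4] with t h5 h6
    rw [h5, not_lt]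
    linarith
  have hfin : {y | φ y = φ x ∧ y ∈ K}.Finite := (T.finite_fiber hxW).subset fun y hy => hy.1
  obtain ⟨t, h3, h4, h5⟩ := (h1.and (((Filter.eventually_all_finite hfin).2 h2).and
    ((tendsto_along_chart (φ x) ν).eventually hs))).exists
  rw [hs0 _ h3, jump_eq_zero fun y hy hyx => h4 y ⟨hyx, hy⟩, add_zero] at h5
  exact h5.symm

end Regular

/-! ### Small components bound small domains -/

section SmallDomain

variable {n : ℕ}
  {M : Type*} [TopologicalSpace M] [T2Space M] [ChartedSpace (EuclideanSpace ℝ (Fin (n + 1))) M]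
  [IsManifold (𝓡 (n + 1)) ∞ M]
  [RiemannianBundle (fun p : M => TangentSpace (𝓡 (n + 1)) p)]
  [IsContMDiffRiemannianBundle (𝓡 (n + 1)) ∞ (EuclideanSpace ℝ (Fin (n + 1)))
    (fun p : M => TangentSpace (𝓡 (n + 1)) p)]
  {S : Type*} [TopologicalSpace S] [CompactSpace S]
  [ChartedSpace (EuclideanSpace ℝ (Fin n)) S] [IsManifold (𝓡 n) ∞ S]

/-- If a component of the hypersurface is contained in a small ball, then so is every domain in its
complement which lies on the positive side of the component at a regular point. -/
theorem subset_ball_of_frequently (hn : 0 < n) {φ : S → M} (hφ : IsAlmostEmbedding (n := n) φ)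
    (hreg : Dense (regularPoints φ))
    (hT : ∀ p ∈ range φ, ∃ T : OrientedSheets (n := n) φ, p ∈ T.W) {P : S → M → Prop}
    (hP : ∀ (x : S) (T : OrientedSheets (n := n) φ) (i : Fin T.l), x ∈ T.U i →
      ∀ᶠ q in 𝓝 (φ x), P x q ↔ 0 < T.f i q)
    {p : M} {ρ : ℝ}
    (hball : Metric.ball (extChartAt (𝓡 (n + 1)) p p) ρ ⊆ (extChartAt (𝓡 (n + 1)) p).target)
    (hpos : ∀ y ∈ Metric.ball (extChartAt (𝓡 (n + 1)) p p) ρ, ∀ a, a ≠ 0 →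
      0 < metricHessian (metricForm p) (chartDistSq (n := n) p ∘ (extChartAt (𝓡 (n + 1)) p).symm) y
        (coordGradient p (chartDistSq (n := n) p) y) a a)
    {x : S} (hx : x ∈ regularPoints φ)
    (hK : ∀ y ∈ connectedComponent x, φ y ∈ (extChartAt (𝓡 (n + 1)) p).source ∧
      extChartAt (𝓡 (n + 1)) p (φ y) ∈ Metric.ball (extChartAt (𝓡 (n + 1)) p p) ρ)
    {C : Set M} (hC : IsPreconnected C) (hCφ : C ⊆ (range φ)ᶜ)
    (hfreq : ∃ᶠ z in 𝓝 (φ x), z ∈ C ∧ P x z) :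
    ∀ q ∈ C, q ∈ (extChartAt (𝓡 (n + 1)) p).source ∧
      extChartAt (𝓡 (n + 1)) p q ∈ Metric.ball (extChartAt (𝓡 (n + 1)) p p) ρ := by
  have : Nonempty S := ⟨x⟩
  have : LocallyConnectedSpace S :=
    ChartedSpace.locallyConnectedSpace (EuclideanSpace ℝ (Fin n)) S
  have hφc : Continuous φ := hφ.contMDiff.continuous
  set e := extChartAt (𝓡 (n + 1)) p with he
  set y₀ := e p with hy₀
  have hKc : IsCompact (connectedComponent x) := isClosed_connectedComponent.isCompact
  have hcont : ContinuousOn (fun y => ‖e (φ y) - y₀‖) (connectedComponent x) := by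
    refine (ContinuousOn.sub ?_ continuousOn_const).norm
    exact (continuousOn_extChartAt p).comp hφc.continuousOn fun y hy => (hK y hy).1
  obtain ⟨x₁, hx₁, hmax⟩ := hKc.exists_isMaxOn ⟨x, mem_connectedComponent⟩ hcont
  have hmax' : ∀ y ∈ connectedComponent x, ‖e (φ y) - y₀‖ ≤ ‖e (φ x₁) - y₀‖ := fun y hy => hmax hy
  have hr : ‖e (φ x₁) - y₀‖ < ρ := by
    rw [← mem_ball_iff_norm]
    exact (hK x₁ hx₁).2
  obtain ⟨s, hs0, hs⟩ := exists_multiplicity hn hφc hT hP hKc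
    (fun T i y hy hyK => by
      rw [connectedComponent_eq hyK]
      exact (T.isPreconnected_U i).subset_connectedComponent hy)
    (p := p) (norm_nonneg (e (φ x₁) - y₀)) (fun y hy => ⟨(hK y hy).1, hmax' y hy⟩)
    ((Metric.closedBall_subset_ball hr).trans hball)
  -- The multiplicity at the regular points of the component does not depend on the point.
  have hloc : ∀ y, ∃ k, s (φ y) ≤ k ∧ ∀ᶠ y' in 𝓝 y, y' ∈ regularPoints φ → s (φ y') = k := by
    intro y
    obtain ⟨T, hTy⟩ := hT _ (mem_range_self y)
    exact T.exists_eventually_eq hφc (fun y i hy => hP y T i hy) hTy (hs (φ y))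
  choose k hk hk' using hloc
  have hkconst : k x = k x₁ := by
    refine IsPreconnected.eq_of_eventually_eq isPreconnected_connectedComponent
      (fun y _ => ?_) mem_connectedComponent hx₁
    filter_upwards [eventually_eventually_nhds.2 (hk' y)] with z hz
    obtain ⟨z', h1, h2, h3⟩ :=
      ((mem_closure_iff_frequently.1 (hreg z)).and_eventually (hz.and (hk' z))).exists
    exact (h3 h1).symm.trans (h2 h1)
  have hs1 : s (φ x₁) = 0 := by
    obtain ⟨T, hTy⟩ := hT _ (mem_range_self x₁)
    refine T.multiplicity_eq_zero_of_farthest hn hφ.contMDiff hφ.immersion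
      (fun y i hy => hP y T i hy) isOpen_connectedComponent hx₁ hTy (hK x₁ hx₁).1
      (hpos _ (hK x₁ hx₁).2) ?_ ?_ (hs _)
    · intro y hy
      exact pow_le_pow_left₀ (norm_nonneg _) (hmax' y hy) 2
    · intro q hq
      refine hs0 q fun h => ?_
      exact (pow_le_pow_left₀ (norm_nonneg _) h.2 2).not_gt hq
  have hsx : 0 ≤ s (φ x) := by
    rw [(hk' x).self_of_nhds hx, hkconst, ← hs1]
    exact hk x₁
  obtain ⟨z, ⟨hzC, hzP⟩, hz⟩ := (hfreq.and_eventually (hs (φ x))).exists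
  rw [jump_of_mem_regularPoints hx mem_connectedComponent hzP] at hz
  intro q hq
  have hsq : s q = s z := by
    refine IsPreconnected.eq_of_eventually_eq hC (fun q hq => ?_) hq hzC
    filter_upwards [hs q] with z' hz'
    rw [hz', jump_eq_zero, add_zero]
    rintro y _ rfl
    exact absurd (mem_range_self y) (hCφ hq)
  by_contra hcon
  have : s q = 0 := hs0 q fun h => hcon ⟨h.1, by rw [mem_ball_iff_norm]; exact h.2.trans_lt hr⟩
  omega

omit [T2Space M] in
variable (n) in
/-- Every point has arbitrarily small neighbourhoods to which `subset_ball_of_frequently`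
applies. -/
theorem exists_radius (p : M) {V : Set M} (hV : V ∈ 𝓝 p) : ∃ ρ > 0,
    Metric.ball (extChartAt (𝓡 (n + 1)) p p) ρ ⊆ (extChartAt (𝓡 (n + 1)) p).target ∧
    (∀ y ∈ Metric.ball (extChartAt (𝓡 (n + 1)) p p) ρ, ∀ a, a ≠ 0 →
      0 < metricHessian (metricForm p) (chartDistSq (n := n) p ∘ (extChartAt (𝓡 (n + 1)) p).symm) y
        (coordGradient p (chartDistSq (n := n) p) y) a a) ∧
    (∀ q ∈ (extChartAt (𝓡 (n + 1)) p).source,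
      extChartAt (𝓡 (n + 1)) p q ∈ Metric.ball (extChartAt (𝓡 (n + 1)) p p) ρ → q ∈ V) := by
  have h1 : ∀ᶠ y in 𝓝 (extChartAt (𝓡 (n + 1)) p p), (extChartAt (𝓡 (n + 1)) p).symm y ∈ V := by
    refine (continuousAt_extChartAt_symm p).eventually ?_
    rw [extChartAt_to_inv]
    exact hV
  have h2 : ∀ᶠ y in 𝓝 (extChartAt (𝓡 (n + 1)) p p), y ∈ (extChartAt (𝓡 (n + 1)) p).target :=
    (isOpen_extChartAt_target p).mem_nhds (mem_extChartAt_target p)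
  obtain ⟨ρ, hρ, h⟩ := Metric.eventually_nhds_iff_ball.1
    (h2.and ((eventually_metricHessian_chartDistSq_pos p).and h1))
  refine ⟨ρ, hρ, fun y hy => (h y hy).1, fun y hy => (h y hy).2.1, fun q hq hqρ => ?_⟩
  have := (h _ hqρ).2.2
  rwa [(extChartAt (𝓡 (n + 1)) p).left_inv hq] at this

end SmallDomain

/-! ### The boundary of a component of the complement -/

theorem frontier_connectedComponentIn_subset {X : Type*} [TopologicalSpace X]
    [LocallyConnectedSpace X] {F : Set X} (hF : IsClosed F) (q : X) :
    frontier (connectedComponentIn Fᶜ q) ⊆ F := by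
  intro p hp
  by_contra hpF
  have ho : IsOpen (connectedComponentIn Fᶜ q) := hF.isOpen_compl.connectedComponentIn
  have hn : connectedComponentIn Fᶜ p ∈ 𝓝 p :=
    hF.isOpen_compl.connectedComponentIn.mem_nhds (mem_connectedComponentIn hpF)
  obtain ⟨z, hz, hz'⟩ := mem_closure_iff_nhds.1 (frontier_subset_closure hp) _ hn
  have h1 : connectedComponentIn Fᶜ q = connectedComponentIn Fᶜ p :=
    (connectedComponentIn_eq hz').trans (connectedComponentIn_eq hz).symm
  rw [ho.frontier_eq] at hp
  refine hp.2 ?_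
  rw [h1]
  exact mem_connectedComponentIn hpF

section Frontier

variable {n : ℕ}
  {M : Type*} [TopologicalSpace M] [ChartedSpace (EuclideanSpace ℝ (Fin (n + 1))) M]
  [RiemannianBundle (fun p : M => TangentSpace (𝓡 (n + 1)) p)]
  {S : Type*} [TopologicalSpace S] [ChartedSpace (EuclideanSpace ℝ (Fin n)) S]
  [IsManifold (𝓡 (n + 1)) ∞ M]

/-- Every component of the complement of the hypersurface has a regular point in its boundary. -/
theorem exists_regularPoint_mem_closure [ConnectedSpace M] {φ : S → M} (hφ : Continuous φ)
    (hreg : Dense (regularPoints φ))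
    (hT : ∀ p ∈ range φ, ∃ T : OrientedSheets (n := n) φ, p ∈ T.W) (hclosed : IsClosed (range φ))
    (hne : (range φ).Nonempty) {q : M} (hq : q ∉ range φ) :
    ∃ x ∈ regularPoints φ, φ x ∈ closure (connectedComponentIn (range φ)ᶜ q) := by
  classical
  have : LocallyConnectedSpace M :=
    ChartedSpace.locallyConnectedSpace (EuclideanSpace ℝ (Fin (n + 1))) M
  set C := connectedComponentIn (range φ)ᶜ q with hC
  have hqC : q ∈ C := mem_connectedComponentIn hq
  have hCφ : C ⊆ (range φ)ᶜ := connectedComponentIn_subset _ _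
  have hCo : IsOpen C := hclosed.isOpen_compl.connectedComponentIn
  have hfr : frontier C ⊆ range φ := frontier_connectedComponentIn_subset hclosed q
  obtain ⟨p₀, hp₀⟩ : (frontier C).Nonempty := by
    by_contra h
    rw [not_nonempty_iff_eq_empty, ← isClopen_iff_frontier_eq_empty] at h
    rcases isClopen_iff.1 h with h | h
    · rw [h] at hqC
      exact hqC
    · obtain ⟨p, hp⟩ := hne
      exact hCφ (h.ge (mem_univ p)) hp
  obtain ⟨T, hTp₀⟩ := hT p₀ (hfr hp₀)
  -- A boundary point in a minimal set of sheets: near such a point, the boundary of the component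
  -- is contained in each of these sheets.
  let J : M → Finset (Fin T.l) := fun z => Finset.univ.filter fun i => T.f i z = 0
  obtain ⟨p, ⟨hp, hpW⟩, hmin⟩ := WellFounded.has_min
    (InvImage.wf (fun z => (J z).card) wellFounded_lt) (frontier C ∩ T.W) ⟨p₀, hp₀, hTp₀⟩
  obtain ⟨y, rfl⟩ := hfr hp
  obtain ⟨i, hyi⟩ := T.exists_mem_U hpW
  set V : Set M := {z | z ∈ T.W ∧ J z ⊆ J (φ y)} with hV
  have hVn : V ∈ 𝓝 (φ y) := by
    have h1 : ∀ j, ∀ᶠ z in 𝓝 (φ y), T.f j z = 0 → T.f j (φ y) = 0 := by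
      intro j
      by_cases h : T.f j (φ y) = 0
      · exact Filter.Eventually.of_forall fun _ _ => h
      · filter_upwards [(T.contMDiffAt j _ hpW).continuousAt.eventually (isOpen_ne.mem_nhds h)]
          with z hz hz'
        exact absurd hz' hz
    filter_upwards [T.isOpen_W.mem_nhds hpW, Filter.eventually_all.2 h1] with z hzW hz
    refine ⟨hzW, fun j hj => ?_⟩
    simp only [J, Finset.mem_filter, Finset.mem_univ, true_and] at hj ⊢
    exact hz j hj
  have hVfr : ∀ z ∈ V, z ∈ frontier C → T.f i z = 0 := by
    intro z hz hzfr
    have h1 : J z = J (φ y) := Finset.eq_of_subset_of_card_le hz.2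
      (not_lt.1 (hmin z ⟨hzfr, hz.1⟩))
    have h2 : i ∈ J (φ y) := by simp [J, T.f_apply hyi]
    rw [← h1] at h2
    simpa [J] using h2
  -- Hence the component contains one of the sides of such a sheet.
  have key : ∀ g : M → ℝ, (∀ z, g z = 0 ↔ T.f i z = 0) →
      (∀ z ∈ T.W, MDifferentiableAt (𝓡 (n + 1)) 𝓘(ℝ) g z ∧
        (T.f i z = 0 → differential (n + 1) g z ≠ 0)) →
      ∀ D ∈ 𝓝 (φ y), D ⊆ V → IsPreconnected (D ∩ {z | 0 < g z}) →
      ((D ∩ {z | 0 < g z}) ∩ C).Nonempty →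
      ∃ x ∈ regularPoints φ, φ x ∈ closure C := by
    intro g hg0 hg D hD hDV hpre hmeet
    have hsub : D ∩ {z | 0 < g z} ⊆ C := by
      refine hpre.subset_left_of_subset_union hCo isClosed_closure.isOpen_compl
        (disjoint_compl_right.mono_left subset_closure) (fun z hz => ?_) hmeet
      by_contra hcon
      rw [mem_union, not_or, notMem_compl_iff] at hcon
      have h1 := hVfr z (hDV hz.1) (hCo.frontier_eq.ge ⟨hcon.2, hcon.1⟩)
      exact hz.2.ne' ((hg0 z).2 h1)
    have hev : ∀ᶠ x in 𝓝 y, D ∈ 𝓝 (φ x) ∧ x ∈ T.U i :=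
      (hφ.continuousAt.eventually (eventually_mem_nhds_iff.2 hD)).and
        ((T.isOpen_U i).mem_nhds hyi)
    obtain ⟨x, hx, hxD, hxi⟩ :=
      ((mem_closure_iff_frequently.1 (hreg y)).and_eventually hev).exists
    refine ⟨x, hx, mem_closure_iff_frequently.2 ?_⟩
    have h0 := T.f_apply hxi
    have h1 := hg _ (T.mem_W hxi)
    refine ((frequently_pos h1.1 ((hg0 _).2 h0) (h1.2 h0)).and_eventually hxD).mono ?_
    exact fun z hz => hsub ⟨hz.2, hz.1⟩
  have hf := T.contMDiffAt i _ hpW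
  have hd := T.differential_ne_zero i _ hpW (T.f_apply hyi)
  obtain ⟨D, hD, hDV, hDpre⟩ := exists_nhds_isPreconnected_pos_manifold
    (hf.of_le (by simp)) (T.f_apply hyi) hd hVn
  obtain ⟨D', hD', hDV', hDpre'⟩ := exists_nhds_isPreconnected_pos_manifold
    (f := fun z => -T.f i z) (hf.of_le (by simp)).neg
    (by rw [T.f_apply hyi, neg_zero]) (by rwa [differential_neg, neg_ne_zero]) hVn
  obtain ⟨z, ⟨hzD, hzD'⟩, hzC⟩ :=
    mem_closure_iff_nhds.1 (frontier_subset_closure hp) _ (Filter.inter_mem hD hD')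
  have hz0 : T.f i z ≠ 0 := fun h => by
    obtain ⟨x, _, rfl⟩ := T.exists_of_f_eq_zero (hDV hzD).1 h
    exact hCφ hzC (mem_range_self x)
  rcases lt_or_gt_of_ne hz0 with h | h
  · exact key (fun z => -T.f i z) (fun z => neg_eq_zero) (fun z hz =>
      ⟨((T.contMDiffAt i z hz).mdifferentiableAt (by simp)).neg, fun h0 => by
        rw [differential_neg, neg_ne_zero]; exact T.differential_ne_zero i z hz h0⟩)
      D' hD' hDV' hDpre' ⟨z, ⟨hzD', neg_pos.2 h⟩, hzC⟩
  · exact key (T.f i) (fun z => Iff.rfl) (fun z hz =>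
      ⟨(T.contMDiffAt i z hz).mdifferentiableAt (by simp), T.differential_ne_zero i z hz⟩)
      D hD hDV hDpre ⟨z, ⟨hzD, h⟩, hzC⟩

omit [IsManifold (𝓡 (n + 1)) ∞ M] in
/-- Near a regular point, the hypersurface consists of a single sheet. -/
theorem OrientedSheets.eventually_mem_range_iff {φ : S → M} (T : OrientedSheets (n := n) φ) {x : S}
    (hx : x ∈ regularPoints φ) {i : Fin T.l} (hxi : x ∈ T.U i) :
    ∀ᶠ z in 𝓝 (φ x), z ∈ range φ ↔ T.f i z = 0 := by
  have hne : ∀ j, ∀ᶠ z in 𝓝 (φ x), j ≠ i → T.f j z ≠ 0 := by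
    intro j
    by_cases hj : j = i
    · exact Filter.Eventually.of_forall fun z h => absurd hj h
    · have h0 : T.f j (φ x) ≠ 0 := by
        intro h
        obtain ⟨y, hy, hyx⟩ := T.exists_of_f_eq_zero (T.mem_W hxi) h
        rw [hx y hyx] at hy
        exact hj (T.eq_of_mem hy hxi)
      filter_upwards [(T.contMDiffAt j _ (T.mem_W hxi)).continuousAt.eventually
        (isOpen_ne.mem_nhds h0)] with z hz _ using hz
  filter_upwards [Filter.eventually_all.2 hne, T.isOpen_W.mem_nhds (T.mem_W hxi)] with z hz hzW
  constructor
  · rintro ⟨y, rfl⟩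
    obtain ⟨j, hj⟩ := T.exists_mem_U hzW
    by_cases hji : j = i
    · exact hji ▸ T.f_apply hj
    · exact absurd (T.f_apply hj) (hz j hji)
  · intro h
    obtain ⟨y, _, rfl⟩ := T.exists_of_f_eq_zero hzW h
    exact mem_range_self y

end Frontier

/-! ### The two sides of the boundary of a measurable set -/

section EssentialInterior

variable {M : Type*} [MetricSpace M] [MeasurableSpace M] [BorelSpace M]

/-- The points which have a neighbourhood contained in `Ω` up to a null set of the `d`-dimensional
volume. -/
def essInterior (d : ℕ) (Ω : Set M) : Set M :=
  {p | ∃ U ∈ 𝓝 p, μHE[d] (U \ Ω) = 0}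

theorem isOpen_essInterior (d : ℕ) (Ω : Set M) : IsOpen (essInterior d Ω) := by
  rw [isOpen_iff_mem_nhds]
  rintro p ⟨U, hU, h⟩
  filter_upwards [eventually_mem_nhds_iff.2 hU] with q hq
  exact ⟨U, hq, h⟩

theorem boundarySupport_eq (d : ℕ) (Ω : Set M) :
    boundarySupport d Ω = (essInterior d Ω ∪ essInterior d Ωᶜ)ᶜ := by
  ext p
  simp only [boundarySupport, essInterior, mem_ofPred_eq, mem_compl_iff, mem_union, not_or,
    not_exists, not_and, sdiff_compl, pos_iff_ne_zero]
  exact ⟨fun h => ⟨fun U hU => (h U hU).2, fun U hU => (h U hU).1⟩,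
    fun h U hU => ⟨h.2 U hU, h.1 U hU⟩⟩

theorem measure_essInterior_diff [SecondCountableTopology M] (d : ℕ) (Ω : Set M) :
    μHE[d] (essInterior d Ω \ Ω) = 0 := by
  refine measure_null_of_locally_null _ fun p hp => ?_
  obtain ⟨U, hU, h⟩ := hp.1
  refine ⟨U ∩ (essInterior d Ω \ Ω), Filter.inter_mem (mem_nhdsWithin_of_mem_nhds hU)
    self_mem_nhdsWithin, measure_mono_null (fun q hq => ?_) h⟩
  exact ⟨hq.1, hq.2.2⟩

variable {n : ℕ} [ChartedSpace (EuclideanSpace ℝ (Fin (n + 1))) M]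

/-- A function whose positive and negative sides lie inside and outside of `Ω` describes `Ω` up to a
null set. -/
theorem pointsInto_of_eventually [SecondCountableTopology M] {Ω Λ : Set M} {p : M} {f : M → ℝ}
    (hf : ContMDiffAt (𝓡 (n + 1)) 𝓘(ℝ) ∞ f p) (hp : f p = 0)
    {w : EuclideanSpace ℝ (Fin (n + 1))} (hw : 0 < differential (n + 1) f p w)
    (hΛ : μHE[n + 1] Λ = 0) (h0 : ∀ᶠ z in 𝓝 p, f z = 0 → z ∈ Λ)
    (h : ∀ᶠ z in 𝓝 p, (0 < f z → z ∈ essInterior (n + 1) Ω) ∧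
      (f z < 0 → z ∈ essInterior (n + 1) Ωᶜ)) :
    PointsInto (n := n) Ω p w := by
  refine ⟨f, hf, hp, hw, _, h0.and h, ?_⟩
  have h1 : ∀ᵐ q ∂(μHE[n + 1] : Measure M), q ∉ essInterior (n + 1) Ω \ Ω :=
    measure_eq_zero_iff_ae_notMem.1 (measure_essInterior_diff _ _)
  have h2 : ∀ᵐ q ∂(μHE[n + 1] : Measure M), q ∉ essInterior (n + 1) Ωᶜ \ Ωᶜ :=
    measure_eq_zero_iff_ae_notMem.1 (measure_essInterior_diff _ _)
  have h3 : ∀ᵐ q ∂(μHE[n + 1] : Measure M), q ∉ Λ := measure_eq_zero_iff_ae_notMem.1 hΛ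
  filter_upwards [h1, h2, h3] with q hq1 hq2 hq3 hq
  have hq0 : f q ≠ 0 := fun h => hq3 (hq.1 h)
  constructor
  · intro hqΩ
    by_contra hneg
    exact hq2 ⟨hq.2.2 (lt_of_le_of_ne (not_lt.1 hneg) hq0), fun h => h hqΩ⟩
  · intro hpos
    by_contra hqΩ
    exact hq1 ⟨hq.2.1 hpos, hqΩ⟩

variable [IsManifold (𝓡 (n + 1)) ∞ M]
  [RiemannianBundle (fun p : M => TangentSpace (𝓡 (n + 1)) p)]
  [IsContMDiffRiemannianBundle (𝓡 (n + 1)) ∞ (EuclideanSpace ℝ (Fin (n + 1)))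
    (fun p : M => TangentSpace (𝓡 (n + 1)) p)]

omit [MeasurableSpace M] [BorelSpace M] in
theorem isContinuousRiemannianBundle_tangentSpace :
    IsContinuousRiemannianBundle (EuclideanSpace ℝ (Fin (n + 1)))
      (fun p : M => TangentSpace (𝓡 (n + 1)) p) := by
  obtain ⟨g, hg, h⟩ := ‹IsContMDiffRiemannianBundle (𝓡 (n + 1)) ∞ (EuclideanSpace ℝ (Fin (n + 1)))
    (fun p : M => TangentSpace (𝓡 (n + 1)) p)›.exists_contMDiff
  exact ⟨g, hg.continuous, h⟩

variable [IsRiemannianManifold (𝓡 (n + 1)) M]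

theorem disjoint_essInterior_compl (Ω : Set M) :
    Disjoint (essInterior (n + 1) Ω) (essInterior (n + 1) Ωᶜ) := by
  rw [Set.disjoint_left]
  rintro p ⟨U, hU, h⟩ ⟨U', hU', h'⟩
  have : IsContinuousRiemannianBundle (EuclideanSpace ℝ (Fin (n + 1)))
      (fun p : M => TangentSpace (𝓡 (n + 1)) p) := isContinuousRiemannianBundle_tangentSpace
  refine (euclideanHausdorffMeasure_pos_of_mem_nhds n (Filter.inter_mem hU hU')).ne' ?_
  refine measure_mono_null (fun q hq => ?_) (measure_union_null h h')
  by_cases hqΩ : q ∈ Ω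
  · exact .inr ⟨hq.2, fun h => h hqΩ⟩
  · exact .inl ⟨hq.1, hqΩ⟩

variable {S : Type*} [TopologicalSpace S] [ChartedSpace (EuclideanSpace ℝ (Fin n)) S]

/-- Near a regular point, `Ω` is one of the sides of the sheet. -/
theorem OrientedSheets.eventually_essInterior_or [SecondCountableTopology M] {φ : S → M}
    (T : OrientedSheets (n := n) φ) {Ω : Set M} (hΩ : range φ = boundarySupport (n + 1) Ω)
    (h0 : μHE[n + 1] (range φ) = 0) {x : S} (hx : x ∈ regularPoints φ) {i : Fin T.l}
    (hxi : x ∈ T.U i) :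
    (∀ᶠ z in 𝓝 (φ x), (0 < T.f i z → z ∈ essInterior (n + 1) Ω) ∧
      (T.f i z < 0 → z ∈ essInterior (n + 1) Ωᶜ)) ∨
    (∀ᶠ z in 𝓝 (φ x), (0 < T.f i z → z ∈ essInterior (n + 1) Ωᶜ) ∧
      (T.f i z < 0 → z ∈ essInterior (n + 1) Ω)) := by
  have hf := T.contMDiffAt i _ (T.mem_W hxi)
  have hd := T.differential_ne_zero i _ (T.mem_W hxi) (T.f_apply hxi)
  have hV := T.eventually_mem_range_iff hx hxi
  -- Each side is connected, and therefore contained in the interior or in the exterior of `Ω`.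
  have key : ∀ g : M → ℝ, (∀ z, 0 < g z → T.f i z ≠ 0) → ∀ D ⊆ {z | z ∈ range φ ↔ T.f i z = 0},
      IsPreconnected (D ∩ {z | 0 < g z}) → D ∩ {z | 0 < g z} ⊆ essInterior (n + 1) Ω ∨
        D ∩ {z | 0 < g z} ⊆ essInterior (n + 1) Ωᶜ := by
    intro g hg D hDV hD
    refine isPreconnected_iff_subset_of_disjoint.1 hD _ _ (isOpen_essInterior _ _)
      (isOpen_essInterior _ _) (fun z hz => ?_) ?_
    · have h1 : z ∉ range φ := fun h => hg z hz.2 ((hDV hz.1).1 h)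
      rw [hΩ, boundarySupport_eq, notMem_compl_iff] at h1
      exact h1
    · rw [(disjoint_essInterior_compl Ω).inter_eq, inter_empty]
  obtain ⟨D, hD, hDV, hDpre⟩ := exists_nhds_isPreconnected_pos_manifold
    (hf.of_le (by simp)) (T.f_apply hxi) hd hV
  obtain ⟨D', hD', hDV', hDpre'⟩ := exists_nhds_isPreconnected_pos_manifold
    (f := fun z => -T.f i z) (hf.of_le (by simp)).neg
    (by rw [T.f_apply hxi, neg_zero]) (by rwa [differential_neg, neg_ne_zero]) hV
  have h1 := key _ (fun z hz => hz.ne') D hDV hDpre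
  have h2 := key _ (fun z hz h => by rw [h, neg_zero] at hz; exact hz.false) D' hDV' hDpre'
  have hmem : φ x ∈ boundarySupport (n + 1) Ω := hΩ ▸ mem_range_self x
  have hmeet := hmem _ (Filter.inter_mem hD hD')
  -- By the definition of the boundary, the two sides are not both inside or both outside.
  have hnull : ∀ E : Set M, D ∩ {z | 0 < T.f i z} ⊆ essInterior (n + 1) E →
      D' ∩ {z | 0 < -T.f i z} ⊆ essInterior (n + 1) E → μHE[n + 1] ((D ∩ D') \ E) = 0 := by
    intro E hE hE'
    refine measure_mono_null (fun z hz => ?_)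
      (measure_union_null h0 (measure_essInterior_diff (n + 1) E))
    rcases lt_trichotomy (T.f i z) 0 with h | h | h
    · exact .inr ⟨hE' ⟨hz.1.2, neg_pos.2 h⟩, hz.2⟩
    · exact .inl ((hDV hz.1.1).2 h)
    · exact .inr ⟨hE ⟨hz.1.1, h⟩, hz.2⟩
  rcases h1 with h1 | h1 <;> rcases h2 with h2 | h2
  · exact absurd (hnull Ω h1 h2) hmeet.2.ne'
  · left
    filter_upwards [hD, hD'] with z hz hz'
    exact ⟨fun h => h1 ⟨hz, h⟩, fun h => h2 ⟨hz', neg_pos.2 h⟩⟩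
  · right
    filter_upwards [hD, hD'] with z hz hz'
    exact ⟨fun h => h1 ⟨hz, h⟩, fun h => h2 ⟨hz', neg_pos.2 h⟩⟩
  · have h3 := hnull Ωᶜ h1 h2
    rw [sdiff_compl] at h3
    exact absurd h3 hmeet.1.ne'

variable [IsManifold (𝓡 n) ∞ S]

/-- The mean curvature vector points into `Ω`, or into its complement. -/
theorem exists_eventually_essInterior [SecondCountableTopology M] {φ : S → M}
    (hφ : ContMDiff (𝓡 n) (𝓡 (n + 1)) ∞ φ) {Ω : Set M}
    (hΩ : range φ = boundarySupport (n + 1) Ω) (h0 : μHE[n + 1] (range φ) = 0)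
    (h : MeanCurvaturePointsInto n φ Ω ∨ MeanCurvaturePointsOutOf n φ Ω) :
    ∃ E : Set M, (E = Ω ∨ E = Ωᶜ) ∧ ∀ (T : OrientedSheets (n := n) φ) (i : Fin T.l),
      ∀ x ∈ T.U i, x ∈ regularPoints φ →
        ∀ᶠ z in 𝓝 (φ x), T.f i z < 0 → z ∈ essInterior (n + 1) Eᶜ := by
  have hsetup : ∀ (T : OrientedSheets (n := n) φ) (i : Fin T.l), ∀ x ∈ T.U i,
      x ∈ regularPoints φ → ∃ w : EuclideanSpace ℝ (Fin (n + 1)),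
        0 < meanCurvature φ x w ∧ IsNormal (n := n) φ x w ∧
        0 < differential (n + 1) (T.f i) (φ x) w ∧ ∀ᶠ z in 𝓝 (φ x), T.f i z = 0 → z ∈ range φ := by
    intro T i x hx hreg
    have hf := T.contMDiffAt i _ (T.mem_W hx)
    obtain ⟨w, hw⟩ := exists_isGradientAt hf
    refine ⟨w, T.meanCurvature_pos i x hx w hw, hw.isNormal ?_,
      hw.differential_pos (T.differential_ne_zero i _ (T.mem_W hx) (T.f_apply hx)), ?_⟩
    · exact differential_pushforward_eq_zero_of_eventually (hφ x) hf (by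
        filter_upwards [(T.isOpen_U i).mem_nhds hx] with z hz using T.f_apply hz)
    · filter_upwards [T.eventually_mem_range_iff hreg hx] with z hz using hz.2
  rcases h with h | h
  · refine ⟨Ω, .inl rfl, fun T i x hx hreg => ?_⟩
    rcases T.eventually_essInterior_or hΩ h0 hreg hx with hside | hside
    · exact hside.mono fun z hz => hz.2
    · obtain ⟨w, hwpos, hwn, hwd, hr⟩ := hsetup T i x hx hreg
      have hn' : IsNormal (n := n) φ x ((-1 : ℝ) • w) := by
        intro v
        have h1 : tangentInner (φ x) (pushforward n φ x v) w = 0 := hwn v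
        have h2 := tangentInner_smul_right (φ x) (-1) (pushforward n φ x v) w
        rw [h1, mul_zero] at h2
        exact h2
      have h1 := h x hreg _ hn' (pointsInto_of_eventually (f := fun z => -T.f i z)
        (T.contMDiffAt i _ (T.mem_W hx)).neg (by rw [T.f_apply hx, neg_zero])
        (by rw [differential_neg]; simpa using hwd) h0
        (by filter_upwards [hr] with z hz hz0 using hz (neg_eq_zero.1 hz0))
        (by filter_upwards [hside] with z hz using
          ⟨fun h => hz.2 (neg_pos.1 h), fun h => hz.1 (neg_neg_iff_pos.1 h)⟩))
      have h2 := meanCurvature_smul (hφ x) (-1) w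
      have h3 := h1.trans_eq h2
      linarith
  · refine ⟨Ωᶜ, .inr rfl, fun T i x hx hreg => ?_⟩
    rcases T.eventually_essInterior_or hΩ h0 hreg hx with hside | hside
    · obtain ⟨w, hwpos, hwn, hwd, hr⟩ := hsetup T i x hx hreg
      have h1 := h x hreg w hwn (pointsInto_of_eventually (T.contMDiffAt i _ (T.mem_W hx))
        (T.f_apply hx) hwd h0 hr hside)
      exact absurd h1 hwpos.le.not_gt
    · rw [compl_compl]
      exact hside.mono fun z hz => hz.2

end EssentialInterior

/-! ### Hypersurfaces with small components -/

section Conclusion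

variable {n : ℕ}
  {M : Type*} [MetricSpace M] [ChartedSpace (EuclideanSpace ℝ (Fin (n + 1))) M]
  [IsManifold (𝓡 (n + 1)) ∞ M]
  [RiemannianBundle (fun p : M => TangentSpace (𝓡 (n + 1)) p)]
  [IsContMDiffRiemannianBundle (𝓡 (n + 1)) ∞ (EuclideanSpace ℝ (Fin (n + 1)))
    (fun p : M => TangentSpace (𝓡 (n + 1)) p)]

/-- On a compact manifold, if all components of the hypersurface are small, then the domains inside
of it are small, too. -/
theorem exists_forall_dist_le (hn : 0 < n) [CompactSpace M] [ConnectedSpace M] [MeasurableSpace M]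
    [BorelSpace M] [IsRiemannianManifold (𝓡 (n + 1)) M] {η : ℝ} (hη : 0 < η) :
    ∃ δ > 0, ∀ (S : Type*) [TopologicalSpace S] [CompactSpace S]
      [ChartedSpace (EuclideanSpace ℝ (Fin n)) S] [IsManifold (𝓡 n) ∞ S] (φ : S → M) (E : Set M),
      IsAlmostEmbedding (n := n) φ → Dense (regularPoints φ) →
      NonvanishingMeanCurvature n φ → (range φ).Nonempty →
      range φ = (essInterior (n + 1) E ∪ essInterior (n + 1) Eᶜ)ᶜ →
      (∀ (T : OrientedSheets (n := n) φ) (i : Fin T.l), ∀ x ∈ T.U i, x ∈ regularPoints φ →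
        ∀ᶠ z in 𝓝 (φ x), T.f i z < 0 → z ∈ essInterior (n + 1) Eᶜ) →
      (∀ x : S, Metric.diam (φ '' connectedComponent x) < δ) →
      ∀ q ∈ essInterior (n + 1) E, ∀ q' ∈ connectedComponentIn (range φ)ᶜ q, dist q q' ≤ η := by
  choose ρ hρ hball hpos hsmall using fun p : M =>
    exists_radius n p (Metric.ball_mem_nhds p (half_pos hη))
  let N : M → Set M := fun p => (extChartAt (𝓡 (n + 1)) p).source ∩
    extChartAt (𝓡 (n + 1)) p ⁻¹' Metric.ball (extChartAt (𝓡 (n + 1)) p p) (ρ p)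
  have hN : ∀ p, IsOpen (N p) := fun p =>
    (continuousOn_extChartAt p).isOpen_inter_preimage (isOpen_extChartAt_source p)
      Metric.isOpen_ball
  obtain ⟨δ, hδ, hleb⟩ := lebesgue_number_lemma_of_metric isCompact_univ hN fun p _ =>
    mem_iUnion.2 ⟨p, mem_extChartAt_source p, Metric.mem_ball_self (hρ p)⟩
  refine ⟨δ, hδ, ?_⟩
  intro S _ _ _ _ φ E hφ hreg hH hne hE hside hdiam q hq q' hq'
  have hT : ∀ p ∈ range φ, ∃ T : OrientedSheets (n := n) φ, p ∈ T.W := fun p hp =>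
    exists_orientedSheets hφ hH hp
  obtain ⟨P, hP⟩ := exists_side hφ hH
  have hφc : Continuous φ := hφ.contMDiff.continuous
  have hclosed : IsClosed (range φ) := (isCompact_range hφc).isClosed
  have hcompl : (range φ)ᶜ = essInterior (n + 1) E ∪ essInterior (n + 1) Eᶜ := by
    rw [hE, compl_compl]
  have hqφ : q ∉ range φ := by
    rw [← mem_compl_iff, hcompl]
    exact .inl hq
  have hqC : q ∈ connectedComponentIn (range φ)ᶜ q := mem_connectedComponentIn hqφ
  have hCφ : connectedComponentIn (range φ)ᶜ q ⊆ (range φ)ᶜ := connectedComponentIn_subset _ _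
  have hCE : connectedComponentIn (range φ)ᶜ q ⊆ essInterior (n + 1) E :=
    isPreconnected_connectedComponentIn.subset_left_of_subset_union (isOpen_essInterior _ _)
      (isOpen_essInterior _ _) (disjoint_essInterior_compl E) (hcompl ▸ hCφ) ⟨q, hqC, hq⟩
  obtain ⟨x, hx, hxC⟩ := exists_regularPoint_mem_closure hφc hreg hT hclosed hne hqφ
  obtain ⟨T, hTx⟩ := hT _ (mem_range_self x)
  obtain ⟨i, hxi⟩ := T.exists_mem_U hTx
  have hfreq : ∃ᶠ z in 𝓝 (φ x), z ∈ connectedComponentIn (range φ)ᶜ q ∧ P x z := by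
    refine ((mem_closure_iff_frequently.1 hxC).and_eventually ((hside T i x hxi hx).and
      ((hP x T i hxi).and (T.eventually_mem_range_iff hx hxi)))).mono ?_
    rintro z ⟨hz, h1, h2, h3⟩
    refine ⟨hz, h2.2 (lt_of_not_ge fun hle => ?_)⟩
    rcases hle.lt_or_eq with h | h
    · exact (disjoint_essInterior_compl E).notMem_of_mem_left (hCE hz) (h1 h)
    · exact hCφ hz (h3.2 h)
  obtain ⟨p, hp⟩ := hleb (φ x) (mem_univ _)
  have hK : ∀ y ∈ connectedComponent x, φ y ∈ N p := by
    intro y hy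
    refine hp (Metric.mem_ball.2 ((Metric.dist_le_diam_of_mem ?_ (mem_image_of_mem φ hy)
      (mem_image_of_mem φ mem_connectedComponent)).trans_lt (hdiam x)))
    exact Metric.isBounded_of_compactSpace
  have hsub := subset_ball_of_frequently hn hφ hreg hT hP (hball p) (hpos p) hx hK
    isPreconnected_connectedComponentIn hCφ hfreq
  have h1 := hsmall p q (hsub q hqC).1 (hsub q hqC).2
  have h2 := hsmall p q' (hsub q' hq').1 (hsub q' hq').2
  have := dist_triangle_right q q' p
  rw [Metric.mem_ball] at h1 h2
  linarith

/-- In dimension `0`, the mean curvature is the trace of an empty matrix. -/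
theorem pos_of_meanCurvature_ne_zero {S : Type*} [TopologicalSpace S]
    [ChartedSpace (EuclideanSpace ℝ (Fin n)) S] {φ : S → M} {x : S}
    {w : EuclideanSpace ℝ (Fin (n + 1))} (h : meanCurvature φ x w ≠ 0) : 0 < n := by
  rcases Nat.eq_zero_or_pos n with rfl | hn
  · exact absurd (Matrix.trace_eq_zero_of_isEmpty _) h
  · exact hn

/-- A set whose measure and whose complement's measure do not vanish has a boundary. -/
theorem boundarySupport_nonempty [ConnectedSpace M] [SecondCountableTopology M]
    [MeasurableSpace M] [BorelSpace M] [IsRiemannianManifold (𝓡 (n + 1)) M] {Ω : Set M}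
    (h : μHE[n + 1] Ω ≠ 0) (h' : μHE[n + 1] Ωᶜ ≠ 0) : (boundarySupport (n + 1) Ω).Nonempty := by
  by_contra hne
  rw [not_nonempty_iff_eq_empty, boundarySupport_eq, compl_empty_iff] at hne
  have hd := disjoint_essInterior_compl (n := n) Ω
  have hclopen : IsClopen (essInterior (n + 1) Ω) := by
    refine ⟨?_, isOpen_essInterior _ _⟩
    rw [← isOpen_compl_iff, (IsCompl.of_eq hd.inter_eq hne).compl_eq]
    exact isOpen_essInterior _ _
  rcases isClopen_iff.1 hclopen with h1 | h1
  · rw [h1, empty_union] at hne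
    have h2 := measure_essInterior_diff (n + 1) Ωᶜ
    rw [hne, sdiff_compl, univ_inter] at h2
    exact h h2
  · have h2 := measure_essInterior_diff (n + 1) Ω
    rw [h1, ← compl_eq_univ_sdiff] at h2
    exact h' h2

end Conclusion

end SmallComponents

open SmallComponents in
theorem proposition6p5 {n : ℕ}
    {M : Type*} [MetricSpace M] [ChartedSpace (EuclideanSpace ℝ (Fin (n + 1))) M]
    [IsManifold (𝓡 (n + 1)) ∞ M]
    [RiemannianBundle (fun p : M => TangentSpace (𝓡 (n + 1)) p)]
    [IsContMDiffRiemannianBundle (𝓡 (n + 1)) ∞ (EuclideanSpace ℝ (Fin (n + 1)))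
      (fun p : M => TangentSpace (𝓡 (n + 1)) p)]
    [IsRiemannianManifold (𝓡 (n + 1)) M]
    [CompactSpace M] [ConnectedSpace M] [MeasurableSpace M] [BorelSpace M] (A : ℝ) :
    ∃ δ : ℝ, 0 < δ ∧
      ∀ (S : Type*) [TopologicalSpace S] [T2Space S] [CompactSpace S]
        [ChartedSpace (EuclideanSpace ℝ (Fin n)) S] [IsManifold (𝓡 n) ∞ S]
        (φ : S → M) (Ω : Set M),
        SmallComponents.IsAlmostEmbedding (n := n) φ →
        MeasurableSet Ω →
        SmallComponents.IsBoundaryOf n φ Ω →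
        SmallComponents.NonvanishingMeanCurvature n φ →
        (SmallComponents.MeanCurvaturePointsInto n φ Ω ∨
          SmallComponents.MeanCurvaturePointsOutOf n φ Ω) →
        μHE[n] (range φ) ≤ ENNReal.ofReal A →
        (1 / 3 : ℝ≥0∞) * μHE[n + 1] (univ : Set M) ≤ μHE[n + 1] Ω →
        μHE[n + 1] Ω ≤ (2 / 3 : ℝ≥0∞) * μHE[n + 1] (univ : Set M) →
        ∃ x : S, δ ≤ Metric.diam (φ '' connectedComponent x) := by
  have : IsContinuousRiemannianBundle (EuclideanSpace ℝ (Fin (n + 1)))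
      (fun p : M => TangentSpace (𝓡 (n + 1)) p) := isContinuousRiemannianBundle_tangentSpace
  have : IsLocallyFiniteMeasure (μHE[n + 1] : Measure M) :=
    isLocallyFiniteMeasure_euclideanHausdorffMeasure n
  set V : ℝ≥0∞ := μHE[n + 1] (univ : Set M) with hV
  have hVtop : V ≠ ⊤ := isCompact_univ.measure_lt_top.ne
  have hV0 : 0 < V := by
    obtain ⟨p⟩ := (inferInstance : Nonempty M)
    exact euclideanHausdorffMeasure_pos_of_mem_nhds n (Filter.univ_mem (f := 𝓝 p))
  have hthird : (1 / 3 : ℝ≥0∞) * V ≠ 0 := mul_ne_zero (by simp) hV0.ne'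
  have hcompl : ∀ Ω : Set M, μHE[n + 1] Ω ≤ (2 / 3 : ℝ≥0∞) * V →
      (1 / 3 : ℝ≥0∞) * V ≤ μHE[n + 1] Ωᶜ := by
    intro Ω h
    have h1 : (2 / 3 : ℝ≥0∞) * V + (1 / 3 : ℝ≥0∞) * V = V := by
      rw [← add_mul, ENNReal.div_add_div_same, show (2 : ℝ≥0∞) + 1 = 3 by norm_num,
        ENNReal.div_self (by simp) (by simp), one_mul]
    have h2 : V ≤ μHE[n + 1] Ω + μHE[n + 1] Ωᶜ := by
      rw [hV, ← union_compl_self Ω]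
      exact measure_union_le _ _
    have h3 : (2 / 3 : ℝ≥0∞) * V ≠ ⊤ := ENNReal.mul_ne_top
      (ENNReal.div_ne_top (by simp) (by simp)) hVtop
    refine (ENNReal.add_le_add_iff_left h3).1 ?_
    rw [h1]
    exact h2.trans (by gcongr)
  rcases Nat.eq_zero_or_pos n with hn | hn
  -- In dimension `0`, there are no points with nonvanishing mean curvature, but `Ω` has a boundary.
  · refine ⟨1, one_pos, ?_⟩
    intro S _ _ _ _ _ φ Ω _ _ hΩ hH _ _ hvol hvol'
    obtain ⟨p, hp⟩ := boundarySupport_nonempty (fun h => hthird (le_zero_iff.1 (h ▸ hvol)))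
      (fun h => hthird (le_zero_iff.1 (h ▸ hcompl Ω hvol')))
    obtain ⟨x, rfl⟩ := hΩ.range_eq.ge hp
    obtain ⟨w, _, hw⟩ := hH x
    exact absurd hn (pos_of_meanCurvature_ne_zero hw).ne'
  obtain ⟨η, hη, hvolume⟩ := euclideanHausdorffMeasure_le_of_small_components (n := n) (M := M)
    (A := ENNReal.ofReal A) (ε := (1 / 4 : ℝ≥0∞) * V) ENNReal.ofReal_ne_top
    (mul_ne_zero (by simp) hV0.ne')
  obtain ⟨δ, hδ, hsmall⟩ := exists_forall_dist_le (M := M) hn hη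
  refine ⟨δ, hδ, ?_⟩
  intro S _ _ _ _ _ φ Ω hφ _ hΩ hH hpoint hA hvol hvol'
  by_contra! hdiam
  have hne : (range φ).Nonempty := by
    rw [hΩ.range_eq]
    exact boundarySupport_nonempty (fun h => hthird (le_zero_iff.1 (h ▸ hvol)))
      (fun h => hthird (le_zero_iff.1 (h ▸ hcompl Ω hvol')))
  -- A set of finite `n`-dimensional area is a null set in dimension `n + 1`.
  have hnull : μHE[n + 1] (range φ) = 0 := by
    rcases Measure.euclideanHausdorffMeasure_zero_or_top (Nat.lt_succ_self n) (range φ) with h | h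
    · exact h
    · rw [h] at hA
      exact absurd hA (by simp)
  obtain ⟨E, hE, hside⟩ := exists_eventually_essInterior hφ.contMDiff hΩ.range_eq hnull hpoint
  have hrange : range φ = (essInterior (n + 1) E ∪ essInterior (n + 1) Eᶜ)ᶜ := by
    rw [hΩ.range_eq, boundarySupport_eq]
    rcases hE with rfl | rfl
    · rfl
    · rw [compl_compl, union_comm]
  have hEvol : (1 / 3 : ℝ≥0∞) * V ≤ μHE[n + 1] E := by
    rcases hE with rfl | rfl
    · exact hvol
    · exact hcompl Ω hvol'
  have h1 := hvolume (range φ) (essInterior (n + 1) E)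
    (isCompact_range hφ.contMDiff.continuous).isClosed hA
    (by rw [hrange, compl_compl]; exact subset_union_left)
    (hsmall S φ E hφ hΩ.multiplicity_one hH hne hrange hside hdiam)
  have h2 : μHE[n + 1] E ≤ μHE[n + 1] (essInterior (n + 1) E) := by
    have h3 : E ⊆ essInterior (n + 1) E ∪ (range φ ∪ (essInterior (n + 1) Eᶜ \ Eᶜ)) := by
      intro q hq
      by_cases hqr : q ∈ range φ
      · exact .inr (.inl hqr)
      · rw [hrange, notMem_compl_iff] at hqr
        rcases hqr with h | h
        · exact .inl h
        · exact .inr (.inr ⟨h, fun h' => h' hq⟩)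
    refine (measure_mono h3).trans ((measure_union_le _ _).trans_eq ?_)
    rw [measure_union_null hnull (measure_essInterior_diff _ _), add_zero]
  have h3 := hEvol.trans (h2.trans h1)
  rw [ENNReal.mul_le_mul_iff_left hV0.ne' hVtop, ← ENNReal.toReal_le_toReal (by simp) (by simp)]
    at h3
  norm_num at h3
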